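/- Let $p$ and $q$ be odd primes with $q-p=2^m$, $m\ge 1$, and let $D=D_1\cdots D_n\ge 1$ be a square-free odd integer with distinct prime factors $D_1,\dots,D_n$, $p\nmid D$, $q\nmid D$, numbered so that $\left(\frac{pq}{D_i}\right)=1$ for $i\le s$ and $\left(\frac{pq}{D_k}\right)=-1$ for $s<k\le n$ (Legendre symbols). Let $E=E_-: y^2=x(x-pD)(x-qD)$ and let $\varphi$ be the 2-isogeny $(x,y)\mapsto\left(y^2/x^2,\ y(pqD^2-x^2)/x^2\right)$ with kernel $\{O,(0,0)\}$ from $E$ to $E': y^2=x^3+2(p+q)Dx^2+4^mD^2x$. Let $S^{(\varphi)}(E/\mathbb{Q})=\ker\left(H^1(\mathbb{Q},E[\varphi])\to\prod_v H^1(\mathbb{Q}_v,E)\right)$, $v$ running over all places of $\mathbb{Q}$. **The graph.** $G(-D)$ is the directed graph with vertices $-1,p,q,D_1,\dots,D_n$ and the following arcs. In all cases it contains $D_i\to D_j$ if $\left(\frac{D_j}{D_i}\right)=-1$ ($i\le s$, $1\le j\le n$); $D_j\to D_i$ if $\left(\frac{D_i}{D_j}\right)=-1$ ($i\le s<j\le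 n$); $l\to D_i$ if $\left(\frac{D_i}{l}\right)=-1$ ($i\le s$, $l=p,q$); $D_i\to p$ if $\left(\frac{p}{D_i}\right)=-1$ ($i\le s$); $D_k\to -1$ if $\left(\frac{-1}{D_k}\right)=-1$ ($1\le k\le n$); $l\to -1$ if $\left(\frac{-1}{l}\right)=-1$ ($l=p,q$). In addition it contains: * Case 1 ($m=1$, $D\equiv1\bmod 4$): the reversed arcs $-1\to D_k$ and $-1\to l$ of the last two kinds. * Case 2 ($m=1$, $D\equiv 3\bmod 4$; or $m=2$, $D\equiv3\bmod 4$, $(p+2)D\not\equiv3\bmod 8$): the arcs $-1\to D_k$ with $\left(\frac{-1}{D_k}\right)=-1$. * Case 3 ($m=2$, $(p+2)D\equiv 3\bmod 8$; or $m\ge3$, $pD\equiv1\bmod 4$): nothing. * Case 4 ($m=2$, $(p+2)D\not\equiv3\bmod8$, $D\equiv1\bmod4$): the arcs $-1\to D_k$ with $\left(\frac{-1}{D_k}\right)=-1$, and the arc $-1\to p$. * Case 5 ($m\ge3$, $pD\equiv3\bmod4$): the arcs $-1\to D_k$ with $\left(\frac{-1}{D_k}\right)=-1$, and $-1\to p$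 if $\left(\frac{-1}{p}\right)=-1$. **Partitions.** Let $(V_1,V_2)$ be an ordered partition of the vertex set into two disjoint, possibly empty parts. For a vertex $P$ let $c(P)$ be the number of arcs from $P$ to vertices of the part not containing $P$. The partition is *even* if $c(P)$ is even for every $P$, and *quasi-even* if for every $P$, $c(P)$ is even when $\left(\frac{2}{P}\right)=1$ and odd when $\left(\frac2P\right)=-1$. Here $\left(\frac2P\right)$ is the Legendre symbol when $P$ is a prime. For $P=-1$ put $\left(\frac{2}{-1}\right)=1$ if one of: $m=1$, $pD\equiv7\bmod8$, $D\equiv1\bmod4$; $m=1$, $pD\equiv1\bmod8$, $D\equiv3\bmod4$; $m=3$, $pD\equiv1\bmod8$; $m\ge4$, $pD\equiv7\bmod8$; $m\ge5$, $pD\equiv1\bmod8$. Put $\left(\frac2{-1}\right)=-1$ if one of: $m=1$, $pD\equiv1\bmod8$, $D\equiv1\bmod4$; $m=1$, $pD\equiv3\bmod8$, $D\equiv3\bmod4$; $m\ge4$, $pD\equiv3\bmod8$. (In the remaining cases quasi-even partitions are not used.) **Theorem.** Let $e$, respectively $e'$, be the number of even, respectively quasi-even, partitions $(V_1,V_2)$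 of $G(-D)$ with $p,q\in V_2$ and $D_k\in V_2$ for all $s<k\le n$. If one of the conditions 1. $m=1$, $pD\equiv5,7\bmod8$ and $D\equiv3\bmod4$; 2. $m=1$, $pD\equiv\pm3\bmod8$ and $D\equiv1\bmod4$; 3. $m=2$; 4. $m=3$, $pD\not\equiv1\bmod8$; 5. $m=4$, $pD\equiv1\bmod4$; 6. $m\ge5$, $pD\equiv5\bmod8$ holds, then $\# S^{(\varphi)}(E/\mathbb{Q})=e$. In all other cases $\# S^{(\varphi)}(E/\mathbb{Q})=e+e'$. -/

import Mathlib

/-! ## Elliptic curves with a rational `2`-torsion point and their `2`-isogenies -/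

namespace TwoIsogeny

open WeierstrassCurve

/-- The Weierstrass curve `y² = x³ + a x² + b x` over `ℚ`. -/
def curve (a b : ℚ) : WeierstrassCurve ℚ := ⟨0, a, 0, b, 0⟩

/-- The curve `y² = x³ - 2 a x² + (a² - 4 b) x`, the target of the `2`-isogeny on `curve a b`. -/
def dualCurve (a b : ℚ) : WeierstrassCurve ℚ := curve (-2 * a) (a ^ 2 - 4 * b)

/-- The group `W(K)` of `K`-rational points of a Weierstrass curve `W` over `ℚ`. -/
abbrev Pt (W : WeierstrassCurve ℚ) (K : Type) [Field K] [Algebra ℚ K] : Type :=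
  (W.baseChange K).toAffine.Point

noncomputable section

open scoped Classical

section Isogeny

variable (a b : ℚ) (K : Type) [Field K] [Algebra ℚ K]

theorem curve_equation_iff (x y : K) :
    ((curve a b).baseChange K).toAffine.Equation x y ↔
      y ^ 2 = x ^ 3 + algebraMap ℚ K a * x ^ 2 + algebraMap ℚ K b * x := by
  rw [Affine.equation_iff]
  simp [curve, WeierstrassCurve.baseChange]

/-- The isogeny `φ : (x, y) ↦ (y² / x², y (b - x²) / x²)` from `y² = x³ + a x² + b x` to
`y² = x³ - 2 a x² + (a² - 4 b) x`, with `φ(O) = φ((0, 0)) = O`, as a map on `K`-points.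
(When `b (a² - 4 b) ≠ 0` the last branch is never reached.) -/
def phi : Pt (curve a b) K → Pt (dualCurve a b) K
  | .zero => .zero
  | .some x y _ =>
    if x = 0 then .zero
    else if h : ((dualCurve a b).baseChange K).toAffine.Nonsingular
        (y ^ 2 / x ^ 2) (y * (algebraMap ℚ K b - x ^ 2) / x ^ 2) then .some _ _ h
    else .zero

/-- The kernel `E[φ] = {O, (0, 0)}` of the isogeny `φ` on `E : y² = x³ + a x² + b x`. -/
def kerPhi : AddSubgroup (Pt (curve a b) K) where
  carrier := {P | P = 0 ∨ ∃ h, P = .some 0 0 h}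
  zero_mem' := Or.inl rfl
  add_mem' := by
    rintro P Q (rfl | ⟨h, rfl⟩) (rfl | ⟨h', rfl⟩)
    · exact Or.inl (add_zero _)
    · exact Or.inr ⟨h', zero_add _⟩
    · exact Or.inr ⟨h, add_zero _⟩
    · refine Or.inl (Affine.Point.add_of_Y_eq rfl ?_)
      simp [Affine.negY, curve, WeierstrassCurve.baseChange]
  neg_mem' := by
    rintro P (rfl | ⟨h, rfl⟩)
    · exact Or.inl neg_zero
    · refine Or.inr ⟨h, ?_⟩
      have h0 : ((curve a b).baseChange K).toAffine.negY 0 0 = 0 := by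
        simp [Affine.negY, curve, WeierstrassCurve.baseChange]
      rw [Affine.Point.neg_some]
      simp only [h0]

/-- `kerPhi` is the kernel of `phi`. -/
theorem mem_kerPhi_iff (hab : b * (a ^ 2 - 4 * b) ≠ 0) (P : Pt (curve a b) K) :
    P ∈ kerPhi a b K ↔ phi a b K P = 0 := by
  rcases P with _ | ⟨x, y, h⟩
  · exact iff_of_true (Or.inl rfl) rfl
  · by_cases hx : x = 0
    · subst hx
      have hy : y = 0 := by
        have := (curve_equation_iff a b K 0 y).1 h.1
        simpa using this
      subst hy
      exact iff_of_true (Or.inr ⟨h, rfl⟩) (if_pos rfl)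
    · refine iff_of_false ?_ ?_
      · rintro (h0 | ⟨_, h0⟩)
        · exact Affine.Point.some_ne_zero h h0
        · exact hx (Affine.Point.some.inj h0).1
      · have : CharZero K := algebraRat.charZero K
        have hA : algebraMap ℚ K b * (algebraMap ℚ K a ^ 2 - 4 * algebraMap ℚ K b) ≠ 0 := by
          have := (map_ne_zero (algebraMap ℚ K)).2 hab
          simpa using this
        have hE := (curve_equation_iff a b K x y).1 h.1
        have hE' : ((dualCurve a b).baseChange K).toAffine.Equation
            (y ^ 2 / x ^ 2) (y * (algebraMap ℚ K b - x ^ 2) / x ^ 2) := by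
          rw [dualCurve, curve_equation_iff]
          simp only [map_mul, map_neg, map_sub, map_pow, map_ofNat]
          field_simp
          rw [hE]
          ring
        have hΔ : ((dualCurve a b).baseChange K).toAffine.Δ ≠ 0 := by
          have h2 : (256 : K) ≠ 0 := by norm_num
          have : ((dualCurve a b).baseChange K).toAffine.Δ = 256 * algebraMap ℚ K b *
              (algebraMap ℚ K a ^ 2 - 4 * algebraMap ℚ K b) ^ 2 := by
            simp [dualCurve, curve, WeierstrassCurve.baseChange, WeierstrassCurve.Δ,
              WeierstrassCurve.b₂, WeierstrassCurve.b₄, WeierstrassCurve.b₆, WeierstrassCurve.b₈]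
            ring
          rw [this]
          exact mul_ne_zero (mul_ne_zero h2 (left_ne_zero_of_mul hA))
            (pow_ne_zero 2 (right_ne_zero_of_mul hA))
        have hN := (Affine.equation_iff_nonsingular_of_Δ_ne_zero hΔ).1 hE'
        simp only [phi, if_neg hx, dif_pos hN]
        exact Affine.Point.some_ne_zero hN

end Isogeny

/-! ## Galois cohomology and the Selmer group -/

section Selmer

/- `Qb` is an algebraic closure of `ℚ`, and `kb` is an algebraic closure of a field `k ⊇ ℚ`. -/
variable {Qb k kb : Type} [Field Qb] [Algebra ℚ Qb] [Normal ℚ Qb]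
  [Field k] [Field kb] [Algebra ℚ k] [Algebra ℚ kb] [Algebra k kb] [IsScalarTower ℚ k kb]

/-- The restriction `Gal(kb/k) → Gal(Qb/ℚ)` attached to an embedding `ι : Qb → kb`. -/
def restrict (ι : Qb →ₐ[ℚ] kb) (σ : kb ≃ₐ[k] kb) : Qb ≃ₐ[ℚ] Qb :=
  letI : Algebra Qb kb := ι.toRingHom.toAlgebra
  haveI : IsScalarTower ℚ Qb kb := IsScalarTower.of_algebraMap_eq fun x => (ι.commutes x).symm
  (σ.restrictScalars ℚ).restrictNormal Qb

theorem apply_restrict (ι : Qb →ₐ[ℚ] kb) (σ : kb ≃ₐ[k] kb) (x : Qb) :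
    ι (restrict ι σ x) = σ (ι x) := by
  let _ : Algebra Qb kb := ι.toRingHom.toAlgebra
  have : IsScalarTower ℚ Qb kb := IsScalarTower.of_algebraMap_eq fun x => (ι.commutes x).symm
  exact (σ.restrictScalars ℚ).restrictNormal_commutes Qb x

/-- The action of `σ ∈ Gal(kb/k)` on `W(kb)`. -/
def galAct (W : WeierstrassCurve ℚ) (σ : kb ≃ₐ[k] kb) : Pt W kb →+ Pt W kb :=
  Affine.Point.map (W' := W) (σ : kb →ₐ[k] kb)

section Cohomology

variable (W : WeierstrassCurve ℚ) (M : AddSubgroup (Pt W Qb))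

/-- Continuous `1`-cocycles of `Gal(Qb/ℚ)` (Krull topology) with values in the discrete
module `M ⊆ W(Qb)`. -/
def cocycles : AddSubgroup ((Qb ≃ₐ[ℚ] Qb) → Pt W Qb) where
  carrier := {ξ | (∀ σ, ξ σ ∈ M) ∧ IsLocallyConstant ξ ∧
    ∀ σ τ, ξ (σ * τ) = ξ σ + galAct W σ (ξ τ)}
  zero_mem' := ⟨fun _ => M.zero_mem, IsLocallyConstant.const 0, fun _ _ => by simp⟩
  add_mem' := by
    rintro ξ η ⟨h₁, h₂, h₃⟩ ⟨k₁, k₂, k₃⟩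
    refine ⟨fun σ => M.add_mem (h₁ σ) (k₁ σ), h₂.add k₂, fun σ τ => ?_⟩
    simp only [Pi.add_apply, h₃, k₃, map_add]
    abel
  neg_mem' := by
    rintro ξ ⟨h₁, h₂, h₃⟩
    refine ⟨fun σ => M.neg_mem (h₁ σ), h₂.neg, fun σ τ => ?_⟩
    simp only [Pi.neg_apply, h₃, map_neg]
    abel

/-- The `1`-coboundaries `σ ↦ σ P - P` with `P ∈ M`. -/
def coboundaries : AddSubgroup ((Qb ≃ₐ[ℚ] Qb) → Pt W Qb) where
  carrier := {ξ | ∃ P ∈ M, ∀ σ, ξ σ = galAct W σ P - P}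
  zero_mem' := ⟨0, M.zero_mem, fun _ => by simp⟩
  add_mem' := by
    rintro ξ η ⟨P, hP, h⟩ ⟨Q, hQ, k⟩
    refine ⟨P + Q, M.add_mem hP hQ, fun σ => ?_⟩
    simp only [Pi.add_apply, h, k, map_add]
    abel
  neg_mem' := by
    rintro ξ ⟨P, hP, h⟩
    refine ⟨-P, M.neg_mem hP, fun σ => ?_⟩
    simp only [Pi.neg_apply, h, map_neg]
    abel

/-- The Galois cohomology group `H¹(ℚ, M)`, for a Galois-stable `M`. -/
abbrev H1 : Type :=
  cocycles W M ⧸ (coboundaries W M).addSubgroupOf (cocycles W M)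

variable (k kb) in
/-- The class of `ξ` becomes trivial in `H¹(k, W)`, that is, the restriction of `ξ` to `Gal(kb/k)`
is the coboundary of a point of `W(kb)`. (For a cocycle `ξ` the condition does not depend on the
embedding `ι : Qb → kb`.) -/
def LocallyTrivial (ξ : (Qb ≃ₐ[ℚ] Qb) → Pt W Qb) : Prop :=
  ∀ ι : Qb →ₐ[ℚ] kb, ∃ P : Pt W kb,
    ∀ σ : kb ≃ₐ[k] kb, Affine.Point.map (W' := W) ι (ξ (restrict ι σ)) = galAct W σ P - P

variable (k kb) in
/-- The cocycles with values in `M` whose class becomes trivial in `H¹(k, W)`. -/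
def locallyTrivialCocycles : AddSubgroup (cocycles W M) where
  carrier := {ξ | LocallyTrivial k kb W ξ.1}
  zero_mem' := fun ι => ⟨0, fun σ => by simp⟩
  add_mem' := by
    intro ξ η h h' ι
    obtain ⟨P, hP⟩ := h ι
    obtain ⟨Q, hQ⟩ := h' ι
    refine ⟨P + Q, fun σ => ?_⟩
    simp only [AddSubgroup.coe_add, Pi.add_apply, map_add, hP, hQ]
    abel
  neg_mem' := by
    intro ξ h ι
    obtain ⟨P, hP⟩ := h ι
    refine ⟨-P, fun σ => ?_⟩
    simp only [AddSubgroup.coe_neg, Pi.neg_apply, map_neg, hP]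
    abel

/-- The Selmer group `ker (H¹(ℚ, M) → ∏_v H¹(ℚ_v, W))`, where `v` runs over all places of `ℚ`:
the classes of the cocycles that are trivial at every prime `l` and at the real place. -/
def selmerGroup : AddSubgroup (H1 W M) :=
  ((⨅ (l : ℕ) (_ : Fact l.Prime), locallyTrivialCocycles ℚ_[l] (AlgebraicClosure ℚ_[l]) W M) ⊓
    locallyTrivialCocycles ℝ (AlgebraicClosure ℝ) W M).map (QuotientAddGroup.mk' _)

end Cohomology

end Selmer

/-- `AlgebraicClosure ℚ` is an algebraic closure of `ℚ` (for the algebra structure that instance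
search finds on a field of characteristic zero). -/
instance isAlgClosureRat : IsAlgClosure ℚ (AlgebraicClosure ℚ) := by
  have h : @IsAlgClosure ℚ (AlgebraicClosure ℚ) _ _ (AlgebraicClosure.instAlgebra ℚ) _ :=
    inferInstance
  convert h
  exact Subsingleton.elim _ _

instance normalRat : Normal ℚ (AlgebraicClosure ℚ) := IsAlgClosure.normal ℚ (AlgebraicClosure ℚ)

/-- The `φ`-Selmer group `S^(φ)(E/ℚ)` of `E : y² = x³ + a x² + b x`. -/
def selmerPhi (a b : ℚ) :
    AddSubgroup (H1 (curve a b) (kerPhi a b (AlgebraicClosure ℚ))) :=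
  selmerGroup (curve a b) (kerPhi a b (AlgebraicClosure ℚ))

end

end TwoIsogeny

/-! ## Even and quasi-even partitions of directed graphs -/

namespace Digraph

variable {V : Type*} (G : Digraph V)

/-- `#{P → A}`, the number of arcs from `P` to vertices in `A`. -/
noncomputable def arcsTo (P : V) (A : Set V) : ℕ := {Q | Q ∈ A ∧ G.Adj P Q}.ncard

/-- `(V₁, V₂)` is an even partition of the vertices of `G` (a part may be empty). -/
def IsEvenPartition (V₁ V₂ : Set V) : Prop :=
  IsCompl V₁ V₂ ∧ (∀ P ∈ V₁, Even (G.arcsTo P V₂)) ∧ (∀ P ∈ V₂, Even (G.arcsTo P V₁))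

/-- `(V₁, V₂)` is a quasi-even partition of the vertices of `G`, where `χ P` is the value
of the symbol `(2 / P)`. -/
def IsQuasiEvenPartition (χ : V → ℤ) (V₁ V₂ : Set V) : Prop :=
  IsCompl V₁ V₂ ∧
    (∀ P ∈ V₁, (χ P = 1 → Even (G.arcsTo P V₂)) ∧ (χ P = -1 → Odd (G.arcsTo P V₂))) ∧
    (∀ P ∈ V₂, (χ P = 1 → Even (G.arcsTo P V₁)) ∧ (χ P = -1 → Odd (G.arcsTo P V₁)))

end Digraph

/-! ## The graph `G(-D)`

For odd primes `l` the Jacobi symbol `jacobiSym a l` is the Legendre symbol `(a / l)`. The primes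
`D_i` with `i ≤ s` are the prime factors `l` of `D` with `(pq / l) = 1`, the primes `D_k` with
`k > s` are those with `(pq / l) = -1`. -/

namespace GraphMinus

/-- The prime factors `D_i`, `1 ≤ i ≤ s`. -/
def plusPrimes (p q D : ℕ) : Finset ℕ := {l ∈ D.primeFactors | jacobiSym (p * q) l = 1}

/-- The prime factors `D_k`, `s < k ≤ n`. -/
def minusPrimes (p q D : ℕ) : Finset ℕ := {l ∈ D.primeFactors | jacobiSym (p * q) l = -1}

/-- The vertices `-1, p, q, D_1, …, D_n`. -/
def vertices (p q D : ℕ) : Finset ℤ :=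
  {-1, (p : ℤ), (q : ℤ)} ∪ D.primeFactors.image (fun l : ℕ => (l : ℤ))

/-- `(l / r) = -1` and `(u, v)` is the arc from `r` to `l`. -/
def ResArc (l : ℤ) (r : ℕ) (u v : ℤ) : Prop := jacobiSym l r = -1 ∧ u = r ∧ v = l

/-- The arcs that all five graphs have in common. -/
def CommonArc (p q D : ℕ) (u v : ℤ) : Prop :=
  (∃ i ∈ plusPrimes p q D, ∃ j ∈ D.primeFactors, ResArc j i u v) ∨
  (∃ i ∈ plusPrimes p q D, ∃ j ∈ minusPrimes p q D, ResArc i j u v) ∨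
  (∃ i ∈ plusPrimes p q D, ResArc i p u v ∨ ResArc i q u v) ∨
  (∃ i ∈ plusPrimes p q D, ResArc p i u v)

/-- The arcs `D_k → -1` with `(-1 / D_k) = -1`. -/
def DToNegOne (D : ℕ) (u v : ℤ) : Prop := ∃ k ∈ D.primeFactors, ResArc (-1) k u v

/-- The arcs `l → -1` with `(-1 / l) = -1`, `l = p, q`. -/
def PQToNegOne (p q : ℕ) (u v : ℤ) : Prop := ResArc (-1) p u v ∨ ResArc (-1) q u v

/-- `G₁(-D)`: an edge without direction stands for the two opposite arcs. -/
def Arc1 (p q D : ℕ) (u v : ℤ) : Prop :=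
  CommonArc p q D u v ∨ (DToNegOne D u v ∨ DToNegOne D v u) ∨
    (PQToNegOne p q u v ∨ PQToNegOne p q v u)

/-- `G₂(-D)`. -/
def Arc2 (p q D : ℕ) (u v : ℤ) : Prop :=
  CommonArc p q D u v ∨ (DToNegOne D u v ∨ DToNegOne D v u) ∨ PQToNegOne p q u v

/-- `G₃(-D)`. -/
def Arc3 (p q D : ℕ) (u v : ℤ) : Prop :=
  CommonArc p q D u v ∨ DToNegOne D u v ∨ PQToNegOne p q u v

/-- `G₄(-D)`. -/
def Arc4 (p q D : ℕ) (u v : ℤ) : Prop :=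
  CommonArc p q D u v ∨ (DToNegOne D u v ∨ DToNegOne D v u) ∨ PQToNegOne p q u v ∨
    (u = -1 ∧ v = p)

/-- `G₅(-D)`. -/
def Arc5 (p q D : ℕ) (u v : ℤ) : Prop :=
  CommonArc p q D u v ∨ (DToNegOne D u v ∨ DToNegOne D v u) ∨ PQToNegOne p q u v ∨
    (jacobiSym (-1) p = -1 ∧ u = -1 ∧ v = p)

/-- The arcs of `G(-D)`; for `m ≥ 1` and `p`, `D` odd exactly one of the five cases applies. -/
def Arc (m p q D : ℕ) (u v : ℤ) : Prop :=
  (m = 1 ∧ D ≡ 1 [MOD 4] ∧ Arc1 p q D u v) ∨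
  (((m = 1 ∧ D ≡ 3 [MOD 4]) ∨
      (m = 2 ∧ D ≡ 3 [MOD 4] ∧ ¬ (p + 2) * D ≡ 3 [MOD 8])) ∧ Arc2 p q D u v) ∨
  (((m = 2 ∧ (p + 2) * D ≡ 3 [MOD 8]) ∨ (3 ≤ m ∧ p * D ≡ 1 [MOD 4])) ∧ Arc3 p q D u v) ∨
  ((m = 2 ∧ ¬ (p + 2) * D ≡ 3 [MOD 8] ∧ D ≡ 1 [MOD 4]) ∧ Arc4 p q D u v) ∨
  ((3 ≤ m ∧ p * D ≡ 3 [MOD 4]) ∧ Arc5 p q D u v)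

/-- The directed graph `G(-D)`. -/
def graph (m p q D : ℕ) : Digraph (vertices p q D) where
  Adj u v := Arc m p q D u v

/-- The value given to the symbol `(2 / -1)`. It is left undefined outside the cases listed here,
which is recorded by the value `0`. -/
def twoOverNegOne (m p D : ℕ) : ℤ :=
  if (m = 1 ∧ p * D ≡ 7 [MOD 8] ∧ D ≡ 1 [MOD 4]) ∨
      (m = 1 ∧ p * D ≡ 1 [MOD 8] ∧ D ≡ 3 [MOD 4]) ∨
      (m = 3 ∧ p * D ≡ 1 [MOD 8]) ∨
      (4 ≤ m ∧ p * D ≡ 7 [MOD 8]) ∨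
      (5 ≤ m ∧ p * D ≡ 1 [MOD 8]) then 1
  else if (m = 1 ∧ p * D ≡ 1 [MOD 8] ∧ D ≡ 1 [MOD 4]) ∨
      (m = 1 ∧ p * D ≡ 3 [MOD 8] ∧ D ≡ 3 [MOD 4]) ∨
      (4 ≤ m ∧ p * D ≡ 3 [MOD 8]) then -1
  else 0

/-- The symbol `(2 / P)` for a vertex `P` of `G(-D)`: the Legendre symbol if `P` is a prime. -/
def twoSymbol (m p q D : ℕ) (P : vertices p q D) : ℤ :=
  if (P : ℤ) = -1 then twoOverNegOne m p D else jacobiSym 2 (P : ℤ).natAbs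

/-- The vertices `p`, `q` and `D_k` (`s < k ≤ n`) lie in `V₂`. -/
def Constraint (p q D : ℕ) (V₂ : Set (vertices p q D)) : Prop :=
  ∀ P : vertices p q D,
    ((P : ℤ) = p ∨ (P : ℤ) = q ∨ ∃ k ∈ minusPrimes p q D, (P : ℤ) = k) → P ∈ V₂

/-- The number of even partitions `(V₁, V₂)` of `G(-D)` with `p, q, D_k ∈ V₂` for `s < k ≤ n`. -/
noncomputable def evenCount (m p q D : ℕ) : ℕ :=
  {V : Set (vertices p q D) × Set (vertices p q D) |
    (graph m p q D).IsEvenPartition V.1 V.2 ∧ Constraint p q D V.2}.ncard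

/-- The number of quasi-even partitions `(V₁, V₂)` of `G(-D)` with `p, q, D_k ∈ V₂`
for `s < k ≤ n`. -/
noncomputable def quasiEvenCount (m p q D : ℕ) : ℕ :=
  {V : Set (vertices p q D) × Set (vertices p q D) |
    (graph m p q D).IsQuasiEvenPartition (twoSymbol m p q D) V.1 V.2 ∧
      Constraint p q D V.2}.ncard

/-- The six conditions on `m`, `p`, `D` under which only even partitions contribute. -/
def OnlyEven (m p D : ℕ) : Prop :=
  (m = 1 ∧ (p * D ≡ 5 [MOD 8] ∨ p * D ≡ 7 [MOD 8]) ∧ D ≡ 3 [MOD 4]) ∨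
  (m = 1 ∧ (p * D ≡ 3 [MOD 8] ∨ p * D ≡ 5 [MOD 8]) ∧ D ≡ 1 [MOD 4]) ∨
  m = 2 ∨
  (m = 3 ∧ ¬ p * D ≡ 1 [MOD 8]) ∨
  (m = 4 ∧ p * D ≡ 1 [MOD 4]) ∨
  (5 ≤ m ∧ p * D ≡ 5 [MOD 8])

end GraphMinus

/-- The Selmer group `S^(φ)(E_ε/ℚ)` of `E_ε : y² = x (x + ε p D) (x + ε q D)`, that is, of
`y² = x³ + (ε p D + ε q D) x² + (ε p D) (ε q D) x`. -/
noncomputable abbrev selmerE (ε : ℤ) (p q D : ℕ) :=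
  TwoIsogeny.selmerPhi (ε * p * D + ε * q * D) ((ε * p * D) * (ε * q * D))

namespace TwoIsogeny

open WeierstrassCurve
open scoped Classical

noncomputable section

/-! ### Points of the curve and translation by the rational 2-torsion point -/

section Points

variable {a b : ℚ} {K L : Type} [Field K] [Algebra ℚ K] [Field L] [Algebra ℚ L]

theorem curve_nonsingular_iff (hab : b * (a ^ 2 - 4 * b) ≠ 0) (x y : K) :
    ((curve a b).baseChange K).toAffine.Nonsingular x y ↔
      y ^ 2 = x ^ 3 + algebraMap ℚ K a * x ^ 2 + algebraMap ℚ K b * x := by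
  have : CharZero K := algebraRat.charZero K
  have hΔ : ((curve a b).baseChange K).toAffine.Δ ≠ 0 := by
    have : ((curve a b).baseChange K).toAffine.Δ = algebraMap ℚ K (16 * b * (b * (a ^ 2 - 4 * b))) := by
      simp [curve, WeierstrassCurve.baseChange, WeierstrassCurve.Δ,
        WeierstrassCurve.b₂, WeierstrassCurve.b₄, WeierstrassCurve.b₆, WeierstrassCurve.b₈]
      ring
    rw [this, map_ne_zero]
    exact mul_ne_zero (mul_ne_zero (by norm_num) (left_ne_zero_of_mul hab)) hab
  rw [← Affine.equation_iff_nonsingular_of_Δ_ne_zero hΔ, curve_equation_iff]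

/-- The point `(0, 0)`, which generates the kernel of the isogeny. -/
def torsionPoint (K : Type) [Field K] [Algebra ℚ K] (hab : b * (a ^ 2 - 4 * b) ≠ 0) :
    Pt (curve a b) K :=
  .some 0 0 ((curve_nonsingular_iff hab 0 0).2 (by simp))

variable (hab : b * (a ^ 2 - 4 * b) ≠ 0)

theorem torsionPoint_ne_zero : torsionPoint K hab ≠ 0 := Affine.Point.some_ne_zero _

theorem mem_kerPhi {P : Pt (curve a b) K} :
    P ∈ kerPhi a b K ↔ P = 0 ∨ P = torsionPoint K hab :=
  ⟨fun h => h.imp_right fun ⟨_, h⟩ => h, fun h => h.imp_right fun h => ⟨_, h⟩⟩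

theorem torsionPoint_add_self : torsionPoint K hab + torsionPoint K hab = 0 := by
  refine Affine.Point.add_of_Y_eq rfl ?_
  simp [Affine.negY, curve, WeierstrassCurve.baseChange]

theorem map_torsionPoint (f : K →ₐ[ℚ] L) :
    Affine.Point.map (W' := curve a b) f (torsionPoint K hab) = torsionPoint L hab := by
  rw [torsionPoint, Affine.Point.map_some, torsionPoint, Affine.Point.some.injEq]
  simp

theorem galAct_torsionPoint {k : Type} [Field k] [Algebra ℚ k] [Algebra k K] [IsScalarTower ℚ k K]
    (σ : K ≃ₐ[k] K) : galAct (curve a b) σ (torsionPoint K hab) = torsionPoint K hab := by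
  rw [galAct, torsionPoint, Affine.Point.map_some, Affine.Point.some.injEq]
  simp

/-- The line through (x, y) and (0, 0) has slope y/x and meets the cubic again at abscissa b/x.
Translation by T therefore changes the sign of y/x, and this sign is what the quadratic character
sees. -/
theorem add_torsionPoint {x y : K} (h : ((curve a b).baseChange K).toAffine.Nonsingular x y)
    (hx : x ≠ 0)
    (h' : ((curve a b).baseChange K).toAffine.Nonsingular
      (algebraMap ℚ K b / x) (-(algebraMap ℚ K b * y / x ^ 2))) :
    Affine.Point.some x y h + torsionPoint K hab = .some _ _ h' := by
  have hE := (curve_equation_iff a b K x y).1 h.1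
  rw [torsionPoint, Affine.Point.add_of_X_ne hx, Affine.Point.some.injEq]
  have e1 : ((curve a b).baseChange K).toAffine.addX x 0
      (((curve a b).baseChange K).toAffine.slope x 0 y 0) = algebraMap ℚ K b / x := by
    rw [Affine.slope_of_X_ne hx]
    simp only [Affine.addX, curve, WeierstrassCurve.baseChange, map_a₁, map_a₂, sub_zero, map_zero]
    field_simp
    linear_combination hE
  refine ⟨e1, ?_⟩
  rw [Affine.addY, Affine.negAddY, e1, Affine.slope_of_X_ne hx]
  simp only [Affine.negY, curve, WeierstrassCurve.baseChange, map_a₁, map_a₃, sub_zero, map_zero]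
  field_simp
  ring

include hab in
theorem nonsingular_translate {x y : K}
    (h : ((curve a b).baseChange K).toAffine.Nonsingular x y) (hx : x ≠ 0) :
    ((curve a b).baseChange K).toAffine.Nonsingular
      (algebraMap ℚ K b / x) (-(algebraMap ℚ K b * y / x ^ 2)) := by
  have hE := (curve_equation_iff a b K x y).1 h.1
  rw [curve_nonsingular_iff hab]
  field_simp
  rw [hE]
  ring

end Points

/-! ### Local triviality of a quadratic character and points on the torsor -/

section Twist

variable {k : Type} [Field k] [Algebra ℚ k]

/-- The torsor attached to `d` under the `2`-isogeny on `y² = x³ + a x² + b x` has a `k`-point. -/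
def TorsorSolvable (k : Type) [Field k] [Algebra ℚ k] (a b d : ℚ) : Prop :=
  IsSquare (algebraMap ℚ k d) ∨ ∃ X : k, X ≠ 0 ∧ IsSquare (algebraMap ℚ k d * X) ∧
    IsSquare (X * (X ^ 2 - 2 * algebraMap ℚ k a * X + algebraMap ℚ k (a ^ 2 - 4 * b)))

variable {Qb kb : Type} [Field Qb] [Algebra ℚ Qb] [Normal ℚ Qb]
  [Field kb] [Algebra ℚ kb] [Algebra k kb] [IsScalarTower ℚ k kb]

variable {a b : ℚ} (hab : b * (a ^ 2 - 4 * b) ≠ 0)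

/-- `ξ` is the quadratic character of `ℚ(s)`, with values in `{O, (0, 0)}`. -/
def IsCharacterOf (ξ : (Qb ≃ₐ[ℚ] Qb) → Pt (curve a b) Qb) (s : Qb) : Prop :=
  ∀ σ, (σ s = s ∧ ξ σ = 0) ∨ (σ s = -s ∧ ξ σ = torsionPoint Qb hab)

theorem galAct_some {σ : kb ≃ₐ[k] kb} {x y : kb}
    (h : ((curve a b).baseChange kb).toAffine.Nonsingular x y) :
    ∃ h', galAct (curve a b) σ (.some x y h) = .some (σ x) (σ y) h' :=
  ⟨_, Affine.Point.map_some _ _⟩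

theorem isSquare_of_fixed [IsGalois k kb] {d : ℚ} {S : kb} (hS : S ^ 2 = algebraMap ℚ kb d)
    (h : ∀ σ : kb ≃ₐ[k] kb, σ S = S) : IsSquare (algebraMap ℚ k d) := by
  obtain ⟨r, hr⟩ := (InfiniteGalois.mem_range_algebraMap_iff_fixed (k := k) S).2 h
  refine ⟨r, (algebraMap k kb).injective ?_⟩
  rw [map_mul, hr, ← sq, hS, ← IsScalarTower.algebraMap_apply]

include hab in
-- If σP - P is the character of S = √d, then w = y/x changes sign exactly when S does, so φ(P) =
-- (w², w(b/x - x)) is a k-point of E' with abscissa in the class of d. The points with xy = 0 are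
-- rational because a² - 4b is a square; for them, as for O, the character is trivial and d is a
-- square in k.
theorem torsorSolvable_of_point [IsGalois k kb] {d c : ℚ} (hd : d ≠ 0)
    (hc : a ^ 2 - 4 * b = c ^ 2) {S : kb} (hS : S ^ 2 = algebraMap ℚ kb d)
    {P : Pt (curve a b) kb}
    (hP : ∀ σ : kb ≃ₐ[k] kb, (σ S = S ∧ galAct (curve a b) σ P = P) ∨
      (σ S = -S ∧ galAct (curve a b) σ P = P + torsionPoint kb hab)) :
    TorsorSolvable k a b d := by
  have : CharZero kb := algebraRat.charZero kb
  have hS0 : S ≠ 0 := by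
    rintro rfl
    exact hd ((algebraMap ℚ kb).injective (by rw [← hS]; simp))
  -- a rational `P` forces `S` to be rational
  have fixed : (∀ σ : kb ≃ₐ[k] kb, galAct (curve a b) σ P = P) → TorsorSolvable k a b d :=
    fun h => Or.inl <| isSquare_of_fixed hS fun σ => by
      rcases hP σ with h1 | h1
      · exact h1.1
      · rw [h σ] at h1
        exact absurd (left_eq_add.1 h1.2) (torsionPoint_ne_zero hab)
  rcases P with _ | ⟨x, y, h⟩
  · exact fixed fun σ => map_zero _
  have hE := (curve_nonsingular_iff hab x y).1 h
  have hQ : ∀ (r : ℚ) (σ : kb ≃ₐ[k] kb), σ (algebraMap ℚ kb r) = algebraMap ℚ kb r := fun r σ => by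
    simp
  by_cases hx : x = 0
  · subst hx
    have hy : y = 0 := by simpa using hE
    subst hy
    exact fixed fun σ => galAct_torsionPoint hab σ
  by_cases hy : y = 0
  · subst hy
    have h0 : x ^ 2 + algebraMap ℚ kb a * x + algebraMap ℚ kb b = 0 := by
      refine (mul_eq_zero.1 (?_ : x * _ = 0)).resolve_left hx
      linear_combination -hE
    have h1 : (2 * x + algebraMap ℚ kb a - algebraMap ℚ kb c) *
        (2 * x + algebraMap ℚ kb a + algebraMap ℚ kb c) = 0 := by
      have := congrArg (algebraMap ℚ kb) hc
      simp only [map_sub, map_mul, map_pow, map_ofNat] at this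
      linear_combination 4 * h0 + this
    have h2 : ∃ r : ℚ, x = algebraMap ℚ kb r := by
      rcases mul_eq_zero.1 h1 with h1 | h1
      · exact ⟨(c - a) / 2, by simp only [map_sub, map_div₀, map_ofNat]; linear_combination h1 / 2⟩
      · exact ⟨(-c - a) / 2, by
          simp only [map_sub, map_div₀, map_ofNat, map_neg]; linear_combination h1 / 2⟩
    obtain ⟨r, rfl⟩ := h2
    refine fixed fun σ => ?_
    obtain ⟨h', e⟩ := galAct_some (σ := σ) h
    rw [e, Affine.Point.some.injEq]
    exact ⟨hQ r σ, map_zero σ⟩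
  · set w := y / x with hw
    have hw0 : w ≠ 0 := div_ne_zero hy hx
    have hact : ∀ σ : kb ≃ₐ[k] kb, (σ S = S ∧ σ x = x ∧ σ y = y) ∨ (σ S = -S ∧
        σ x = algebraMap ℚ kb b / x ∧ σ y = -(algebraMap ℚ kb b * y / x ^ 2)) := fun σ => by
      obtain ⟨h', e⟩ := galAct_some (σ := σ) h
      refine (hP σ).imp (And.imp_right fun h1 => ?_) (And.imp_right fun h1 => ?_)
      · rwa [e, Affine.Point.some.injEq] at h1
      · rwa [e, add_torsionPoint hab h hx (nonsingular_translate hab h hx),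
          Affine.Point.some.injEq] at h1
    have hb : algebraMap ℚ kb b ≠ 0 := (map_ne_zero _).2 (left_ne_zero_of_mul hab)
    have f1 : ∀ σ : kb ≃ₐ[k] kb, σ (w * S) = w * S := fun σ => by
      rcases hact σ with ⟨h1, h2, h3⟩ | ⟨h1, h2, h3⟩
      · rw [map_mul, hw, map_div₀, h1, h2, h3]
      · rw [map_mul, hw, map_div₀, h1, h2, h3]
        field_simp
    have f2 : ∀ σ : kb ≃ₐ[k] kb, σ (w * (algebraMap ℚ kb b / x - x)) =
        w * (algebraMap ℚ kb b / x - x) := fun σ => by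
      rcases hact σ with ⟨h1, h2, h3⟩ | ⟨h1, h2, h3⟩
      · rw [map_mul, hw, map_div₀, map_sub, map_div₀, hQ, h2, h3]
      · rw [map_mul, hw, map_div₀, map_sub, map_div₀, hQ, h2, h3]
        field_simp
        ring
    -- Both coordinates of φ(P) descend to k: w² = e²/d with e = wS, and Y = w(b/x - x).
    obtain ⟨e, he⟩ := (InfiniteGalois.mem_range_algebraMap_iff_fixed (k := k) _).2 f1
    obtain ⟨Y, hY⟩ := (InfiniteGalois.mem_range_algebraMap_iff_fixed (k := k) _).2 f2
    have hd' : algebraMap ℚ k d ≠ 0 := (map_ne_zero _).2 hd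
    have he0 : e ≠ 0 := by
      rintro rfl
      exact mul_ne_zero hw0 hS0 (by rw [← he, map_zero])
    have hXw : algebraMap k kb (e ^ 2 / algebraMap ℚ k d) = w ^ 2 := by
      rw [map_div₀, map_pow, he, ← IsScalarTower.algebraMap_apply, ← hS]
      field_simp
    refine Or.inr ⟨e ^ 2 / algebraMap ℚ k d, div_ne_zero (pow_ne_zero 2 he0) hd',
      ⟨e, by field_simp⟩, Y, (algebraMap k kb).injective ?_⟩
    simp only [map_mul, map_add, map_sub, map_pow, hXw, hY, map_ofNat,
      ← IsScalarTower.algebraMap_apply]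
    rw [hw]
    field_simp
    linear_combination (y ^ 2 + x ^ 3 + algebraMap ℚ kb b * x -
      algebraMap ℚ kb a * x ^ 2) * hE

/-- This inverts φ. With w = e/S, so that w² = X, the point (x, wx) with x = (w² - a - Y/w)/2 lies
above (X, Y). The other root x' of x² - (w² - a)x + b arises by w ↦ -w, and (x', -wx') is the
translate by T since xx' = b. -/
theorem exists_point_of_torsorSolvable {d : ℚ} (hd : d ≠ 0) {S : kb}
    (hS : S ^ 2 = algebraMap ℚ kb d) (h : TorsorSolvable k a b d) :
    ∃ P : Pt (curve a b) kb, ∀ σ : kb ≃ₐ[k] kb,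
      (σ S = S → galAct (curve a b) σ P = P) ∧
      (σ S = -S → galAct (curve a b) σ P = P + torsionPoint kb hab) := by
  have : CharZero kb := algebraRat.charZero kb
  have hS0 : S ≠ 0 := by
    rintro rfl
    exact hd ((algebraMap ℚ kb).injective (by rw [← hS]; simp))
  have hQ : ∀ (r : ℚ) (σ : kb ≃ₐ[k] kb), σ (algebraMap ℚ kb r) = algebraMap ℚ kb r := fun r σ => by
    simp
  rcases h with ⟨r, hr⟩ | ⟨X, hX, ⟨e, he⟩, Y, hY⟩
  · have h1 : S = algebraMap k kb r ∨ S = -algebraMap k kb r := by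
      rw [← sq_eq_sq_iff_eq_or_eq_neg, hS, IsScalarTower.algebraMap_apply ℚ k kb, hr, map_mul, sq]
    refine ⟨0, fun σ => ⟨fun _ => map_zero _, fun h => ?_⟩⟩
    have h2 : σ S = S := by rcases h1 with h1 | h1 <;> simp [h1]
    rw [h2] at h
    exact absurd (self_eq_neg.1 h) hS0
  · have he0 : e ≠ 0 := by
      rintro rfl
      exact mul_ne_zero ((map_ne_zero _).2 hd) hX (by rw [he, mul_zero])
    set A := algebraMap ℚ kb a with hA
    set B := algebraMap ℚ kb b with hB
    set w := algebraMap k kb e / S with hw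
    have hw0 : w ≠ 0 := div_ne_zero ((map_ne_zero _).2 he0) hS0
    have hwX : w ^ 2 = algebraMap k kb X := by
      have := congrArg (algebraMap k kb) he
      rw [map_mul, map_mul, ← IsScalarTower.algebraMap_apply, ← hS] at this
      rw [hw, div_pow, div_eq_iff (pow_ne_zero 2 hS0)]
      linear_combination -this
    set η := algebraMap k kb Y with hη
    have hηw : η ^ 2 = w ^ 2 * (w ^ 4 - 2 * A * w ^ 2 + (A ^ 2 - 4 * B)) := by
      have := congrArg (algebraMap k kb) hY
      simp only [map_mul, map_add, map_sub, map_pow, map_ofNat,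
        ← IsScalarTower.algebraMap_apply] at this
      rw [← hwX] at this
      rw [sq η]
      linear_combination -this
    set x := (w ^ 2 - A - η / w) / 2 with hx
    set x' := (w ^ 2 - A + η / w) / 2 with hx'
    have hxx : x * x' = B := by
      rw [hx, hx']
      field_simp
      linear_combination -hηw
    have hx0 : x ≠ 0 := by
      intro h0
      rw [h0, zero_mul] at hxx
      exact (map_ne_zero _).2 (left_ne_zero_of_mul hab) hxx.symm
    have hsum : x + x' = w ^ 2 - A := by rw [hx, hx']; ring
    have hN : ((curve a b).baseChange kb).toAffine.Nonsingular x (w * x) := by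
      rw [curve_nonsingular_iff hab, ← hA, ← hB, ← hxx]
      linear_combination -x ^ 2 * hsum
    clear_value w η A B
    refine ⟨.some x (w * x) hN, fun σ => ⟨fun h => ?_, fun h => ?_⟩⟩
    · obtain ⟨h', e'⟩ := galAct_some (σ := σ) hN
      have hσw : σ w = w := by rw [hw, map_div₀, AlgEquiv.commutes, h]
      have hσx : σ x = x := by
        rw [hx, map_div₀, map_sub, map_sub, map_pow, map_div₀, hσw, hη, AlgEquiv.commutes, hA, hQ,
          map_ofNat]
      rw [e', Affine.Point.some.injEq, map_mul, hσw, hσx]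
      exact ⟨rfl, rfl⟩
    · obtain ⟨h', e'⟩ := galAct_some (σ := σ) hN
      have hσw : σ w = -w := by rw [hw, map_div₀, AlgEquiv.commutes, h, div_neg]
      have hσx : σ x = x' := by
        rw [hx, map_div₀, map_sub, map_sub, map_pow, map_div₀, hσw, hη, AlgEquiv.commutes, hA, hQ,
          map_ofNat, ← hη, ← hA, hx']
        ring
      rw [e', add_torsionPoint hab hN hx0 (nonsingular_translate hab hN hx0),
        Affine.Point.some.injEq, map_mul, hσw, hσx, ← hB, ← hxx]
      constructor <;> field_simp

/-- Along every embedding the character restricts to that of a square root of d in `kb`, so one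
embedding suffices to find a point on the torsor and a point on the torsor serves them all. -/
theorem locallyTrivial_iff [IsGalois k kb] [IsAlgClosed kb] {d c : ℚ}
    (hd : d ≠ 0) (hc : a ^ 2 - 4 * b = c ^ 2) {s : Qb} (hs : s ^ 2 = algebraMap ℚ Qb d)
    {ξ : (Qb ≃ₐ[ℚ] Qb) → Pt (curve a b) Qb} (hξ : IsCharacterOf hab ξ s) :
    LocallyTrivial k kb (curve a b) ξ ↔ TorsorSolvable k a b d := by
  have hS : ∀ ι : Qb →ₐ[ℚ] kb, (ι s) ^ 2 = algebraMap ℚ kb d := fun ι => by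
    rw [← map_pow, hs, AlgHom.commutes]
  have key : ∀ (ι : Qb →ₐ[ℚ] kb) (σ : kb ≃ₐ[k] kb),
      (σ (ι s) = ι s ∧ Affine.Point.map (W' := curve a b) ι (ξ (restrict ι σ)) = 0) ∨
      (σ (ι s) = -ι s ∧
        Affine.Point.map (W' := curve a b) ι (ξ (restrict ι σ)) = torsionPoint kb hab) := by
    intro ι σ
    rw [← apply_restrict]
    refine (hξ (restrict ι σ)).imp ?_ ?_ <;> rintro ⟨h1, h2⟩
    · rw [h1, h2, map_zero]
      exact ⟨rfl, rfl⟩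
    · rw [h1, h2, map_torsionPoint, map_neg]
      exact ⟨rfl, rfl⟩
  constructor
  · intro h
    obtain ⟨P, hP⟩ := h (IsAlgClosed.lift (R := ℚ))
    refine torsorSolvable_of_point hab hd hc (hS IsAlgClosed.lift) (P := P) fun σ => ?_
    have hPσ := hP σ
    refine (key IsAlgClosed.lift σ).imp ?_ ?_ <;> rintro ⟨h1, h2⟩ <;> rw [h2] at hPσ
    · exact ⟨h1, sub_eq_zero.1 hPσ.symm⟩
    · exact ⟨h1, by rw [hPσ]; abel⟩
  · intro h ι
    obtain ⟨P, hP⟩ := exists_point_of_torsorSolvable hab hd (hS ι) h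
    refine ⟨P, fun σ => ?_⟩
    rcases key ι σ with ⟨h1, h2⟩ | ⟨h1, h2⟩ <;> rw [h2]
    · rw [(hP σ).1 h1, sub_self]
    · rw [(hP σ).2 h1]
      abel

end Twist

end

end TwoIsogeny

/-! ### Square-free representatives of ℚˣ/ℚˣ² -/

/-- All exponents are 0 or 1, and two such exponents with even sum coincide. -/
theorem Nat.eq_of_squarefree_of_isSquare_mul {x y : ℕ} (hx : Squarefree x) (hy : Squarefree y)
    (h : IsSquare (x * y)) : x = y := by
  refine Nat.eq_of_factorization_eq hx.ne_zero hy.ne_zero fun l => ?_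
  obtain ⟨r, hr⟩ := h
  have hr0 : r ≠ 0 := by
    rintro rfl
    exact mul_ne_zero hx.ne_zero hy.ne_zero hr
  have h1 := congrArg (fun n => n.factorization l) hr
  simp only [Nat.factorization_mul hx.ne_zero hy.ne_zero, Nat.factorization_mul hr0 hr0,
    Finsupp.add_apply] at h1
  have h2 := hx.natFactorization_le_one l
  have h3 := hy.natFactorization_le_one l
  omega

theorem Int.eq_of_squarefree_of_isSquare_mul {x y : ℤ} (hx : Squarefree x) (hy : Squarefree y)
    (h : IsSquare (x * y)) : x = y := by
  have h1 : x.natAbs = y.natAbs := by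
    refine Nat.eq_of_squarefree_of_isSquare_mul (Int.squarefree_natAbs.2 hx)
      (Int.squarefree_natAbs.2 hy) ?_
    obtain ⟨r, hr⟩ := h
    exact ⟨r.natAbs, by rw [← Int.natAbs_mul, hr, Int.natAbs_mul]⟩
  rcases Int.natAbs_eq_natAbs_iff.1 h1 with h2 | h2
  · exact h2
  · have h3 := h.nonneg
    have h4 : y = 0 := by
      rw [h2] at h3
      exact pow_eq_zero_iff (two_ne_zero) |>.1 (by nlinarith [sq_nonneg y])
    exact absurd h4 hy.ne_zero

theorem Rat.exists_squarefree_mul_sq {d : ℚ} (hd : d ≠ 0) :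
    ∃ (n : ℤ) (t : ℚ), Squarefree n ∧ t ≠ 0 ∧ d = n * t ^ 2 := by
  -- The integer num · den differs from d by the square of the denominator.
  obtain ⟨u, v, h, hu⟩ := Nat.sq_mul_squarefree (d.num * d.den).natAbs
  have hN : d.num * d.den ≠ 0 :=
    mul_ne_zero (Rat.num_ne_zero.2 hd) (Int.natCast_ne_zero.2 d.den_ne_zero)
  have hden : (d.den : ℚ) ≠ 0 := Nat.cast_ne_zero.2 d.den_ne_zero
  have hv : v ≠ 0 := by
    rintro rfl
    exact hN (Int.natAbs_eq_zero.1 (by rw [← h]; simp))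
  have hdd : d = ((d.num * d.den : ℤ) : ℚ) / (d.den : ℚ) ^ 2 := by
    push_cast
    rw [eq_div_iff (pow_ne_zero 2 hden), sq, ← mul_assoc, Rat.mul_den_eq_num]
  have hvd : (v : ℚ) / d.den ≠ 0 := div_ne_zero (Nat.cast_ne_zero.2 hv) hden
  rcases Int.natAbs_eq (d.num * d.den) with e | e
  · refine ⟨u, v / d.den, Int.squarefree_natCast.2 hu, hvd, hdd.trans ?_⟩
    rw [e, ← h]
    push_cast
    ring
  · refine ⟨-u, v / d.den, ?_, hvd, hdd.trans ?_⟩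
    · rw [← Int.squarefree_natAbs, Int.natAbs_neg, Int.natAbs_natCast]
      exact hu
    · rw [e, ← h]
      push_cast
      ring

/-! ### H¹ of the kernel as quadratic characters, and the Selmer group as a set of integers -/

namespace TwoIsogeny

open WeierstrassCurve
open scoped Classical

noncomputable section

variable {a b : ℚ} (hab : b * (a ^ 2 - 4 * b) ≠ 0)
variable {Qb : Type} [Field Qb] [Algebra ℚ Qb]

theorem galAct_of_mem_kerPhi {P : Pt (curve a b) Qb} (hP : P ∈ kerPhi a b Qb)
    (hab : b * (a ^ 2 - 4 * b) ≠ 0) (σ : Qb ≃ₐ[ℚ] Qb) : galAct (curve a b) σ P = P := by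
  rcases (mem_kerPhi hab).1 hP with rfl | rfl
  · exact map_zero _
  · exact galAct_torsionPoint hab σ

/-- The quadratic character of `ℚ(s)`, with values in `{O, (0, 0)}`. -/
def character (s : Qb) (σ : Qb ≃ₐ[ℚ] Qb) : Pt (curve a b) Qb :=
  if σ s = s then 0 else torsionPoint Qb hab

theorem apply_eq_or_eq_neg {s : Qb} {d : ℚ} (hs : s ^ 2 = algebraMap ℚ Qb d)
    (σ : Qb ≃ₐ[ℚ] Qb) : σ s = s ∨ σ s = -s := by
  rw [← sq_eq_sq_iff_eq_or_eq_neg, ← map_pow, hs, AlgEquiv.commutes]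

theorem isCharacterOf_character {s : Qb} {d : ℚ} (hs : s ^ 2 = algebraMap ℚ Qb d) :
    IsCharacterOf hab (character hab s) s := fun σ => by
  by_cases h : σ s = s
  · exact Or.inl ⟨h, if_pos h⟩
  · exact Or.inr ⟨(apply_eq_or_eq_neg hs σ).resolve_left h, if_neg h⟩

theorem IsCharacterOf.unique {ξ η : (Qb ≃ₐ[ℚ] Qb) → Pt (curve a b) Qb} {s : Qb} (hs : s ≠ 0)
    (hξ : IsCharacterOf hab ξ s) (hη : IsCharacterOf hab η s) : ξ = η := by
  have : CharZero Qb := algebraRat.charZero Qb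
  funext σ
  rcases hξ σ with h | h <;> rcases hη σ with h' | h'
  · rw [h.2, h'.2]
  · exact absurd (self_eq_neg.1 (h.1.symm.trans h'.1)) hs
  · exact absurd (self_eq_neg.1 (h'.1.symm.trans h.1)) hs
  · rw [h.2, h'.2]

theorem IsCharacterOf.mul {ξ η : (Qb ≃ₐ[ℚ] Qb) → Pt (curve a b) Qb} {s t : Qb}
    (hξ : IsCharacterOf hab ξ s) (hη : IsCharacterOf hab η t) :
    IsCharacterOf hab (ξ + η) (s * t) := fun σ => by
  rcases hξ σ with h | h <;> rcases hη σ with h' | h' <;>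
    simp [h.1, h.2, h'.1, h'.2, torsionPoint_add_self]

theorem IsCharacterOf.mul_rat {ξ : (Qb ≃ₐ[ℚ] Qb) → Pt (curve a b) Qb} {s : Qb}
    (hξ : IsCharacterOf hab ξ s) (r : ℚ) :
    IsCharacterOf hab ξ (s * algebraMap ℚ Qb r) := fun σ => by
  rcases hξ σ with h | h <;> simp [h.1, h.2]

/-- Continuity holds because the stabiliser of s is open and the character is constant on its
cosets. -/
theorem IsCharacterOf.mem_cocycles [Algebra.IsIntegral ℚ Qb]
    {ξ : (Qb ≃ₐ[ℚ] Qb) → Pt (curve a b) Qb} {s : Qb} (hs : s ≠ 0)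
    (hξ : IsCharacterOf hab ξ s) : ξ ∈ cocycles (curve a b) (kerPhi a b Qb) := by
  have hchar : CharZero Qb := algebraRat.charZero Qb
  have hmem : ∀ σ, ξ σ ∈ kerPhi a b Qb := fun σ =>
    (mem_kerPhi hab).2 ((hξ σ).imp And.right And.right)
  have hcoc : ∀ σ τ, ξ (σ * τ) = ξ σ + ξ τ := fun σ τ => by
    have hne : s ≠ -s := fun h => hs (self_eq_neg.1 h)
    rcases hξ σ with h | h <;> rcases hξ τ with h' | h' <;> rcases hξ (σ * τ) with h'' | h'' <;>
      have h3 := h''.1 <;> rw [AlgEquiv.mul_apply, h'.1] at h3 <;>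
      simp [h.1, h.2, h'.2, h''.2, torsionPoint_add_self, hne, hne.symm] at h3 ⊢
  refine ⟨hmem, ?_, fun σ τ => by rw [hcoc, galAct_of_mem_kerPhi (hmem τ) hab]⟩
  rw [IsLocallyConstant.iff_exists_open]
  intro σ
  have hopen := stabilizer_isOpen_of_isIntegral (K := ℚ) s
  refine ⟨(fun τ => σ⁻¹ * τ) ⁻¹' (MulAction.stabilizer (Qb ≃ₐ[ℚ] Qb) s : Set (Qb ≃ₐ[ℚ] Qb)),
    hopen.preimage (continuous_const_mul _), ?_, fun τ hτ => ?_⟩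
  · simp
  · have h1 : (σ⁻¹ * τ) s = s := hτ
    have h2 : ξ (σ⁻¹ * τ) = 0 := by
      rcases hξ (σ⁻¹ * τ) with h | h
      · exact h.2
      · exact absurd (self_eq_neg.1 (h1.symm.trans h.1)) hs
    rw [← mul_inv_cancel_left σ τ, hcoc, h2, add_zero]

/-- Kummer theory for exponent two. A cocycle is a continuous homomorphism to a group of order 2,
with closed kernel H. For τ outside H choose α fixed by H and moved by τ: then α - τα changes sign
according to ξ, and its square is rational. -/
theorem exists_isCharacterOf [IsGalois ℚ Qb] {ξ : (Qb ≃ₐ[ℚ] Qb) → Pt (curve a b) Qb}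
    (hξ : ξ ∈ cocycles (curve a b) (kerPhi a b Qb)) :
    ∃ (s : Qb) (d : ℚ), d ≠ 0 ∧ s ^ 2 = algebraMap ℚ Qb d ∧ IsCharacterOf hab ξ s := by
  have hchar : CharZero Qb := algebraRat.charZero Qb
  obtain ⟨hmem, hloc, hcoc⟩ := hξ
  replace hcoc : ∀ σ τ, ξ (σ * τ) = ξ σ + ξ τ := fun σ τ => by
    rw [hcoc, galAct_of_mem_kerPhi (hmem τ) hab]
  have hval : ∀ σ, ξ σ = 0 ∨ ξ σ = torsionPoint Qb hab := fun σ => (mem_kerPhi hab).1 (hmem σ)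
  have h1 : ξ 1 = 0 := by simpa using hcoc 1 1
  have hinv : ∀ σ, ξ σ⁻¹ = ξ σ := fun σ => by
    have h2 : ξ σ + ξ σ = 0 := by
      rcases hval σ with h | h <;> simp [h, torsionPoint_add_self]
    have h3 := hcoc σ σ⁻¹
    rw [mul_inv_cancel, h1, ← h2] at h3
    exact (add_left_cancel h3).symm
  let H : Subgroup (Qb ≃ₐ[ℚ] Qb) :=
    { carrier := {σ | ξ σ = 0}
      one_mem' := h1
      mul_mem' := fun {σ τ} hσ hτ => by
        rw [Set.mem_ofPred_eq] at *
        rw [hcoc, hσ, hτ, add_zero]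
      inv_mem' := fun {σ} hσ => by
        rw [Set.mem_ofPred_eq] at *
        rw [hinv, hσ] }
  have hmemH : ∀ σ, σ ∈ H ↔ ξ σ = 0 := fun σ => Iff.rfl
  by_cases htop : ∀ σ, ξ σ = 0
  · exact ⟨1, 1, one_ne_zero, by simp, fun σ => Or.inl ⟨map_one σ, htop σ⟩⟩
  push Not at htop
  obtain ⟨τ, hτ⟩ := htop
  have hclosed : IsClosed (H : Set (Qb ≃ₐ[ℚ] Qb)) := (hloc.isClosed_fiber 0)
  have hfix := InfiniteGalois.fixingSubgroup_fixedField (⟨H, hclosed⟩ : ClosedSubgroup (Qb ≃ₐ[ℚ] Qb))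
  -- By the Galois correspondence for the closed subgroup H, an automorphism that fixes everything
  -- fixed by H lies in H.
  have hα : ∃ α : Qb, (∀ σ ∈ H, σ α = α) ∧ τ α ≠ α := by
    by_contra! hcon
    apply hτ
    rw [← hmemH]
    change τ ∈ (⟨H, hclosed⟩ : ClosedSubgroup (Qb ≃ₐ[ℚ] Qb)).1
    rw [← hfix, IntermediateField.mem_fixingSubgroup_iff]
    intro x hx
    exact hcon x fun σ hσ => (IntermediateField.mem_fixedField_iff _ _).1 hx σ hσ
  obtain ⟨α, hα, hατ⟩ := hα
  have hτT : ξ τ = torsionPoint Qb hab := (hval τ).resolve_left hτ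
  have hact : ∀ σ, (σ (α - τ α) = α - τ α ∧ ξ σ = 0) ∨
      (σ (α - τ α) = -(α - τ α) ∧ ξ σ = torsionPoint Qb hab) := fun σ => by
    refine (hval σ).imp (fun h => ⟨?_, h⟩) fun h => ⟨?_, h⟩
    · have h2 : (τ⁻¹ * σ * τ) α = α := hα _ (by
        rw [hmemH, hcoc, hcoc, hinv, h, hτT, add_zero, torsionPoint_add_self])
      have h3 : σ (τ α) = τ α := by
        have := congrArg τ h2
        simpa [AlgEquiv.mul_apply] using this
      rw [map_sub, hα σ h, h3]
    · have h2 : (τ⁻¹ * σ) α = α := hα _ (by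
        rw [hmemH, hcoc, hinv, h, hτT, torsionPoint_add_self])
      have h3 : σ α = τ α := by
        have := congrArg τ h2
        simpa [AlgEquiv.mul_apply] using this
      have h4 : (σ * τ) α = α := hα _ (by
        rw [hmemH, hcoc, h, hτT, torsionPoint_add_self])
      rw [map_sub, h3, ← AlgEquiv.mul_apply, h4, neg_sub]
  have hβ : α - τ α ≠ 0 := sub_ne_zero.2 hατ.symm
  obtain ⟨d, hd⟩ := (InfiniteGalois.mem_range_algebraMap_iff_fixed (k := ℚ) ((α - τ α) ^ 2)).2
    fun σ => by
      rw [map_pow]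
      rcases hact σ with h | h <;> rw [h.1]
      rw [neg_sq]
  refine ⟨α - τ α, d, ?_, hd.symm, hact⟩
  rintro rfl
  rw [map_zero] at hd
  exact pow_ne_zero 2 hβ hd.symm

/-- The torsor attached to `d` has points at every place of `ℚ`. -/
def EverywhereSolvable (a b d : ℚ) : Prop :=
  (∀ (l : ℕ) [Fact l.Prime], TorsorSolvable ℚ_[l] a b d) ∧ TorsorSolvable ℝ a b d

theorem exists_sqrt [IsAlgClosed Qb] (d : ℚ) : ∃ s : Qb, s ^ 2 = algebraMap ℚ Qb d :=
  IsAlgClosed.exists_pow_nat_eq _ two_pos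

theorem isSquare_rat_of_fixed [IsGalois ℚ Qb] {d e : ℚ} {s t : Qb}
    (hs : s ^ 2 = algebraMap ℚ Qb d) (ht : t ^ 2 = algebraMap ℚ Qb e)
    {ξ : (Qb ≃ₐ[ℚ] Qb) → Pt (curve a b) Qb}
    (h : IsCharacterOf hab ξ s) (h' : IsCharacterOf hab ξ t) : IsSquare (d * e) := by
  have hfix : ∀ σ : Qb ≃ₐ[ℚ] Qb, σ (s * t) = s * t := fun σ => by
    have := torsionPoint_ne_zero (K := Qb) hab
    rcases h σ with h1 | h1 <;> rcases h' σ with h2 | h2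
    · rw [map_mul, h1.1, h2.1]
    · exact absurd (h2.2.symm.trans h1.2) this
    · exact absurd (h1.2.symm.trans h2.2) this
    · rw [map_mul, h1.1, h2.1, neg_mul_neg]
  exact isSquare_of_fixed (k := ℚ) (kb := Qb) (d := d * e) (S := s * t)
    (by rw [mul_pow, hs, ht, map_mul]) hfix

theorem coboundary_eq_zero {ξ : (Qb ≃ₐ[ℚ] Qb) → Pt (curve a b) Qb}
    (hab : b * (a ^ 2 - 4 * b) ≠ 0)
    (h : ξ ∈ coboundaries (curve a b) (kerPhi a b Qb)) : ξ = 0 := by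
  obtain ⟨P, hP, h⟩ := h
  funext σ
  rw [h, galAct_of_mem_kerPhi hP hab, sub_self, Pi.zero_apply]

theorem mk_injective (hab : b * (a ^ 2 - 4 * b) ≠ 0) :
    Function.Injective (QuotientAddGroup.mk' ((coboundaries (curve a b)
      (kerPhi a b Qb)).addSubgroupOf (cocycles (curve a b) (kerPhi a b Qb)))) := by
  rw [← AddMonoidHom.ker_eq_bot_iff, QuotientAddGroup.ker_mk', eq_bot_iff]
  intro η hη
  exact Subtype.ext (coboundary_eq_zero hab hη)

theorem mem_selmerGroup_mk_iff [IsGalois ℚ Qb] {c : ℚ} (hc : a ^ 2 - 4 * b = c ^ 2)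
    {s : Qb} {d : ℚ} (hd : d ≠ 0)
    (hs : s ^ 2 = algebraMap ℚ Qb d) (ξ : cocycles (curve a b) (kerPhi a b Qb))
    (hξ : IsCharacterOf hab ξ.1 s) :
    (QuotientAddGroup.mk' _ ξ : H1 (curve a b) (kerPhi a b Qb)) ∈
      selmerGroup (curve a b) (kerPhi a b Qb) ↔ EverywhereSolvable a b d := by
  have hinj := mk_injective (Qb := Qb) hab
  rw [selmerGroup, AddSubgroup.mem_map_iff_mem hinj, AddSubgroup.mem_inf]
  refine and_congr ?_ ?_
  · simp only [AddSubgroup.mem_iInf]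
    exact forall_congr' fun l => forall_congr' fun hl => locallyTrivial_iff hab hd hc hs hξ
  · exact locallyTrivial_iff hab hd hc hs hξ

include hab in
-- The characters of √n with n square-free exhaust H¹. Two equal ones make the product of their
-- integers a square, which forces the integers to agree.
theorem card_selmerGroup [IsGalois ℚ Qb] [IsAlgClosed Qb] {c : ℚ} (hc : a ^ 2 - 4 * b = c ^ 2) :
    Nat.card (selmerGroup (curve a b) (kerPhi a b Qb)) =
      {n : ℤ | Squarefree n ∧ EverywhereSolvable a b n}.ncard := by
  have hchar : CharZero Qb := algebraRat.charZero Qb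
  choose s hs using exists_sqrt (Qb := Qb)
  have hs0 : ∀ d, d ≠ 0 → s d ≠ 0 := fun d hd h0 => hd ((algebraMap ℚ Qb).injective (by
    rw [← hs, h0, map_zero]; simp))
  have hinj := mk_injective (Qb := Qb) hab
  have hchr : ∀ d : ℚ, IsCharacterOf hab (character hab (s d)) (s d) := fun d =>
    isCharacterOf_character hab (hs d)
  let ξ : ∀ n : ℤ, Squarefree n → cocycles (curve a b) (kerPhi a b Qb) := fun n hn =>
    ⟨character hab (s n), (hchr n).mem_cocycles hab (hs0 _ (Int.cast_ne_zero.2 hn.ne_zero))⟩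
  symm
  rw [← Nat.card_coe_set_eq]
  refine Nat.card_congr (Equiv.ofBijective
    (fun n : {n : ℤ | Squarefree n ∧ EverywhereSolvable a b n} =>
      (⟨QuotientAddGroup.mk' _ (ξ n.1 n.2.1), ?_⟩ :
        selmerGroup (curve a b) (kerPhi a b Qb))) ⟨?_, ?_⟩)
  · exact (mem_selmerGroup_mk_iff hab hc (Int.cast_ne_zero.2 n.2.1.ne_zero) (hs _) _ (hchr _)).2
      n.2.2
  · rintro ⟨n, hn, hn'⟩ ⟨n', hm, hm'⟩ h
    have h1 : ξ n hn = ξ n' hm := hinj (congrArg Subtype.val h)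
    have h2 : character hab (s n) = character hab (s n') := congrArg Subtype.val h1
    have h3 := isSquare_rat_of_fixed hab (hs n) (hs n') (hchr _) (h2 ▸ hchr n')
    have h4 : IsSquare (n * n') := by
      rw [← Rat.isSquare_intCast_iff]
      exact_mod_cast h3
    exact Subtype.ext (Int.eq_of_squarefree_of_isSquare_mul hn hm h4)
  · rintro ⟨x, hx⟩
    obtain ⟨η, rfl⟩ := QuotientAddGroup.mk'_surjective _ x
    obtain ⟨t, d, hd, ht, hη⟩ := exists_isCharacterOf hab η.2
    obtain ⟨n, r, hn, hr, hdn⟩ := Rat.exists_squarefree_mul_sq hd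
    have hn0 : (n : ℚ) ≠ 0 := Int.cast_ne_zero.2 hn.ne_zero
    have hη' : IsCharacterOf hab η.1 (s n) := by
      have h1 := hη.mul_rat hab r⁻¹
      have h2 : (t * algebraMap ℚ Qb r⁻¹) ^ 2 = s n ^ 2 := by
        rw [mul_pow, ht, hs, ← map_pow, ← map_mul, hdn]
        congr 1
        field_simp
      -- The square root of n obtained from t may be the negative of the chosen one; both have the
      -- same character.
      rcases sq_eq_sq_iff_eq_or_eq_neg.1 h2 with h3 | h3
      · rwa [h3] at h1
      · rw [h3] at h1
        simpa using h1.mul_rat hab (-1)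
    have hξη : ξ n hn = η := Subtype.ext ((hchr n).unique hab (hs0 _ hn0) hη')
    refine ⟨⟨n, hn, (mem_selmerGroup_mk_iff hab hc hn0 (hs _) _ hη').1 hx⟩, ?_⟩
    exact Subtype.ext (congrArg (QuotientAddGroup.mk' _) hξη)

include hab in
-- If P and Q trivialise two characters, then P + Q trivialises their product. Passing through
-- cocycles avoids the addition formulas on E'.
theorem TorsorSolvable.mul {k : Type} [Field k] [Algebra ℚ k] {c : ℚ} (hc : a ^ 2 - 4 * b = c ^ 2)
    {d e : ℚ} (hd : d ≠ 0) (he : e ≠ 0) (h : TorsorSolvable k a b d)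
    (h' : TorsorSolvable k a b e) : TorsorSolvable k a b (d * e) := by
  have : CharZero k := algebraRat.charZero k
  let Qb := AlgebraicClosure ℚ
  let kb := AlgebraicClosure k
  obtain ⟨s, hs⟩ := exists_sqrt (Qb := Qb) d
  obtain ⟨t, ht⟩ := exists_sqrt (Qb := Qb) e
  have hst : (s * t) ^ 2 = algebraMap ℚ Qb (d * e) := by rw [mul_pow, hs, ht, map_mul]
  have h1 := isCharacterOf_character hab hs
  have h2 := isCharacterOf_character hab ht
  rw [← locallyTrivial_iff (kb := kb) hab hd hc hs h1] at h
  rw [← locallyTrivial_iff (kb := kb) hab he hc ht h2] at h'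
  rw [← locallyTrivial_iff (kb := kb) hab (mul_ne_zero hd he) hc hst (h1.mul hab h2)]
  intro ι
  obtain ⟨P, hP⟩ := h ι
  obtain ⟨Q, hQ⟩ := h' ι
  refine ⟨P + Q, fun σ => ?_⟩
  rw [Pi.add_apply, map_add, map_add, hP, hQ]
  abel

include hab in
theorem card_selmerPhi {c : ℚ} (hc : a ^ 2 - 4 * b = c ^ 2) :
    Nat.card (selmerPhi a b) = {n : ℤ | Squarefree n ∧ EverywhereSolvable a b n}.ncard :=
  card_selmerGroup hab hc

end

end TwoIsogeny

/-! ### A character sum over a finite field -/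

section FiniteField

open Finset

variable {F : Type*} [Field F] [Fintype F] [DecidableEq F]

/-- The hyperbola (t - y)(t + y) = c has |F| - 1 points, parametrised by u = t + y ≠ 0, and each t
carries 1 + χ(t² - c) of them. -/
theorem quadraticChar_sum_sq_sub (hF : ringChar F ≠ 2) {c : F} (hc : c ≠ 0) :
    ∑ t : F, quadraticChar F (t ^ 2 - c) = -1 := by
  have h2 : (2 : F) ≠ 0 := Ring.two_ne_zero hF
  have h1 : ∑ t : F, (quadraticChar F (t ^ 2 - c) + 1) =
      (#{z : F × F | z.2 ^ 2 = z.1 ^ 2 - c} : ℤ) := by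
    have h3 : #{z : F × F | z.2 ^ 2 = z.1 ^ 2 - c} = ∑ t : F, #{y : F | y ^ 2 = t ^ 2 - c} := by
      simp only [card_filter, Fintype.sum_prod_type]
    rw [h3, Nat.cast_sum]
    refine sum_congr rfl fun t _ => ?_
    rw [← quadraticChar_card_sqrts hF, Set.toFinset_ofPred]
  have h4 : #{z : F × F | z.2 ^ 2 = z.1 ^ 2 - c} = #(univ.erase (0 : F)) := by
    refine card_bij' (fun z _ => z.1 + z.2) (fun u _ => ((u + c / u) / 2, (u - c / u) / 2))
      ?_ ?_ ?_ ?_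
    · rintro ⟨t, y⟩ h
      simp only [mem_filter, mem_univ, true_and, mem_erase, and_true] at h ⊢
      intro h0
      exact hc (by linear_combination h - (y - t) * h0)
    · intro u hu
      simp only [mem_filter, mem_univ, true_and, mem_erase, and_true] at hu ⊢
      field_simp
      ring
    · rintro ⟨t, y⟩ h
      simp only [mem_filter, mem_univ, true_and] at h ⊢
      have h0 : t + y ≠ 0 := fun h0 => hc (by linear_combination h - (y - t) * h0)
      have h5 : c / (t + y) = t - y := by
        rw [div_eq_iff h0]
        linear_combination h
      rw [h5]
      ext <;> field_simp <;> ring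
    · intro u hu
      simp only [mem_erase, mem_univ, and_true] at hu
      field_simp
      ring
  rw [h4, card_erase_of_mem (mem_univ _), card_univ, Nat.cast_sub Fintype.card_pos,
    sum_add_distrib] at h1
  simp only [sum_const, card_univ, nsmul_eq_mul, mul_one, Nat.cast_one] at h1
  linarith

/-- A conic bundle `x = square, (x + A)² - c = square` twisted by a non-square has points. -/
theorem exists_not_isSquare_of_quadratic (hF : ringChar F ≠ 2) {A c e : F} (hc : c ≠ 0)
    (he : e ≠ 0) (hA : A ^ 2 - c = e ^ 2) :
    ∃ x : F, ¬ IsSquare x ∧ ((x + A) ^ 2 = c ∨ ¬ IsSquare ((x + A) ^ 2 - c)) := by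
  -- Otherwise (1 - χ(x))(1 - χ((x + A)² - c)) vanishes for every x; at x = 0 this holds because A²
  -- - c = e² is a nonzero square. But its sum is |F| + 1 + ∑ χ(x((x + A)² - c)), and the trivial
  -- bound on the last term makes this at least 1.
  by_contra! hcon
  have hχ : ∀ x : F, (1 - quadraticChar F x) * (1 - quadraticChar F ((x + A) ^ 2 - c)) = 0 := by
    intro x
    by_cases hx : IsSquare x
    · by_cases hx0 : x = 0
      · have : quadraticChar F (e ^ 2) = 1 := quadraticChar_sq_one' he
        simp [hx0, hA, this]
      · rw [(quadraticChar_one_iff_isSquare hx0).2 hx, sub_self, zero_mul]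
    · obtain ⟨h1, h2⟩ := hcon x hx
      rw [(quadraticChar_one_iff_isSquare (sub_ne_zero.2 h1)).2 h2, sub_self, mul_zero]
  have h1 := sum_eq_zero fun x (_ : x ∈ univ) => hχ x
  have h2 : ∑ x : F, quadraticChar F ((x + A) ^ 2 - c) = -1 := by
    rw [← quadraticChar_sum_sq_sub hF hc]
    exact Fintype.sum_equiv (Equiv.addRight A) _ _ fun _ => rfl
  have h3 : ∀ x : F, 1 - quadraticChar F x - quadraticChar F ((x + A) ^ 2 - c) - (-1) ≤
      (1 - quadraticChar F x) * (1 - quadraticChar F ((x + A) ^ 2 - c)) + 2 := fun x => by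
    have : (-1 : ℤ) ≤ quadraticChar F (x * ((x + A) ^ 2 - c)) := by
      rcases quadraticChar_isQuadratic F (x * ((x + A) ^ 2 - c)) with h | h | h <;> rw [h] <;> simp
    rw [map_mul] at this
    linarith
  have h4 : ∑ x : F, (1 - quadraticChar F x) * (1 - quadraticChar F ((x + A) ^ 2 - c)) =
      Fintype.card F - ∑ x : F, quadraticChar F x - ∑ x : F, quadraticChar F ((x + A) ^ 2 - c) +
        ∑ x : F, quadraticChar F (x * ((x + A) ^ 2 - c)) := by
    rw [show (Fintype.card F : ℤ) = ∑ _x : F, (1 : ℤ) by simp, ← sum_sub_distrib,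
      ← sum_sub_distrib, ← sum_add_distrib]
    refine sum_congr rfl fun x _ => ?_
    rw [map_mul]
    ring
  have h5 : -(Fintype.card F : ℤ) ≤ ∑ x : F, quadraticChar F (x * ((x + A) ^ 2 - c)) := by
    rw [show -(Fintype.card F : ℤ) = ∑ _x : F, (-1 : ℤ) by simp]
    refine sum_le_sum fun x _ => ?_
    rcases quadraticChar_isQuadratic F (x * ((x + A) ^ 2 - c)) with h | h | h <;> rw [h] <;> simp
  rw [h1, h2, quadraticChar_sum_zero hF] at h4
  linarith

end FiniteField

/-! ### Squares in fields and in ℚ_l -/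

theorem IsSquare.of_mul_right {k : Type*} [Field k] {x y : k} (h : IsSquare (x * y))
    (hy : IsSquare y) (hy0 : y ≠ 0) : IsSquare x := by
  have := h.div hy
  rwa [mul_div_cancel_right₀ _ hy0] at this

theorem IsSquare.of_mul_left {k : Type*} [Field k] {x y : k} (h : IsSquare (x * y))
    (hx : IsSquare x) (hx0 : x ≠ 0) : IsSquare y :=
  IsSquare.of_mul_right (mul_comm x y ▸ h) hx hx0

namespace Padic

variable {l : ℕ} [hl : Fact l.Prime]

/-- Hensel's lemma for the polynomial T² - x at T = 1, where the derivative is 2. For l = 2 the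
hypothesis means x ≡ 1 mod 8. -/
theorem isSquare_of_norm_sub_one_lt {x : ℚ_[l]} (h : ‖x - 1‖ < ‖(4 : ℚ_[l])‖) : IsSquare x := by
  have h4 : ‖(4 : ℚ_[l])‖ ≤ 1 := by
    have := Padic.norm_int_le_one (p := l) 4
    exact_mod_cast this
  have hx : ‖x‖ ≤ 1 := by
    have := Padic.nonarchimedean (x - 1) 1
    rw [sub_add_cancel, norm_one] at this
    exact this.trans (max_le (h.le.trans h4) le_rfl)
  let z : ℤ_[l] := ⟨x, hx⟩
  have key : ‖(Polynomial.X ^ 2 - Polynomial.C z : Polynomial ℤ_[l]).aeval (1 : ℤ_[l])‖ <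
      ‖(Polynomial.X ^ 2 - Polynomial.C z : Polynomial ℤ_[l]).derivative.aeval (1 : ℤ_[l])‖ ^ 2 := by
    have e1 : (Polynomial.X ^ 2 - Polynomial.C z : Polynomial ℤ_[l]).aeval (1 : ℤ_[l]) = 1 - z := by
      simp
    have e2 : (Polynomial.X ^ 2 - Polynomial.C z : Polynomial ℤ_[l]).derivative.aeval (1 : ℤ_[l]) =
        2 := by
      simp
      norm_num
    rw [e1, e2, ← norm_pow, norm_sub_rev]
    norm_num
    exact h
  obtain ⟨y, hy, -⟩ := hensels_lemma key
  refine ⟨y, ?_⟩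
  have h1 : y ^ 2 - z = 0 := by simpa using hy
  have h2 := congrArg (fun w : ℤ_[l] => (w : ℚ_[l])) (sub_eq_zero.1 h1)
  simp only [PadicInt.coe_pow] at h2
  rw [← sq, h2]

theorem isSquare_of_norm_sub_sq_lt {x y : ℚ_[l]} (h : ‖x - y ^ 2‖ < ‖4 * y ^ 2‖) : IsSquare x := by
  have hy : y ≠ 0 := by
    rintro rfl
    rw [zero_pow two_ne_zero, mul_zero, norm_zero] at h
    exact absurd h (norm_nonneg _).not_gt
  have hy2 : y ^ 2 ≠ 0 := pow_ne_zero 2 hy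
  have h1 : IsSquare (x / y ^ 2) := by
    apply isSquare_of_norm_sub_one_lt
    rw [div_sub_one hy2, norm_div, div_lt_iff₀ (norm_pos_iff.2 hy2), ← norm_mul]
    exact h
  have h2 := h1.mul (IsSquare.sq y)
  rwa [div_mul_cancel₀ _ hy2] at h2

theorem even_valuation_of_isSquare {x : ℚ_[l]} (hx : x ≠ 0) (h : IsSquare x) :
    Even x.valuation := by
  obtain ⟨r, rfl⟩ := h
  rw [Padic.valuation_mul (left_ne_zero_of_mul hx) (left_ne_zero_of_mul hx)]
  exact ⟨_, rfl⟩

theorem valuation_eq_zero_of_norm_eq_one {x : ℚ_[l]} (h : ‖x‖ = 1) : x.valuation = 0 := by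
  have hx : x ≠ 0 := by
    rintro rfl
    simp at h
  rw [Padic.norm_eq_zpow_neg_valuation hx] at h
  have h1 : (1 : ℝ) < l := by exact_mod_cast hl.out.one_lt
  have := (zpow_eq_one_iff_right₀ (by positivity) h1.ne').1 h
  omega

theorem not_isSquare_prime_mul {u : ℚ_[l]} (hu : ‖u‖ = 1) : ¬ IsSquare ((l : ℚ_[l]) * u) := by
  have hl0 : (l : ℚ_[l]) ≠ 0 := Nat.cast_ne_zero.2 hl.out.ne_zero
  have hu0 : u ≠ 0 := by
    rintro rfl
    simp at hu
  intro h
  have := even_valuation_of_isSquare (mul_ne_zero hl0 hu0) h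
  rw [Padic.valuation_mul hl0 hu0, Padic.valuation_p, valuation_eq_zero_of_norm_eq_one hu] at this
  exact absurd this (by decide)

theorem norm_intCast_eq_one_of_not_dvd {n : ℤ} (hn : ¬ (l : ℤ) ∣ n) : ‖(n : ℚ_[l])‖ = 1 :=
  le_antisymm (Padic.norm_int_le_one n) (not_lt.1 fun h => hn (Padic.norm_intCast_lt_one_iff.1 h))

variable (hl2 : l ≠ 2)

include hl2

theorem norm_two_eq_one : ‖(2 : ℚ_[l])‖ = 1 := by
  have h := (Padic.norm_natCast_eq_one_iff (p := l) (n := 2)).2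
    ((Nat.coprime_primes hl.out Nat.prime_two).2 hl2)
  exact_mod_cast h

theorem norm_four_eq_one : ‖(4 : ℚ_[l])‖ = 1 := by
  have : (4 : ℚ_[l]) = 2 * 2 := by norm_num
  rw [this, norm_mul, norm_two_eq_one hl2, mul_one]

theorem isSquare_of_norm_sub_sq_lt_one {x y : ℚ_[l]} (hy : ‖y‖ = 1) (h : ‖x - y ^ 2‖ < 1) :
    IsSquare x := by
  apply isSquare_of_norm_sub_sq_lt (y := y)
  rwa [norm_mul, norm_four_eq_one hl2, norm_pow, hy, one_pow, mul_one]

theorem isSquare_intCast_iff {n : ℤ} (hn : ¬ (l : ℤ) ∣ n) :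
    IsSquare (n : ℚ_[l]) ↔ IsSquare (n : ZMod l) := by
  have hn1 := norm_intCast_eq_one_of_not_dvd hn
  constructor
  · rintro ⟨r, hr⟩
    have hr1 : ‖r‖ = 1 := by
      rw [hr, norm_mul] at hn1
      nlinarith [norm_nonneg r]
    let z : ℤ_[l] := ⟨r, hr1.le⟩
    have : z * z = (n : ℤ_[l]) := PadicInt.ext (by
      rw [PadicInt.coe_mul, PadicInt.coe_intCast, hr])
    exact ⟨PadicInt.toZMod z, by rw [← map_mul, this, map_intCast]⟩
  · rintro ⟨r, hr⟩
    obtain ⟨m, rfl⟩ := ZMod.intCast_surjective r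
    have h1 : ‖((n - m ^ 2 : ℤ) : ℚ_[l])‖ < 1 := by
      rw [Padic.norm_intCast_lt_one_iff, ← ZMod.intCast_zmod_eq_zero_iff_dvd]
      push_cast
      rw [hr]
      ring
    have hm1 : ‖(m : ℚ_[l])‖ = 1 := by
      refine le_antisymm (Padic.norm_int_le_one m) (not_lt.1 fun h => hn ?_)
      rw [Padic.norm_intCast_lt_one_iff, ← ZMod.intCast_zmod_eq_zero_iff_dvd] at h
      rw [← ZMod.intCast_zmod_eq_zero_iff_dvd, hr, h, mul_zero]
    exact isSquare_of_norm_sub_sq_lt_one hl2 hm1 (by exact_mod_cast h1)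

end Padic

/-! ### The torsors of the curve with roots 0, pD, qD, and the real place -/

/-- The torsor attached to `d` under the `2`-isogeny on `y² = x (x - p D) (x - q D)` has a
`k`-point. -/
def LocalPoint (k : Type) [Field k] (p q D d : ℤ) : Prop :=
  IsSquare (d : k) ∨ ∃ X : k, X ≠ 0 ∧ IsSquare (d * X) ∧
    IsSquare (X * ((X + (p + q) * D) ^ 2 - 4 * (p * q * D ^ 2)))

namespace LocalPoint

theorem iff_torsorSolvable {k : Type} [Field k] [Algebra ℚ k] {p q D d : ℤ} :
    TwoIsogeny.TorsorSolvable k (-(p + q) * D) (p * q * D ^ 2) d ↔ LocalPoint k p q D d := by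
  unfold TwoIsogeny.TorsorSolvable LocalPoint
  simp only [map_mul, map_neg, map_add, map_intCast, map_sub, map_pow, map_ofNat]
  refine or_congr Iff.rfl (exists_congr fun X => and_congr Iff.rfl (and_congr Iff.rfl ?_))
  rw [iff_iff_eq]
  congr 1
  ring

theorem swap {k : Type} [Field k] {p q D d : ℤ} (h : LocalPoint k p q D d) :
    LocalPoint k q p D d := by
  refine h.imp_right fun ⟨X, h1, h2, h3⟩ => ⟨X, h1, h2, ?_⟩
  rwa [add_comm (q : k), mul_comm (q : k)]

theorem mul {k : Type} [Field k] [CharZero k] {p q D d e : ℤ} (hp : p ≠ 0) (hq : q ≠ 0)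
    (hpq : p ≠ q) (hD : D ≠ 0) (hd : d ≠ 0) (he : e ≠ 0)
    (h : LocalPoint k p q D d) (h' : LocalPoint k p q D e) : LocalPoint k p q D (d * e) := by
  rw [← iff_torsorSolvable] at *
  have e1 : (-(p + q) * D : ℚ) ^ 2 - 4 * (p * q * D ^ 2) = (((q - p) * D : ℤ) : ℚ) ^ 2 := by
    push_cast
    ring
  push_cast
  refine TwoIsogeny.TorsorSolvable.mul ?_ e1 (Int.cast_ne_zero.2 hd) (Int.cast_ne_zero.2 he) h h'
  rw [e1]
  exact_mod_cast mul_ne_zero (mul_ne_zero (mul_ne_zero hp hq) (pow_ne_zero 2 hD))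
    (pow_ne_zero 2 (mul_ne_zero (sub_ne_zero.2 hpq.symm) hD))

/-- The `2`-torsion points of the isogenous curve lie in the class of `-p D`. -/
theorem of_torsion {k : Type} [Field k] [CharZero k] {p q D d : ℤ} (hp : p ≠ 0) (hpq : p ≠ q)
    (hD : D ≠ 0) (hs : IsSquare ((p : k) * q)) (h : IsSquare (-(p * D * d) : k)) :
    LocalPoint k p q D d := by
  obtain ⟨r, hr⟩ := hs
  have hp' : (p : k) ≠ 0 := Int.cast_ne_zero.2 hp
  have hD' : (D : k) ≠ 0 := Int.cast_ne_zero.2 hD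
  have hpr : (p : k) - r ≠ 0 := by
    intro h0
    rw [← sub_eq_zero.1 h0] at hr
    exact hpq (Int.cast_injective (mul_left_cancel₀ hp' hr)).symm
  have e1 : (p : k) * (p + q - 2 * r) = (p - r) ^ 2 := by linear_combination hr
  have e2 : (p + q - 2 * r : k) ≠ 0 := fun h0 => pow_ne_zero 2 hpr (by rw [← e1, h0, mul_zero])
  -- A root of the quadratic factor; p(p + q - 2r) = (p - r)² puts it in the class of -pD.
  refine Or.inr ⟨-(D * (p + q - 2 * r)), neg_ne_zero.2 (mul_ne_zero hD' e2), ?_, ?_⟩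
  · obtain ⟨s, hs⟩ := h
    refine ⟨s * (p - r) / p, ?_⟩
    field_simp
    linear_combination (p - r : k) ^ 2 * hs - p * d * D * e1
  · refine ⟨0, ?_⟩
    linear_combination 4 * D ^ 3 * (p + q - 2 * r) * hr

theorem real {p q D d : ℤ} (hp : 0 < p) (hq : 0 < q) (hD : 0 < D) (hd : d ≠ 0) :
    LocalPoint ℝ p q D d := by
  have hp' : (0 : ℝ) < p := Int.cast_pos.2 hp
  have hq' : (0 : ℝ) < q := Int.cast_pos.2 hq
  have hD' : (0 : ℝ) < D := Int.cast_pos.2 hD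
  rcases lt_or_gt_of_ne hd with hd | hd
  · have hd' : (d : ℝ) < 0 := Int.cast_lt_zero.2 hd
    -- The centre of the quadratic factor: there X and the factor -4pqD² are both negative.
    refine Or.inr ⟨-((p + q) * D), ?_, Real.isSquare_iff.2 ?_, Real.isSquare_iff.2 ?_⟩
    · exact neg_ne_zero.2 (by positivity)
    · rw [mul_neg, ← neg_mul]
      have : 0 ≤ -(d : ℝ) := by linarith
      positivity
    · have : (-(((p : ℝ) + q) * D)) * ((-((p + q) * D) + (p + q) * D) ^ 2 - 4 * (p * q * D ^ 2)) =
          (p + q) * D * (4 * (p * q * D ^ 2)) := by ring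
      rw [this]
      positivity
  · exact Or.inl (Real.isSquare_iff.2 (Int.cast_nonneg hd.le))

/-! ### Solubility at the odd primes -/

section Odd

variable {l : ℕ} [hl : Fact l.Prime] {p q D d : ℤ}

theorem _root_.Padic.isSquare_and_ne_zero (hl2 : l ≠ 2) {x y : ℚ_[l]}
    (h : ‖x - y ^ 2‖ < ‖y ^ 2‖) : IsSquare x ∧ x ≠ 0 := by
  refine ⟨Padic.isSquare_of_norm_sub_sq_lt (y := y) ?_, ?_⟩
  · rwa [norm_mul, Padic.norm_four_eq_one hl2, one_mul]
  · rintro rfl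
    rw [zero_sub, norm_neg] at h
    exact lt_irrefl _ h

theorem _root_.Padic.norm_add_lt {x y : ℚ_[l]} {r : ℝ} (hx : ‖x‖ < r) (hy : ‖y‖ < r) :
    ‖x + y‖ < r := (Padic.nonarchimedean x y).trans_lt (max_lt hx hy)

theorem _root_.Padic.norm_add_le {x y : ℚ_[l]} {r : ℝ} (hx : ‖x‖ ≤ r) (hy : ‖y‖ ≤ r) :
    ‖x + y‖ ≤ r := (Padic.nonarchimedean x y).trans (max_le hx hy)

/-- Put X = DY. If |Y| < 1 the factor (Y + p + q)² - 4pq is close to the unit square (q - p)², and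
if |Y| > 1 it is close to Y². Either way it is a nonzero square, so DY and with it d are squares. A
non-square d thus needs a unit Y. -/
theorem exists_norm_eq_one (hl2 : l ≠ 2) (hpq : ¬ (l : ℤ) ∣ q - p) (hD : D ≠ 0)
    (h : LocalPoint ℚ_[l] p q D d) : IsSquare (d : ℚ_[l]) ∨
      ∃ Y : ℚ_[l], ‖Y‖ = 1 ∧ IsSquare (d * (D * Y)) ∧
        IsSquare (D * Y * ((Y + (p + q)) ^ 2 - 4 * (p * q))) := by
  by_cases hd : IsSquare (d : ℚ_[l])
  · exact Or.inl hd
  obtain ⟨X, hX, h1, h2⟩ := h.resolve_left hd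
  have hD' : (D : ℚ_[l]) ≠ 0 := Int.cast_ne_zero.2 hD
  obtain ⟨Y, rfl⟩ : ∃ Y, X = D * Y := ⟨X / D, by field_simp⟩
  have hY0 : Y ≠ 0 := right_ne_zero_of_mul hX
  have h3 : IsSquare (D * Y * ((Y + (p + q)) ^ 2 - 4 * (p * q))) := by
    refine IsSquare.of_mul_right (y := (D : ℚ_[l]) ^ 2) ?_ (IsSquare.sq _) (pow_ne_zero 2 hD')
    convert h2 using 1
    ring
  refine Or.inr ⟨Y, ?_, h1, h3⟩
  have key : ¬ (IsSquare ((Y + (p + q)) ^ 2 - 4 * (p * q)) ∧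
      ((Y + (p + q)) ^ 2 - 4 * (p * q) : ℚ_[l]) ≠ 0) := fun h4 =>
    hd ((h1.of_mul_right (h3.of_mul_right h4.1 h4.2)) hX)
  have hpq1 : ‖((q - p : ℤ) : ℚ_[l])‖ = 1 := Padic.norm_intCast_eq_one_of_not_dvd hpq
  have hsum : ‖((2 * (p + q) : ℤ) : ℚ_[l])‖ ≤ 1 := Padic.norm_int_le_one _
  by_contra hne
  rcases lt_or_gt_of_ne hne with hlt | hgt
  · refine key (Padic.isSquare_and_ne_zero hl2 (y := ((q - p : ℤ) : ℚ_[l])) ?_)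
    have e1 : (Y + (p + q)) ^ 2 - 4 * (p * q) - ((q - p : ℤ) : ℚ_[l]) ^ 2 =
        Y * (Y + ((2 * (p + q) : ℤ) : ℚ_[l])) := by push_cast; ring
    rw [e1, norm_pow, hpq1, one_pow, norm_mul]
    have h5 := Padic.norm_add_le hlt.le hsum
    nlinarith [norm_nonneg Y]
  · refine key (Padic.isSquare_and_ne_zero hl2 (y := Y) ?_)
    have e1 : (Y + (p + q)) ^ 2 - 4 * (p * q) - Y ^ 2 =
        ((2 * (p + q) : ℤ) : ℚ_[l]) * Y + ((q - p : ℤ) : ℚ_[l]) ^ 2 := by push_cast; ring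
    rw [e1, norm_pow]
    have h5 : ‖((2 * (p + q) : ℤ) : ℚ_[l]) * Y‖ ≤ ‖Y‖ := by
      rw [norm_mul]
      nlinarith [norm_nonneg Y]
    have h6 : ‖((q - p : ℤ) : ℚ_[l]) ^ 2‖ ≤ ‖Y‖ := by
      rw [norm_pow, hpq1, one_pow]
      exact hgt.le
    have h7 := Padic.norm_add_le h5 h6
    nlinarith

/-- If `l` divides `d D` exactly once and the quadratic factor is a unit, there is no point. -/
theorem not_isSquare_of_exact {n : ℤ} (hn : ¬ (l : ℤ) ∣ n) {Y : ℚ_[l]} (hY : ‖Y‖ = 1) :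
    ¬ IsSquare (((l * n : ℤ) : ℚ_[l]) * Y) := by
  have := Padic.not_isSquare_prime_mul (l := l) (u := n * Y)
    (by rw [norm_mul, Padic.norm_intCast_eq_one_of_not_dvd hn, hY, one_mul])
  convert this using 2
  push_cast
  ring

/-- For l prime to D the square dDY has the valuation of d, which would be 1 if l divided the
square-free d. -/
theorem not_dvd_of_not_dvd (hl2 : l ≠ 2) (hpq : ¬ (l : ℤ) ∣ q - p) (hD : ¬ (l : ℤ) ∣ D)
    (hd : Squarefree d) (h : LocalPoint ℚ_[l] p q D d) : ¬ (l : ℤ) ∣ d := by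
  rintro ⟨n, rfl⟩
  have hn : ¬ (l : ℤ) ∣ n := fun hn =>
    (Nat.prime_iff_prime_int.1 hl.out).not_isUnit (hd _ (mul_dvd_mul_left _ hn))
  rcases exists_norm_eq_one hl2 hpq (by rintro rfl; exact hD (dvd_zero _)) h with h | ⟨Y, hY, h, -⟩
  · have := not_isSquare_of_exact (l := l) hn (Y := 1) norm_one
    rw [mul_one] at this
    exact this h
  · refine not_isSquare_of_exact (l := l) (n := n * D)
      (fun h' => ((Nat.prime_iff_prime_int.1 hl.out).dvd_or_dvd h').elim hn hD) hY ?_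
    convert h using 1
    push_cast
    ring

/-- Here p = l and the quadratic factor is ≡ (Y + q)² mod l. If Y + q is a unit the factor is a
square, and so are DY and d. If Y + q = lt, the factor is l(l(t + 1)² - 4q), of valuation exactly 1,
while DY is a unit, so there is no point. -/
theorem isSquare_of_eq_left (hl2 : l ≠ 2) (hql : ¬ (l : ℤ) ∣ q) (hD : ¬ (l : ℤ) ∣ D)
    (h : LocalPoint ℚ_[l] l q D d) : IsSquare (d : ℚ_[l]) := by
  have hD0 : D ≠ 0 := by rintro rfl; exact hD (dvd_zero _)
  rcases exists_norm_eq_one hl2 (fun h => hql ((dvd_sub_self_right).1 h)) hD0 h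
    with h | ⟨Y, hY, h1, h2⟩
  · exact h
  have hq1 := Padic.norm_intCast_eq_one_of_not_dvd hql
  have hD1 := Padic.norm_intCast_eq_one_of_not_dvd hD
  have hl0 : (l : ℚ_[l]) ≠ 0 := Nat.cast_ne_zero.2 hl.out.ne_zero
  have hll : ‖(l : ℚ_[l])‖ < 1 := Padic.norm_p_lt_one
  have hDY : (D * Y : ℚ_[l]) ≠ 0 := by
    rw [← norm_pos_iff, norm_mul, hD1, hY]
    norm_num
  rw [Int.cast_natCast] at h2
  rcases (Padic.norm_add_le hY.le hq1.le).lt_or_eq with h3 | h3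
  · exfalso
    have h4 : ‖(Y + q) / l‖ ≤ 1 := by
      rw [norm_div, Padic.norm_p, div_inv_eq_mul]
      have := (Padic.norm_lt_pow_iff_norm_le_pow_sub_one (Y + (q : ℚ_[l])) 0).1 (by simpa using h3)
      rw [zero_sub, zpow_neg, zpow_one] at this
      have hl1 : (0 : ℝ) < l := Nat.cast_pos.2 hl.out.pos
      calc ‖Y + q‖ * l ≤ (l : ℝ)⁻¹ * l := by gcongr
        _ = 1 := inv_mul_cancel₀ hl1.ne'
    obtain ⟨t, ht⟩ : ∃ t, t = (Y + q) / l := ⟨_, rfl⟩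
    rw [← ht] at h4
    have e1 : Y + q = l * t := by rw [ht]; field_simp
    have e2 : D * Y * ((Y + (l + q)) ^ 2 - 4 * (l * q)) =
        l * (D * Y * (l * (t + 1) ^ 2 + -(4 * q))) := by
      have : Y + (l + q) = l * (t + 1) := by rw [mul_add, ← e1]; ring
      rw [this]
      ring
    rw [e2] at h2
    refine Padic.not_isSquare_prime_mul ?_ h2
    have h5 : ‖-(4 * q : ℚ_[l])‖ = 1 := by
      rw [norm_neg, norm_mul, Padic.norm_four_eq_one hl2, hq1, one_mul]
    have h6 : ‖(l * (t + 1) ^ 2 : ℚ_[l])‖ < 1 := by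
      have : ‖t + 1‖ ≤ 1 := Padic.norm_add_le h4 norm_one.le
      rw [norm_mul, norm_pow]
      have h8 : ‖t + 1‖ ^ 2 ≤ 1 := pow_le_one₀ (norm_nonneg _) this
      nlinarith [norm_nonneg (l : ℚ_[l])]
    rw [norm_mul, norm_mul, hD1, hY, Padic.add_eq_max_of_ne (by rw [h5]; exact h6.ne), h5,
      max_eq_right h6.le]
    norm_num
  · have h4 : IsSquare ((Y + (l + q)) ^ 2 - 4 * (l * q) : ℚ_[l]) ∧
        ((Y + (l + q)) ^ 2 - 4 * (l * q) : ℚ_[l]) ≠ 0 := by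
      refine Padic.isSquare_and_ne_zero hl2 (y := Y + q) ?_
      have e1 : (Y + (l + q)) ^ 2 - 4 * (l * q) - (Y + q) ^ 2 =
          l * (2 * (Y + q) + ((l - 4 * q : ℤ) : ℚ_[l])) := by
        push_cast
        ring
      rw [e1, norm_pow, h3, one_pow, norm_mul]
      have h5 : ‖2 * (Y + q) + ((l - 4 * q : ℤ) : ℚ_[l])‖ ≤ 1 := by
        refine Padic.norm_add_le ?_ (Padic.norm_int_le_one _)
        rw [norm_mul, Padic.norm_two_eq_one hl2, h3, one_mul]
      nlinarith [norm_nonneg (l : ℚ_[l])]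
    exact (h1.of_mul_right (h2.of_mul_right h4.1 h4.2)) hDY

/-- A quadratic factor divisible by l would make 4pq a square. So it is a unit, and its product with
DY has valuation 1. -/
theorem isSquare_of_not_isSquare_mul (hl2 : l ≠ 2) (hpq : ¬ (l : ℤ) ∣ q - p)
    (hp : ¬ (l : ℤ) ∣ p) (hq : ¬ (l : ℤ) ∣ q) {n : ℤ}
    (hn : ¬ (l : ℤ) ∣ n) (hs : ¬ IsSquare (p * q : ℚ_[l]))
    (h : LocalPoint ℚ_[l] p q (l * n) d) : IsSquare (d : ℚ_[l]) := by
  have hD0 : (l * n : ℤ) ≠ 0 := mul_ne_zero (Int.natCast_ne_zero.2 hl.out.ne_zero)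
    (by rintro rfl; exact hn (dvd_zero _))
  rcases exists_norm_eq_one hl2 hpq hD0 h with h | ⟨Y, hY, h1, h2⟩
  · exact h
  exfalso
  have hp1 := Padic.norm_intCast_eq_one_of_not_dvd hp
  have hq1 := Padic.norm_intCast_eq_one_of_not_dvd hq
  have h4 : ‖-(4 * (p * q) : ℚ_[l])‖ = 1 := by
    rw [norm_neg, norm_mul, norm_mul, Padic.norm_four_eq_one hl2, hp1, hq1, one_mul, one_mul]
  have hsum : ‖((p + q : ℤ) : ℚ_[l])‖ ≤ 1 := Padic.norm_int_le_one _
  rw [Int.cast_add] at hsum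
  have h5 : ‖(Y + (p + q)) ^ 2‖ ≤ 1 := by
    rw [norm_pow]
    exact pow_le_one₀ (norm_nonneg _) (Padic.norm_add_le hY.le hsum)
  have h6 : ‖(Y + (p + q)) ^ 2 + -(4 * (p * q))‖ = 1 := by
    refine (Padic.norm_add_le h5 h4.le).lt_or_eq.resolve_left fun h6 => ?_
    have h7 : IsSquare (4 * (p * q) : ℚ_[l]) := by
      apply Padic.isSquare_of_norm_sub_sq_lt_one hl2 (y := Y + (p + q))
      · have := Padic.norm_eq_of_norm_add_lt_right (h6.trans_eq h4.symm)
        rw [h4, norm_pow] at this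
        exact (pow_eq_one_iff_of_nonneg (norm_nonneg _) two_ne_zero).1 this
      · rw [norm_sub_rev, sub_eq_add_neg]
        exact h6
    exact hs (h7.of_mul_left ⟨2, by norm_num⟩ (by norm_num))
  refine not_isSquare_of_exact (l := l) hn (Y := Y * ((Y + (p + q)) ^ 2 + -(4 * (p * q)))) ?_ ?_
  · rw [norm_mul, hY, h6, one_mul]
  · convert h2 using 1
    ring

/-- The roots of the quadratic factor lie in the class of `-p`. -/
theorem isSquare_neg_mul (hl2 : l ≠ 2) (hpq : ¬ (l : ℤ) ∣ q - p) (hp : ¬ (l : ℤ) ∣ p)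
    (hs : IsSquare (p * q : ℚ_[l])) {Y : ℚ_[l]}
    (h : ‖(Y + (p + q)) ^ 2 - 4 * (p * q)‖ < 1) : IsSquare (-(p * Y)) := by
  obtain ⟨r, hr⟩ := hs
  have hp1 := Padic.norm_intCast_eq_one_of_not_dvd hp
  have hpq1 := Padic.norm_intCast_eq_one_of_not_dvd hpq
  -- For Y ≡ 2r - (p + q) one has -pY ≡ (p - r)², and (p - r)(p + r) = -p(q - p) shows that p - r is
  -- a unit. The sign of r selects the root to which Y reduces.
  have main : ∀ r : ℚ_[l], (p * q : ℚ_[l]) = r * r → ‖Y + (p + q) - 2 * r‖ < 1 →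
      IsSquare (-(p * Y)) := by
    intro r hr h1
    have hr1 : ‖r‖ ≤ 1 := by
      have h2 : ‖((p * q : ℤ) : ℚ_[l])‖ ≤ 1 := Padic.norm_int_le_one _
      rw [Int.cast_mul, hr, norm_mul] at h2
      nlinarith [norm_nonneg r]
    have h2 : ‖(p : ℚ_[l]) - r‖ ≤ 1 := by
      rw [sub_eq_add_neg]
      exact Padic.norm_add_le hp1.le (by rwa [norm_neg])
    have h3 : ‖(p : ℚ_[l]) + r‖ ≤ 1 := Padic.norm_add_le hp1.le hr1
    have h4 : ‖(p : ℚ_[l]) - r‖ * ‖(p : ℚ_[l]) + r‖ = 1 := by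
      rw [← norm_mul]
      have : ((p : ℚ_[l]) - r) * (p + r) = -(p * ((q - p : ℤ) : ℚ_[l])) := by
        push_cast
        linear_combination hr
      rw [this, norm_neg, norm_mul, hp1, hpq1, one_mul]
    refine Padic.isSquare_of_norm_sub_sq_lt_one hl2 (y := p - r) ?_ ?_
    · refine le_antisymm h2 ?_
      nlinarith [norm_nonneg ((p : ℚ_[l]) - r)]
    · have : -(p * Y) - (p - r) ^ 2 = -(p * (Y + (p + q) - 2 * r)) := by linear_combination hr
      rw [this, norm_neg, norm_mul, hp1, one_mul]
      exact h1
  by_cases h1 : ‖Y + (p + q) - 2 * r‖ < 1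
  · exact main r hr h1
  · refine main (-r) (by rw [hr]; ring) ?_
    have e1 : (Y + (p + q)) ^ 2 - 4 * (p * q) =
        (Y + (p + q) - 2 * r) * (Y + (p + q) - 2 * -r) := by linear_combination -4 * hr
    rw [e1, norm_mul] at h
    nlinarith [norm_nonneg (Y + (p + q) - 2 * -r)]

/-- As l divides D exactly once, parity of valuations forces the quadratic factor to vanish mod l.
Then Y lies in the class of -p, and dDY being a square makes -pDd one. -/
theorem isSquare_or_of_isSquare_mul (hl2 : l ≠ 2) (hpq : ¬ (l : ℤ) ∣ q - p)
    (hp : ¬ (l : ℤ) ∣ p) {n : ℤ}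
    (hn : ¬ (l : ℤ) ∣ n) (hs : IsSquare (p * q : ℚ_[l]))
    (h : LocalPoint ℚ_[l] p q (l * n) d) : IsSquare (d : ℚ_[l]) ∨
      IsSquare (-(p * (l * n : ℤ) * d) : ℚ_[l]) := by
  have hD0 : (l * n : ℤ) ≠ 0 := mul_ne_zero (Int.natCast_ne_zero.2 hl.out.ne_zero)
    (by rintro rfl; exact hn (dvd_zero _))
  refine (exists_norm_eq_one hl2 hpq hD0 h).imp_right ?_
  rintro ⟨Y, hY, h1, h2⟩
  have hY0 : Y ≠ 0 := by
    rintro rfl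
    simp at hY
  have hp0 : (p : ℚ_[l]) ≠ 0 := by
    rw [← norm_pos_iff, Padic.norm_intCast_eq_one_of_not_dvd hp]
    exact one_pos
  have h6 : ‖(Y + (p + q)) ^ 2 - 4 * (p * q)‖ < 1 := by
    have hle : ‖(Y + (p + q)) ^ 2 - 4 * (p * q)‖ ≤ 1 := by
      have hsum : ‖((p + q : ℤ) : ℚ_[l])‖ ≤ 1 := Padic.norm_int_le_one _
      have hprod : ‖((-(4 * (p * q)) : ℤ) : ℚ_[l])‖ ≤ 1 := Padic.norm_int_le_one _
      push_cast at hsum hprod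
      rw [sub_eq_add_neg]
      refine Padic.norm_add_le ?_ hprod
      rw [norm_pow]
      exact pow_le_one₀ (norm_nonneg _) (Padic.norm_add_le hY.le hsum)
    refine hle.lt_of_ne fun h6 => ?_
    refine not_isSquare_of_exact (l := l) hn (Y := Y * ((Y + (p + q)) ^ 2 - 4 * (p * q))) ?_ ?_
    · rw [norm_mul, hY, h6, one_mul]
    · convert h2 using 1
      ring
  have h7 := isSquare_neg_mul hl2 hpq hp hs h6
  refine IsSquare.of_mul_right (y := Y ^ 2) ?_ (IsSquare.sq _) (pow_ne_zero 2 hY0)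
  have h8 := h7.mul h1
  have e : -(p * (l * n : ℤ) * d : ℚ_[l]) * Y ^ 2 = -(p * Y) * (d * ((l * n : ℤ) * Y)) := by ring
  rw [e]
  exact h8

/-- For a non-square unit d it suffices to have a non-square x mod l at which the quadratic factor
is a non-square too, for then both products are unit squares and x lifts. If the factor vanishes at
x instead, pq is a square and a 2-torsion point of E' does the job. The character sum supplies x. -/
theorem of_good_reduction (hl2 : l ≠ 2) (hpq : ¬ (l : ℤ) ∣ q - p) (hp : ¬ (l : ℤ) ∣ p)
    (hq : ¬ (l : ℤ) ∣ q) (hD : ¬ (l : ℤ) ∣ D) (hd : ¬ (l : ℤ) ∣ d) :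
    LocalPoint ℚ_[l] p q D d := by
  by_cases hsq : IsSquare (d : ℚ_[l])
  · exact Or.inl hsq
  have hne : ∀ {n : ℤ}, ¬ (l : ℤ) ∣ n → (n : ZMod l) ≠ 0 := fun hn h0 =>
    hn ((ZMod.intCast_zmod_eq_zero_iff_dvd _ l).1 h0)
  have hchar : ringChar (ZMod l) ≠ 2 := by rwa [ZMod.ringChar_zmod_n]
  have h4 : (4 : ZMod l) ≠ 0 := by
    have := Ring.two_ne_zero hchar
    have e : (4 : ZMod l) = 2 * 2 := by norm_num
    rw [e]
    exact mul_ne_zero this this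
  obtain ⟨x, hx, hx'⟩ := exists_not_isSquare_of_quadratic hchar (F := ZMod l)
    (A := (p + q) * D) (c := 4 * (p * q * D ^ 2)) (e := ((q - p : ℤ) : ZMod l) * D)
    (mul_ne_zero h4 (mul_ne_zero (mul_ne_zero (hne hp) (hne hq)) (pow_ne_zero 2 (hne hD))))
    (mul_ne_zero (hne hpq) (hne hD)) (by push_cast; ring)
  obtain ⟨n, rfl⟩ := ZMod.intCast_surjective x
  have hn : ¬ (l : ℤ) ∣ n := fun h => hx (by
    rw [(ZMod.intCast_zmod_eq_zero_iff_dvd _ l).2 h]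
    exact IsSquare.zero)
  have hmul : ∀ {x y : ℤ}, ¬ (l : ℤ) ∣ x → ¬ (l : ℤ) ∣ y → ¬ IsSquare (x : ZMod l) →
      ¬ IsSquare (y : ZMod l) → IsSquare ((x * y : ℤ) : ℚ_[l]) := by
    intro x y hx hy h1 h2
    have hxy : ¬ (l : ℤ) ∣ x * y := fun h =>
      ((Nat.prime_iff_prime_int.1 hl.out).dvd_or_dvd h).elim hx hy
    rw [Padic.isSquare_intCast_iff hl2 hxy, ← quadraticChar_one_iff_isSquare (hne hxy),
      Int.cast_mul, map_mul, quadraticChar_neg_one_iff_not_isSquare.2 h1,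
      quadraticChar_neg_one_iff_not_isSquare.2 h2]
    rfl
  have hdZ : ¬ IsSquare (d : ZMod l) := fun h => hsq ((Padic.isSquare_intCast_iff hl2 hd).2 h)
  have hdn := hmul hd hn hdZ hx
  have hn0 : (n : ℚ_[l]) ≠ 0 := by
    rw [← norm_pos_iff, Padic.norm_intCast_eq_one_of_not_dvd hn]
    exact one_pos
  have hp0 : p ≠ 0 := by rintro rfl; exact hp (dvd_zero _)
  have hD0 : D ≠ 0 := by rintro rfl; exact hD (dvd_zero _)
  have hpq0 : p ≠ q := by rintro rfl; exact hpq (by simp)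
  have hD0' : (D : ℚ_[l]) ≠ 0 := Int.cast_ne_zero.2 hD0
  rcases hx' with hx' | hx'
  · have hsq' : IsSquare (p * q : ℚ_[l]) := by
      have hpqD : ¬ (l : ℤ) ∣ p * q := fun h =>
        ((Nat.prime_iff_prime_int.1 hl.out).dvd_or_dvd h).elim hp hq
      rw [← Int.cast_mul, Padic.isSquare_intCast_iff hl2 hpqD]
      refine IsSquare.of_mul_left (x := (2 * D : ZMod l) ^ 2) ?_ (IsSquare.sq _)
        (pow_ne_zero 2 (mul_ne_zero (Ring.two_ne_zero hchar) (hne hD)))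
      refine ⟨n + (p + q) * D, ?_⟩
      push_cast
      linear_combination -hx'
    refine of_torsion hp0 hpq0 hD0 hsq' ?_
    have h1 : ‖((n / D : ℚ_[l]) + (p + q)) ^ 2 - 4 * (p * q)‖ < 1 := by
      have e1 : ((n / D : ℚ_[l]) + (p + q)) ^ 2 - 4 * (p * q) =
          (((n + (p + q) * D) ^ 2 - 4 * (p * q * D ^ 2) : ℤ) : ℚ_[l]) / D ^ 2 := by
        push_cast
        field_simp
      rw [e1, norm_div, norm_pow, Padic.norm_intCast_eq_one_of_not_dvd hD, one_pow, div_one,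
        Padic.norm_intCast_lt_one_iff, ← ZMod.intCast_zmod_eq_zero_iff_dvd]
      push_cast
      rw [hx', sub_self]
    have h2 := (isSquare_neg_mul hl2 hpq hp hsq' h1).mul hdn
    refine IsSquare.of_mul_right (y := ((n : ℚ_[l]) / D) ^ 2) ?_ (IsSquare.sq _)
      (pow_ne_zero 2 (div_ne_zero hn0 hD0'))
    have e : -(p * D * d : ℚ_[l]) * (n / D) ^ 2 = -(p * (n / D)) * ((d * n : ℤ) : ℚ_[l]) := by
      push_cast
      field_simp
    rw [e]
    exact h2
  · have hg : ¬ (l : ℤ) ∣ (n + (p + q) * D) ^ 2 - 4 * (p * q * D ^ 2) := by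
      rw [← ZMod.intCast_zmod_eq_zero_iff_dvd]
      push_cast
      intro h0
      rw [h0] at hx'
      exact hx' IsSquare.zero
    refine Or.inr ⟨n, hn0, by exact_mod_cast hdn, ?_⟩
    have := hmul hn hg hx (by push_cast; exact hx')
    exact_mod_cast this

end Odd

end LocalPoint

/-! ### Norms, squares and conics over ℚ₂ -/

namespace Padic

theorem norm_le_half {x : ℚ_[2]} (h : ‖x‖ < 1) : ‖x‖ ≤ 1 / 2 := by
  have := (Padic.norm_lt_pow_iff_norm_le_pow_sub_one x 0).1 (by simpa using h)
  norm_num at this ⊢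
  exact this

theorem norm_le_quarter {x : ℚ_[2]} (h : ‖x‖ < 1 / 2) : ‖x‖ ≤ 1 / 4 := by
  have := (Padic.norm_lt_pow_iff_norm_le_pow_sub_one x (-1)).1 (by norm_num at h ⊢; exact h)
  norm_num [zpow_neg] at this ⊢
  exact this

theorem two_le_norm {x : ℚ_[2]} (h : 1 < ‖x‖) : 2 ≤ ‖x‖ := by
  by_contra! hlt
  have := (Padic.norm_lt_pow_iff_norm_le_pow_sub_one x 1).1 (by simpa using hlt)
  norm_num at this
  linarith

theorem norm_two : ‖(2 : ℚ_[2])‖ = 1 / 2 := by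
  have := Padic.norm_p (p := 2)
  norm_num at this ⊢
  exact this

theorem norm_four : ‖(4 : ℚ_[2])‖ = 1 / 4 := by
  rw [show (4 : ℚ_[2]) = 2 * 2 by norm_num, norm_mul, norm_two]
  norm_num

theorem norm_odd {n : ℤ} (hn : n % 2 = 1) : ‖(n : ℚ_[2])‖ = 1 :=
  norm_intCast_eq_one_of_not_dvd (by norm_num; omega)

theorem norm_intCast_le_eighth {n : ℤ} : ‖(n : ℚ_[2])‖ ≤ 1 / 8 ↔ n % 8 = 0 := by
  have := Padic.norm_int_le_pow_iff_dvd (p := 2) n 3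
  norm_num [zpow_neg] at this
  rw [this]
  omega

theorem norm_intCast_le_quarter {n : ℤ} : ‖(n : ℚ_[2])‖ ≤ 1 / 4 ↔ n % 4 = 0 := by
  have := Padic.norm_int_le_pow_iff_dvd (p := 2) n 2
  norm_num [zpow_neg] at this
  rw [this]
  omega

theorem norm_sub_one_lt_of_unit {r : ℚ_[2]} (hr : ‖r‖ = 1) : ‖r - 1‖ ≤ 1 / 2 := by
  apply norm_le_half
  let z : ℤ_[2] := ⟨r, hr.le⟩
  have h1 := PadicInt.norm_sub_zmodRepr_lt_one z
  have h2 := PadicInt.zmodRepr_lt_p z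
  have h3 : z.zmodRepr = 0 ∨ z.zmodRepr = 1 := by omega
  rcases h3 with h3 | h3
  · rw [h3, Nat.cast_zero, sub_zero] at h1
    exact absurd hr h1.ne
  · rw [h3, Nat.cast_one] at h1
    exact h1

/-- With r = 1 + 2t one has r² - 1 = 4t(t + 1), and t(t + 1) is even. -/
theorem norm_sq_sub_one_le {r : ℚ_[2]} (hr : ‖r‖ = 1) : ‖r ^ 2 - 1‖ ≤ 1 / 8 := by
  have h1 := norm_sub_one_lt_of_unit hr
  obtain ⟨t, rfl⟩ : ∃ t, r = 1 + 2 * t := ⟨(r - 1) / 2, by ring⟩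
  have h2 : ‖t‖ ≤ 1 := by
    rw [add_sub_cancel_left, norm_mul, norm_two] at h1
    linarith
  have h3 : ‖t * (t + 1)‖ ≤ 1 / 2 := by
    have h5 := norm_add_le h2 (norm_one (α := ℚ_[2])).le
    rw [norm_mul]
    rcases h2.lt_or_eq with h4 | h4
    · nlinarith [norm_le_half h4, norm_nonneg t]
    · have h6 := norm_add_le (norm_sub_one_lt_of_unit h4) norm_two.le
      rw [show t - 1 + 2 = t + 1 by ring] at h6
      rw [h4]
      linarith
  rw [show (1 + 2 * t) ^ 2 - 1 = 4 * (t * (t + 1)) by ring, norm_mul, norm_four]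
  linarith

theorem norm_eq_one_of_isSquare_near {x : ℚ_[2]} {n : ℤ} (hn : n % 2 = 1)
    (h : ‖x - n‖ < 1) : ‖x‖ = 1 := by
  rw [Padic.norm_eq_of_norm_sub_lt_right (h.trans_eq (norm_odd hn).symm), norm_odd hn]

theorem norm_sub_one_le_of_isSquare {x : ℚ_[2]} (hx : IsSquare x) (h : ‖x‖ = 1) :
    ‖x - 1‖ ≤ 1 / 8 := by
  obtain ⟨r, rfl⟩ := hx
  rw [norm_mul] at h
  have hr : ‖r‖ = 1 := by nlinarith [norm_nonneg r]
  rw [← sq]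
  exact norm_sq_sub_one_le hr

theorem emod_eight_of_isSquare {x : ℚ_[2]} (hx : IsSquare x) {n : ℤ} (hn : n % 2 = 1)
    (h : ‖x - n‖ ≤ 1 / 8) : n % 8 = 1 := by
  have h1 := norm_sub_one_le_of_isSquare hx
    (norm_eq_one_of_isSquare_near hn (h.trans_lt (by norm_num)))
  have h2 : ‖((n - 1 : ℤ) : ℚ_[2])‖ ≤ 1 / 8 := by
    have : ((n - 1 : ℤ) : ℚ_[2]) = (x - 1) + -(x - n) := by push_cast; ring
    rw [this]
    exact norm_add_le h1 (by rwa [norm_neg])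
  rw [norm_intCast_le_eighth] at h2
  omega

theorem emod_four_of_isSquare {x : ℚ_[2]} (hx : IsSquare x) {n : ℤ} (hn : n % 2 = 1)
    (h : ‖x - n‖ ≤ 1 / 4) : n % 4 = 1 := by
  have h1 := norm_sub_one_le_of_isSquare hx
    (norm_eq_one_of_isSquare_near hn (h.trans_lt (by norm_num)))
  have h2 : ‖((n - 1 : ℤ) : ℚ_[2])‖ ≤ 1 / 4 := by
    have : ((n - 1 : ℤ) : ℚ_[2]) = (x - 1) + -(x - n) := by push_cast; ring
    rw [this]
    exact norm_add_le (h1.trans (by norm_num)) (by rwa [norm_neg])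
  rw [norm_intCast_le_quarter] at h2
  omega

theorem not_isSquare_near_two_mul {x : ℚ_[2]} {n : ℤ} (hn : n % 4 = 2)
    (h : ‖x - n‖ ≤ 1 / 4) : ¬ IsSquare x := by
  obtain ⟨k, rfl⟩ : ∃ k, n = 2 * k := ⟨n / 2, by omega⟩
  have h1 : ‖x / 2‖ = 1 := by
    refine norm_eq_one_of_isSquare_near (n := k) (by omega) ?_
    have : x / 2 - k = (x - (2 * k : ℤ)) / 2 := by push_cast; ring
    rw [this, norm_div, norm_two]
    linarith
  have := not_isSquare_prime_mul h1
  rwa [Nat.cast_ofNat, mul_div_cancel₀ x (two_ne_zero)] at this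

theorem isSquare_of_emod_eight {n : ℤ} (hn : n % 8 = 1) : IsSquare (n : ℚ_[2]) := by
  apply isSquare_of_norm_sub_one_lt
  rw [norm_four]
  have : ‖((n - 1 : ℤ) : ℚ_[2])‖ ≤ 1 / 8 := norm_intCast_le_eighth.2 (by omega)
  push_cast at this
  linarith

/-- Points on the conic `y² = d w² + e` over `ℚ₂` with `d` even. -/
theorem conic_even {d' e : ℤ} (hd : d' % 2 = 1) (he : e % 2 = 1) {w : ℚ_[2]}
    (h : IsSquare (2 * d' * w ^ 2 + e)) :
    (‖w‖ < 1 ∧ e % 8 = 1) ∨ (‖w‖ = 1 ∧ (2 * d' + e) % 8 = 1) := by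
  rcases lt_trichotomy ‖w‖ 1 with hw | hw | hw
  · refine Or.inl ⟨hw, emod_eight_of_isSquare h he ?_⟩
    rw [add_sub_cancel_right, norm_mul, norm_mul, norm_two, norm_odd hd, norm_pow]
    nlinarith [norm_le_half hw, norm_nonneg w]
  · refine Or.inr ⟨hw, emod_eight_of_isSquare h (by omega) ?_⟩
    have : 2 * d' * w ^ 2 + e - (2 * d' + e : ℤ) = 2 * d' * (w ^ 2 - 1) := by push_cast; ring
    rw [this, norm_mul, norm_mul, norm_two, norm_odd hd]
    linarith [norm_sq_sub_one_le hw]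
  -- Division by w² leaves a square within 1/4 of 2d', hence of odd valuation.
  · exfalso
    have hw0 : w ≠ 0 := by
      rintro rfl
      rw [norm_zero] at hw
      linarith
    refine not_isSquare_near_two_mul (x := 2 * d' + e / w ^ 2) (n := 2 * d') (by omega) ?_ ?_
    · have : 2 * d' + e / w ^ 2 - (2 * d' : ℤ) = e / w ^ 2 := by push_cast; ring
      rw [this, norm_div, norm_odd he, norm_pow]
      have := two_le_norm hw
      exact one_div_le_one_div_of_le (by norm_num) (by nlinarith)
    · have := h.div (IsSquare.sq w)
      rwa [add_div, mul_div_cancel_right₀ _ (pow_ne_zero 2 hw0)] at this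

theorem conic_odd_of_one_lt {d e : ℤ} (hd : d % 2 = 1) (he : e % 2 = 1) {w : ℚ_[2]}
    (h : IsSquare (d * w ^ 2 + e)) (hw : 1 < ‖w‖) : d % 4 = 1 := by
  have hw0 : w ≠ 0 := by
    rintro rfl
    rw [norm_zero] at hw
    linarith
  refine emod_four_of_isSquare (x := d + e / w ^ 2) ?_ hd ?_
  · have := h.div (IsSquare.sq w)
    rwa [add_div, mul_div_cancel_right₀ _ (pow_ne_zero 2 hw0)] at this
  · rw [add_sub_cancel_left, norm_div, norm_odd he, norm_pow]
    have := two_le_norm hw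
    exact one_div_le_one_div_of_le (by norm_num) (by nlinarith)

/-- If d ≡ 3 mod 4, the value is ≡ 3 mod 4 for |w| < 1 and ≡ 2 mod 4 for a unit w, while for |w| > 1
it becomes ≡ 3 mod 4 after division by w². None of these is a square. -/
theorem conic_odd {d e : ℤ} (hd : d % 2 = 1) (he : e % 4 = 3) {w : ℚ_[2]}
    (h : IsSquare (d * w ^ 2 + e)) : d % 4 = 1 := by
  rcases lt_trichotomy ‖w‖ 1 with hw | hw | hw
  · have := emod_four_of_isSquare h (n := e) (by omega) (by
      rw [add_sub_cancel_right, norm_mul, norm_odd hd, norm_pow]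
      nlinarith [norm_le_half hw, norm_nonneg w])
    omega
  · by_contra hd'
    refine not_isSquare_near_two_mul (n := d + e) (by omega) ?_ h
    have : d * w ^ 2 + e - (d + e : ℤ) = d * (w ^ 2 - 1) := by push_cast; ring
    rw [this, norm_mul, norm_odd hd, one_mul]
    exact (norm_sq_sub_one_le hw).trans (by norm_num)
  · exact conic_odd_of_one_lt hd (by omega) h hw

end Padic

/-! ### Solubility at 2: odd classes -/

namespace LocalPoint

theorem of_sq_mul {k : Type} [Field k] [CharZero k] {p q D d c : ℤ} (hc : c ≠ 0)
    (h : LocalPoint k p q D (c ^ 2 * d)) : LocalPoint k p q D d := by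
  have hc' : ((c : k)) ^ 2 ≠ 0 := pow_ne_zero 2 (Int.cast_ne_zero.2 hc)
  unfold LocalPoint at h
  push_cast at h
  refine h.imp (fun h => h.of_mul_left (IsSquare.sq _) hc') ?_
  rintro ⟨X, h1, h2, h3⟩
  exact ⟨X, h1, IsSquare.of_mul_left (mul_assoc _ (d : k) X ▸ h2) (IsSquare.sq _) hc', h3⟩

variable {p D d : ℤ} {m : ℕ}

/-- The coordinate `z` with `X = d D² z²` turns the quadratic factor into `d w² + 4 p D`. -/
theorem of_coordinate {z c : ℤ} {n : ℤ} (hd : d ≠ 0) (hD : D ≠ 0) (hz : z ≠ 0)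
    (h : d * (d * D * z ^ 2 + 2 ^ m) ^ 2 + 4 * (p * D) * d ^ 2 * z ^ 2 = c ^ 2 * n)
    (hn : n % 8 = 1) : LocalPoint ℚ_[2] p (p + 2 ^ m) D d := by
  have hd' : (d : ℚ_[2]) ≠ 0 := Int.cast_ne_zero.2 hd
  have hD' : (D : ℚ_[2]) ≠ 0 := Int.cast_ne_zero.2 hD
  have hz' : (z : ℚ_[2]) ≠ 0 := Int.cast_ne_zero.2 hz
  obtain ⟨r, hr⟩ := Padic.isSquare_of_emod_eight hn
  have h' := congrArg (fun x : ℤ => (x : ℚ_[2])) h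
  push_cast at h'
  -- Since q = p + 2^m, the quadratic factor is (X + 2^m D)² + 4pDX, which at this X equals D²((dDz²
  -- + 2^m)² + 4pDdz²).
  refine Or.inr ⟨d * D ^ 2 * z ^ 2, by positivity, ⟨d * D * z, by ring⟩, D ^ 2 * z * c * r, ?_⟩
  push_cast
  linear_combination (D : ℚ_[2]) ^ 4 * z ^ 2 * h' + (D : ℚ_[2]) ^ 4 * z ^ 2 * c ^ 2 * hr

/-- Writing the quadratic factor as (X + 2^m D)² + 4pDX and as (X + (p + q)D)² - 4pqD² gives two
conics y² = dw² + e, with e = pD and e = pqD². The first keeps the shape of w in terms of z, because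
the norm of w decides some cases. -/
theorem exists_coordinate {q : ℤ} (hq : q = p + 2 ^ m) (hd : d ≠ 0) (hD : D ≠ 0)
    (hsq : ¬ IsSquare (d : ℚ_[2])) (h : LocalPoint ℚ_[2] p q D d) :
    (∃ z : ℚ_[2], z ≠ 0 ∧
      IsSquare (d * ((D * z + 2 ^ m / (d * z)) / 2) ^ 2 + ((p * D : ℤ) : ℚ_[2]))) ∧
    ∃ w : ℚ_[2], IsSquare (d * w ^ 2 + ((p * q * D ^ 2 : ℤ) : ℚ_[2])) := by
  obtain ⟨X, hX, ⟨s, hs⟩, Y, hY⟩ := h.resolve_left hsq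
  have hd' : (d : ℚ_[2]) ≠ 0 := Int.cast_ne_zero.2 hd
  have hD' : (D : ℚ_[2]) ≠ 0 := Int.cast_ne_zero.2 hD
  have hs0 : s ≠ 0 := by
    rintro rfl
    exact mul_ne_zero hd' hX (by rw [hs, mul_zero])
  have hXs : X = s ^ 2 / d := by
    rw [eq_div_iff hd', mul_comm, hs, sq]
  subst hXs
  rw [hq] at hY ⊢
  push_cast at hY
  refine ⟨⟨s / (d * D), by positivity, Y * d / (2 * s ^ 2), ?_⟩,
    Y / (2 * s), ((s ^ 2 / d + (p + (p + 2 ^ m)) * D)) / 2, ?_⟩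
  · push_cast
    field_simp
    field_simp at hY
    linear_combination hY
  · push_cast
    field_simp
    field_simp at hY
    linear_combination -hY

theorem _root_.Int.sq_emod_eight {u : ℤ} (hu : u % 2 = 1) : ∃ k, u ^ 2 = 8 * k + 1 := by
  have := Int.sq_mod_four_eq_one_of_odd (Int.odd_iff.2 hu)
  have h8 := Int.eight_dvd_sq_sub_one_of_odd (Int.odd_iff.2 hu)
  exact ⟨(u ^ 2 - 1) / 8, by omega⟩

theorem _root_.Int.two_pow_eq {m k : ℕ} (h : k ≤ m) : (2 : ℤ) ^ m = 2 ^ k * 2 ^ (m - k) := by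
  rw [← pow_add, Nat.add_sub_cancel' h]

theorem ne_zero_of_emod {n : ℤ} (hn : n % 2 = 1) : n ≠ 0 := by omega

/-- Either d ≡ 1 mod 8 is a square, or d ≡ 5 and z = 1 gives du² + 4pDd² with u = dD + 2^m odd,
which is ≡ d + 4 ≡ 1 mod 8. -/
theorem of_emod_four (hp : p % 2 = 1) (hD : D % 2 = 1) (hm : 1 ≤ m) (hd : d % 4 = 1) :
    LocalPoint ℚ_[2] p (p + 2 ^ m) D d := by
  by_cases h8 : d % 8 = 1
  · exact Or.inl (Padic.isSquare_of_emod_eight h8)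
  have e1 := Int.two_pow_eq hm
  have hdD := Int.mul_emod d D 2
  obtain ⟨k, hk⟩ := Int.sq_emod_eight (u := d * D + 2 ^ m) (by
    rw [show d % 2 = 1 by omega, hD] at hdD
    omega)
  obtain ⟨i, hi⟩ := Int.sq_emod_eight (u := d) (by omega)
  obtain ⟨j, hj⟩ : ∃ j, p * D = 2 * j + 1 := ⟨p * D / 2, by
    have := Int.mul_emod p D 2
    rw [hp, hD] at this
    omega⟩
  refine of_coordinate (z := 1) (c := 1) (ne_zero_of_emod (by omega)) (ne_zero_of_emod hD)
    one_ne_zero (n := d * (8 * k + 1) + 4 * (2 * j + 1) * (8 * i + 1)) ?_ ?_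
  · rw [← hk, ← hi, ← hj]
    ring
  · ring_nf
    omega

/-- The case in which every odd class at `2` is soluble. -/
def AllOddClasses (m : ℕ) (p D : ℤ) : Prop :=
  (m = 2 ∧ (p + 2) * D % 8 = 3) ∨ (3 ≤ m ∧ p * D % 4 = 1)

theorem of_allOddClasses (hp : p % 2 = 1) (hD : D % 2 = 1) (hd : d % 4 = 3)
    (h : AllOddClasses m p D) : LocalPoint ℚ_[2] p (p + 2 ^ m) D d := by
  have hd0 : d ≠ 0 := ne_zero_of_emod (by omega)
  have hD0 : D ≠ 0 := ne_zero_of_emod hD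
  have hp0 : p ≠ 0 := ne_zero_of_emod hp
  rcases h with ⟨rfl, h⟩ | ⟨hm, h⟩
  · obtain ⟨i, hi⟩ := Int.sq_emod_eight (u := d) (by omega)
    obtain ⟨f, hf⟩ : ∃ f, d * D + 1 = 2 * f := ⟨(d * D + 1) / 2, by
      have := Int.mul_emod d D 2
      rw [show d % 2 = 1 by omega, hD] at this
      omega⟩
    -- The value at z = 2 is 16(4df² + pDd²). If D ≡ 1 mod 4, then f is even and pD ≡ 1 mod 8; if D
    -- ≡ 3 mod 4, then f is odd and pD ≡ 5.
    refine of_coordinate (z := 2) (c := 4) hd0 hD0 two_ne_zero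
      (n := 4 * d * f ^ 2 + p * D * (8 * i + 1)) ?_ ?_
    · rw [show d * D * 2 ^ 2 + 2 ^ 2 = 4 * (d * D + 1) by ring, hf, ← hi]
      ring
    · rw [add_mul] at h
      have hdD := Int.mul_emod d D 4
      rcases (show D % 4 = 1 ∨ D % 4 = 3 by omega) with hD4 | hD4 <;> rw [hd, hD4] at hdD
      · obtain ⟨g, rfl⟩ : ∃ g, f = 2 * g := ⟨f / 2, by omega⟩
        ring_nf
        omega
      · obtain ⟨j, hj⟩ := Int.sq_emod_eight (u := f) (by omega)
        rw [hj]
        ring_nf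
        omega
  -- For m ≥ 3, pq ≡ p² ≡ 1 mod 8 is a square, so 2-torsion of E' makes the class of -pD ≡ 3 mod 4
  -- soluble. The other class ≡ 3 mod 4 is 5 times this one, and the class of 5 is soluble as well.
  · have hsq : IsSquare ((p : ℚ_[2]) * ((p + 2 ^ m : ℤ) : ℚ_[2])) := by
      rw [← Int.cast_mul]
      obtain ⟨i, hi⟩ := Int.sq_emod_eight hp
      refine Padic.isSquare_of_emod_eight ?_
      rw [mul_add, ← sq, hi, Int.two_pow_eq hm]
      ring_nf
      omega
    have hpq : p ≠ p + 2 ^ m := by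
      have : (0 : ℤ) < 2 ^ m := by positivity
      omega
    have tors : ∀ e : ℤ, (p * D + e) % 8 = 0 → LocalPoint ℚ_[2] p (p + 2 ^ m) D e := by
      intro e he
      refine of_torsion hp0 hpq hD0 hsq ?_
      obtain ⟨i, hi⟩ := Int.sq_emod_eight (u := p * D) (by omega)
      have : (-(p * D * e)) % 8 = 1 := by
        obtain ⟨j, hj⟩ : ∃ j, e = 8 * j - p * D := ⟨(p * D + e) / 8, by omega⟩
        rw [hj, show -(p * D * (8 * j - p * D)) = (p * D) ^ 2 - 8 * (p * D * j) by ring, hi]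
        omega
      have h1 := Padic.isSquare_of_emod_eight this
      exact_mod_cast h1
    by_cases h8 : (p * D + d) % 8 = 0
    · exact tors d h8
    · have h1 := tors (d * 5) (by omega)
      have h2 : LocalPoint ℚ_[2] p (p + 2 ^ m) D 5 := of_emod_four hp hD (by omega) (by norm_num)
      have hq0 : p + 2 ^ m ≠ 0 := ne_zero_of_emod (by
        rw [Int.two_pow_eq (show 1 ≤ m by omega)]
        omega)
      have h3 := LocalPoint.mul hp0 hq0 hpq hD0 (mul_ne_zero hd0 (by norm_num)) (by norm_num) h1 h2
      refine of_sq_mul (c := 5) (by norm_num) ?_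
      convert h3 using 1
      ring

/-- By `Padic.conic_odd` the first conic excludes pD ≡ 3 mod 4, and the second excludes m = 1, where
pqD² ≡ 3 mod 4. For m = 2, w has norm greater than 1, which is impossible, unless |z| = 1/2; then
dw² is 0 or 4 mod 8 according to D mod 4, and this determines pD mod 8. -/
theorem allOddClasses_of (hp : p % 2 = 1) (hD : D % 2 = 1) (hm : 1 ≤ m) (hd : d % 4 = 3)
    (h : LocalPoint ℚ_[2] p (p + 2 ^ m) D d) : AllOddClasses m p D := by
  have hsq : ¬ IsSquare (d : ℚ_[2]) := fun hs => by
    have := Padic.emod_four_of_isSquare hs (n := d) (by omega) (by simp)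
    omega
  obtain ⟨⟨z, hz, h1⟩, w, h2⟩ := exists_coordinate rfl (ne_zero_of_emod (by omega))
    (ne_zero_of_emod hD) hsq h
  have hpD : p * D % 2 = 1 := by
    have := Int.mul_emod p D 2
    rw [hp, hD] at this
    omega
  have hpD4 : p * D % 4 = 1 := by
    by_contra hne
    have := Padic.conic_odd (by omega) (by omega) h1
    omega
  rcases (show m = 1 ∨ m = 2 ∨ 3 ≤ m by omega) with rfl | rfl | hm3
  · exfalso
    obtain ⟨i, hi⟩ := Int.sq_emod_eight hp
    obtain ⟨j, hj⟩ := Int.sq_emod_eight hD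
    have := Padic.conic_odd (by omega) (e := p * (p + 2 ^ 1) * D ^ 2) (by
      rw [hj, show p * (p + 2 ^ 1) = p ^ 2 + 2 * p by ring, hi]
      ring_nf
      omega) h2
    omega
  · refine Or.inl ⟨rfl, ?_⟩
    rw [add_mul]
    have hd2 : d % 2 = 1 := by omega
    have hdn := Padic.norm_odd hd2
    have hDn := Padic.norm_odd hD
    have hd0 : (d : ℚ_[2]) ≠ 0 := Int.cast_ne_zero.2 (by omega)
    have hz0 := norm_pos_iff.2 hz
    -- away from `‖z‖ = 1/2` the variable `w` is not small
    have hbig : ‖z‖ ≠ 1 / 2 → 1 ≤ ‖(D * z + 2 ^ 2 / (d * z) : ℚ_[2])‖ := by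
      intro hne
      have e1 : ‖(D * z : ℚ_[2])‖ = ‖z‖ := by rw [norm_mul, hDn, one_mul]
      have e2 : ‖(2 ^ 2 / (d * z) : ℚ_[2])‖ = 1 / (4 * ‖z‖) := by
        rw [norm_div, norm_mul, hdn, one_mul, norm_pow, Padic.norm_two]
        field_simp
        norm_num
      rcases lt_or_gt_of_ne hne with hlt | hgt
      · have h4 := Padic.norm_le_quarter hlt
        have h5 : 1 ≤ 1 / (4 * ‖z‖) := by
          rw [le_div_iff₀ (by positivity)]
          linarith
        rw [Padic.add_eq_max_of_ne (by rw [e1, e2]; linarith), e2]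
        exact h5.trans (le_max_right _ _)
      · have h4 : 1 ≤ ‖z‖ := by
          by_contra! hlt
          exact absurd (Padic.norm_le_half hlt) (not_le.2 hgt)
        have h5 : 1 / (4 * ‖z‖) ≤ 1 / 4 := by
          rw [div_le_div_iff₀ (by positivity) (by norm_num)]
          linarith
        rw [Padic.add_eq_max_of_ne (by rw [e1, e2]; linarith), e1]
        exact h4.trans (le_max_left _ _)
    by_cases hz2 : ‖z‖ = 1 / 2
    · obtain ⟨y, rfl⟩ : ∃ y, z = 2 * y := ⟨z / 2, by ring⟩
      have hy : ‖y‖ = 1 := by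
        rw [norm_mul, Padic.norm_two] at hz2
        linarith
      have hy0 : y ≠ 0 := right_ne_zero_of_mul hz
      have e1 : (d : ℚ_[2]) * ((D * (2 * y) + 2 ^ 2 / (d * (2 * y))) / 2) ^ 2 =
          (d * D * y ^ 2 + 1) ^ 2 / (d * y ^ 2) := by
        field_simp
      rw [e1] at h1
      have hy2 := Padic.norm_sq_sub_one_le hy
      have hdD := Int.mul_emod d D 4
      have e2 : (d * D * y ^ 2 + 1 : ℚ_[2]) = ((d * D + 1 : ℤ) : ℚ_[2]) + d * D * (y ^ 2 - 1) := by
        push_cast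
        ring
      have hsmall : ‖(d * D * (y ^ 2 - 1) : ℚ_[2])‖ ≤ 1 / 8 := by
        rwa [norm_mul, norm_mul, hdn, hDn, one_mul, one_mul]
      have hnorm : ‖(d * y ^ 2 : ℚ_[2])‖ = 1 := by rw [norm_mul, hdn, norm_pow, hy]; norm_num
      rcases (show D % 4 = 1 ∨ D % 4 = 3 by omega) with hD4 | hD4 <;> rw [hd, hD4] at hdD
      · have h3 : ‖(d * D * y ^ 2 + 1 : ℚ_[2])‖ ≤ 1 / 4 := by
          rw [e2]
          exact Padic.norm_add_le (Padic.norm_intCast_le_quarter.2 (by omega))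
            (hsmall.trans (by norm_num))
        have := Padic.emod_eight_of_isSquare h1 hpD (by
          rw [add_sub_cancel_right, norm_div, norm_pow, hnorm, div_one]
          nlinarith [norm_nonneg (d * D * y ^ 2 + 1 : ℚ_[2])])
        omega
      · obtain ⟨f, hf⟩ : ∃ f, d * D + 1 = 2 * f := ⟨(d * D + 1) / 2, by omega⟩
        -- `x = 2 u` with `u` a unit
        obtain ⟨u, hu⟩ : ∃ u : ℚ_[2], d * D * y ^ 2 + 1 = 2 * u :=
          ⟨(d * D * y ^ 2 + 1) / 2, by ring⟩
        have hu1 : ‖u‖ = 1 := by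
          refine Padic.norm_eq_one_of_isSquare_near (n := f) (by omega) ?_
          have e3 : u - f = d * D * (y ^ 2 - 1) / 2 := by
            rw [hu, hf] at e2
            push_cast at e2
            linear_combination e2 / 2
          rw [e3, norm_div, Padic.norm_two]
          linarith
        have hu2 : ‖(u / (d * y)) ^ 2 - 1‖ ≤ 1 / 8 := Padic.norm_sq_sub_one_le (by
          rw [norm_div, norm_mul, hu1, hdn, hy]
          norm_num)
        have := Padic.emod_eight_of_isSquare h1 (n := 4 * d + p * D) (by omega) (by
          have e4 : (d * D * y ^ 2 + 1) ^ 2 / (d * y ^ 2) + ((p * D : ℤ) : ℚ_[2]) -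
              ((4 * d + p * D : ℤ) : ℚ_[2]) = 4 * d * ((u / (d * y)) ^ 2 - 1) := by
            rw [hu]
            push_cast
            field_simp
            ring
          rw [e4, norm_mul, norm_mul, Padic.norm_four, hdn]
          linarith)
        omega
    · have h3 := hbig hz2
      have := Padic.conic_odd_of_one_lt hd2 hpD h1 (by
        rw [norm_div, Padic.norm_two]
        linarith)
      omega
  · exact Or.inr ⟨hm3, hpD4⟩

theorem odd_iff (hp : p % 2 = 1) (hD : D % 2 = 1) (hm : 1 ≤ m) (hd : d % 2 = 1) :
    LocalPoint ℚ_[2] p (p + 2 ^ m) D d ↔ d % 4 = 1 ∨ AllOddClasses m p D := by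
  constructor
  · intro h
    by_cases h1 : d % 4 = 1
    · exact Or.inl h1
    · exact Or.inr (allOddClasses_of hp hD hm (by omega) h)
  · intro h
    by_cases h1 : d % 4 = 1
    · exact of_emod_four hp hD hm h1
    · exact of_allOddClasses hp hD (by omega) (h.resolve_left h1)

/-! ### Solubility at 2: even classes -/

/-- The even classes that are soluble at `2`. -/
def EvenClass (m : ℕ) (p D d : ℤ) : Prop :=
  (m = 1 ∧ D % 4 = 1 ∧ p * D % 8 = 1 ∧ d % 4 = 3) ∨
  (m = 1 ∧ D % 4 = 1 ∧ p * D % 8 = 7 ∧ d % 4 = 1) ∨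
  (m = 1 ∧ D % 4 = 3 ∧ p * D % 8 = 1 ∧ d % 4 = 1) ∨
  (m = 1 ∧ D % 4 = 3 ∧ p * D % 8 = 3 ∧ d % 4 = 3) ∨
  (m = 3 ∧ p * D % 8 = 1) ∨
  (4 ≤ m ∧ p * D % 8 = 3 ∧ d % 4 = 3) ∨
  (4 ≤ m ∧ p * D % 8 = 7 ∧ d % 4 = 1) ∨
  (5 ≤ m ∧ p * D % 8 = 1)

/-- The witness z is 1, 2 or 4. Once c² is removed, the value is pDd² plus 2d or 8d times a square,
so it is ≡ 1 mod 8 as soon as pD ≡ 1 or 2d + pD ≡ 1, according to the case. -/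
theorem of_evenClass (hD : D % 2 = 1) (hd : d % 2 = 1)
    (h : EvenClass m p D d) : LocalPoint ℚ_[2] p (p + 2 ^ m) D (2 * d) := by
  have hd0 : 2 * d ≠ 0 := by omega
  have hD0 : D ≠ 0 := ne_zero_of_emod hD
  obtain ⟨i, hi⟩ := Int.sq_emod_eight hd
  have hdD2 := Int.mul_emod d D 2
  rw [hd, hD] at hdD2
  have hdD := Int.mul_emod d D 4
  obtain ⟨f, hf⟩ : ∃ f, d * D + 1 = 2 * f := ⟨(d * D + 1) / 2, by omega⟩
  have case1 : m = 1 → ((f % 2 = 0 ∧ p * D % 8 = 1) ∨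
      (f % 2 = 1 ∧ (2 * d + p * D) % 8 = 1)) → LocalPoint ℚ_[2] p (p + 2 ^ m) D (2 * d) := by
    rintro rfl h
    refine of_coordinate (z := 1) (c := 4) hd0 hD0 one_ne_zero
      (n := 2 * d * f ^ 2 + p * D * (8 * i + 1)) ?_ ?_
    · rw [show 2 * d * D * 1 ^ 2 + 2 ^ 1 = 2 * (d * D + 1) by ring, hf, ← hi]
      ring
    · rcases h with ⟨h1, h2⟩ | ⟨h1, h2⟩
      · obtain ⟨g, rfl⟩ : ∃ g, f = 2 * g := ⟨f / 2, by omega⟩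
        ring_nf
        omega
      · obtain ⟨j, hj⟩ := Int.sq_emod_eight h1
        rw [hj]
        ring_nf
        omega
  -- At z = 2 the bracket is 8(dD + 2^(m-3)), and dD + 2^(m-3) is odd from m = 4 on.
  have case4 : 4 ≤ m → (2 * d + p * D) % 8 = 1 →
      LocalPoint ℚ_[2] p (p + 2 ^ m) D (2 * d) := by
    intro hm h
    have e1 := Int.two_pow_eq (show 1 ≤ m - 3 by omega)
    obtain ⟨j, hj⟩ := Int.sq_emod_eight (u := d * D + 2 ^ (m - 3)) (by omega)
    refine of_coordinate (z := 2) (c := 8) hd0 hD0 two_ne_zero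
      (n := 2 * d * (8 * j + 1) + p * D * (8 * i + 1)) ?_ ?_
    · rw [← hj, ← hi, Int.two_pow_eq (show 3 ≤ m by omega)]
      ring
    · ring_nf
      omega
  rcases h with ⟨h1, h2, h3, h4⟩ | ⟨h1, h2, h3, h4⟩ | ⟨h1, h2, h3, h4⟩ | ⟨h1, h2, h3, h4⟩ |
    ⟨rfl, h3⟩ | ⟨h1, h3, h4⟩ | ⟨h1, h3, h4⟩ | ⟨h1, h3⟩
  · rw [h2, h4] at hdD
    exact case1 h1 (Or.inl ⟨by omega, by omega⟩)
  · rw [h2, h4] at hdD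
    exact case1 h1 (Or.inr ⟨by omega, by omega⟩)
  · rw [h2, h4] at hdD
    exact case1 h1 (Or.inl ⟨by omega, by omega⟩)
  · rw [h2, h4] at hdD
    exact case1 h1 (Or.inr ⟨by omega, by omega⟩)
  · refine of_coordinate (z := 2) (c := 8) hd0 hD0 two_ne_zero
      (n := 8 * d * f ^ 2 + p * D * (8 * i + 1)) ?_ ?_
    · rw [show 2 * d * D * 2 ^ 2 + 2 ^ 3 = 8 * (d * D + 1) by ring, hf, ← hi]
      ring
    · ring_nf
      omega
  · exact case4 h1 (by omega)
  · exact case4 h1 (by omega)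
  · refine of_coordinate (z := 4) (c := 16) hd0 hD0 (by norm_num)
      (n := 8 * d * (d * D + 2 ^ (m - 5)) ^ 2 + p * D * (8 * i + 1)) ?_ ?_
    · rw [← hi, Int.two_pow_eq h1]
      ring
    · generalize (d * D + 2 ^ (m - 5)) ^ 2 = g
      ring_nf
      omega

/-- Each conic with constant e leaves only e ≡ 1 or 2d + e ≡ 1 mod 8. For m = 1 the second conic
gives d ≡ -p mod 4, and for m = 2 it has no points since pqD² ≡ 5. The norm of w singles out the
first alternative when m = 3 and the second when m = 4; for m ≥ 5 both remain. -/
theorem evenClass_of (hp : p % 2 = 1) (hD : D % 2 = 1) (hm : 1 ≤ m) (hd : d % 2 = 1)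
    (h : LocalPoint ℚ_[2] p (p + 2 ^ m) D (2 * d)) : EvenClass m p D d := by
  have hsq : ¬ IsSquare ((2 * d : ℤ) : ℚ_[2]) :=
    Padic.not_isSquare_near_two_mul (n := 2 * d) (by omega) (by simp)
  obtain ⟨⟨z, hz, h1⟩, w, h2⟩ := exists_coordinate rfl (by omega) (ne_zero_of_emod hD) hsq h
  have hpD : p * D % 2 = 1 := by
    have := Int.mul_emod p D 2
    rw [hp, hD] at this
    omega
  have hdn := Padic.norm_odd hd
  have hDn := Padic.norm_odd hD
  have hd0 : (d : ℚ_[2]) ≠ 0 := Int.cast_ne_zero.2 (by omega)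
  have hz0 := norm_pos_iff.2 hz
  have h1' := h1
  have h2' := h2
  rw [Int.cast_mul, Int.cast_ofNat] at h1' h2'
  obtain ⟨i, hi⟩ := Int.sq_emod_eight hp
  obtain ⟨j, hj⟩ := Int.sq_emod_eight hD
  have hodd2 : p * (p + 2 ^ m) * D ^ 2 % 2 = 1 := by
    rw [hj, mul_add p, ← sq, hi, Int.two_pow_eq hm]
    ring_nf
    omega
  have c1 := Padic.conic_even hd hpD h1'
  have c2 := Padic.conic_even hd hodd2 h2'
  have c1' : p * D % 8 = 1 ∨ (2 * d + p * D) % 8 = 1 := c1.imp And.right And.right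
  have c2' : p * (p + 2 ^ m) * D ^ 2 % 8 = 1 ∨ (2 * d + p * (p + 2 ^ m) * D ^ 2) % 8 = 1 :=
    c2.imp And.right And.right
  clear c2 h1' h2' h1 h2 h
  have hw1 : ‖(D * z : ℚ_[2])‖ = ‖z‖ := by rw [norm_mul, hDn, one_mul]
  rcases (show m = 1 ∨ m = 2 ∨ m = 3 ∨ m = 4 ∨ 5 ≤ m by omega) with rfl | rfl | rfl | rfl | hm5
  · have e1 : p * (p + 2 ^ 1) * D ^ 2 % 8 = (1 + 2 * p) % 8 := by
      rw [hj, show p * (p + 2 ^ 1) = p ^ 2 + 2 * p by ring, hi]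
      ring_nf
      omega
    have e2 := Int.mul_emod p D 4
    rcases (show p % 4 = 1 ∨ p % 4 = 3 by omega) with h3 | h3
    · have h5 : d % 4 = 3 := by omega
      rcases (show D % 4 = 1 ∨ D % 4 = 3 by omega) with h4 | h4 <;> rw [h3, h4] at e2
      · exact Or.inl ⟨rfl, h4, by omega, h5⟩
      · exact Or.inr (Or.inr (Or.inr (Or.inl ⟨rfl, h4, by omega, h5⟩)))
    · have h5 : d % 4 = 1 := by omega
      rcases (show D % 4 = 1 ∨ D % 4 = 3 by omega) with h4 | h4 <;> rw [h3, h4] at e2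
      · exact Or.inr (Or.inl ⟨rfl, h4, by omega, h5⟩)
      · exact Or.inr (Or.inr (Or.inl ⟨rfl, h4, by omega, h5⟩))
  · exfalso
    have e1 : p * (p + 2 ^ 2) * D ^ 2 % 8 = 5 := by
      rw [hj, show p * (p + 2 ^ 2) = p ^ 2 + 4 * p by ring, hi]
      ring_nf
      omega
    omega
  · have e2 : ‖(2 ^ 3 / (2 * d * z) : ℚ_[2])‖ = 1 / (4 * ‖z‖) := by
      rw [norm_div, norm_mul, norm_mul, hdn, norm_pow, Padic.norm_two]
      field_simp
      norm_num
    -- The norms |z| and 1/(4|z|) agree only at 1/2; elsewhere their sum has norm at least 1, so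
    -- that w has norm at least 2.
    have hbig : ‖z‖ = 1 / 2 := by
      by_contra hne
      have : 1 ≤ ‖(D * z + 2 ^ 3 / (2 * d * z) : ℚ_[2])‖ := by
        rcases lt_or_gt_of_ne hne with hlt | hgt
        · have h4 := Padic.norm_le_quarter hlt
          have h5 : 1 ≤ 1 / (4 * ‖z‖) := by
            rw [le_div_iff₀ (by positivity)]
            linarith
          rw [Padic.add_eq_max_of_ne (by rw [hw1, e2]; linarith), e2]
          exact h5.trans (le_max_right _ _)
        · have h4 : 1 ≤ ‖z‖ := by
            by_contra! hlt
            exact absurd (Padic.norm_le_half hlt) (not_le.2 hgt)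
          have h5 : 1 / (4 * ‖z‖) ≤ 1 / 4 := by
            rw [div_le_div_iff₀ (by positivity) (by norm_num)]
            linarith
          rw [Padic.add_eq_max_of_ne (by rw [hw1, e2]; linarith), hw1]
          exact h4.trans (le_max_left _ _)
      rw [norm_div, Padic.norm_two] at c1
      rcases c1 with ⟨c1, -⟩ | ⟨c1, -⟩ <;> linarith
    obtain ⟨y, rfl⟩ : ∃ y, z = 2 * y := ⟨z / 2, by ring⟩
    have hy : ‖y‖ = 1 := by
      rw [norm_mul, Padic.norm_two] at hbig
      linarith
    have hy0 : y ≠ 0 := right_ne_zero_of_mul hz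
    have e3 : (D * (2 * y) + 2 ^ 3 / (2 * d * (2 * y))) / 2 =
        (((d * D + 1 : ℤ) : ℚ_[2]) + d * D * (y ^ 2 - 1)) / (d * y) := by
      push_cast
      field_simp
      ring
    have h3 : ‖(D * (2 * y) + 2 ^ 3 / (2 * d * (2 * y))) / 2‖ < 1 := by
      rw [e3, norm_div, norm_mul (d : ℚ_[2]), hdn, hy, one_mul, div_one]
      refine Padic.norm_add_lt ?_ ?_
      · have := Int.mul_emod d D 2
        rw [hd, hD] at this
        exact Padic.norm_intCast_lt_one_iff.2 (by norm_num; omega)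
      · rw [norm_mul, norm_mul, hdn, hDn]
        linarith [Padic.norm_sq_sub_one_le hy]
    rcases c1 with ⟨-, c1⟩ | ⟨c1, -⟩
    · exact Or.inr (Or.inr (Or.inr (Or.inr (Or.inl ⟨rfl, c1⟩))))
    · exact absurd c1 h3.ne
  · have e2 : ‖(2 ^ 4 / (2 * d * z) : ℚ_[2])‖ = 1 / (8 * ‖z‖) := by
      rw [norm_div, norm_mul, norm_mul, hdn, norm_pow, Padic.norm_two]
      field_simp
      norm_num
    -- The norms |z| and 1/(8|z|) are powers of 2 with product 1/8, hence distinct, and the larger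
    -- is at least 1/2.
    have hbig : 1 / 2 ≤ ‖(D * z + 2 ^ 4 / (2 * d * z) : ℚ_[2])‖ := by
      rcases lt_or_ge ‖z‖ (1 / 2) with hlt | hge
      · have h4 := Padic.norm_le_quarter hlt
        have h5 : 1 / 2 ≤ 1 / (8 * ‖z‖) := by
          rw [div_le_div_iff₀ (by norm_num) (by positivity)]
          linarith
        rw [Padic.add_eq_max_of_ne (by rw [hw1, e2]; linarith), e2]
        exact h5.trans (le_max_right _ _)
      · have h5 : 1 / (8 * ‖z‖) ≤ 1 / 4 := by
          rw [div_le_div_iff₀ (by positivity) (by norm_num)]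
          linarith
        rw [Padic.add_eq_max_of_ne (by rw [hw1, e2]; linarith), hw1]
        exact hge.trans (le_max_left _ _)
    rw [norm_div, Padic.norm_two] at c1
    rcases c1 with ⟨c1, -⟩ | ⟨-, c1⟩
    · linarith
    · rcases (show p * D % 8 = 3 ∧ d % 4 = 3 ∨ p * D % 8 = 7 ∧ d % 4 = 1 by
        omega) with h | h
      · exact Or.inr (Or.inr (Or.inr (Or.inr (Or.inr (Or.inl ⟨le_rfl, h⟩)))))
      · exact Or.inr (Or.inr (Or.inr (Or.inr (Or.inr (Or.inr (Or.inl ⟨le_rfl, h⟩))))))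
  · rcases (show p * D % 8 = 1 ∨ p * D % 8 = 3 ∧ d % 4 = 3 ∨ p * D % 8 = 7 ∧ d % 4 = 1 by
      omega) with h | h | h
    · exact Or.inr (Or.inr (Or.inr (Or.inr (Or.inr (Or.inr (Or.inr ⟨hm5, h⟩))))))
    · exact Or.inr (Or.inr (Or.inr (Or.inr (Or.inr (Or.inl ⟨by omega, h⟩)))))
    · exact Or.inr (Or.inr (Or.inr (Or.inr (Or.inr (Or.inr (Or.inl ⟨by omega, h⟩))))))

end LocalPoint

/-! ### Arcs of the graph and partitions as signed products -/

namespace GraphMinus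

/-- The standing hypotheses on `m`, `p`, `q`, `D`. -/
structure Admissible (m p q D : ℕ) : Prop where
  one_le : 1 ≤ m
  prime_p : p.Prime
  p_ne_two : p ≠ 2
  prime_q : q.Prime
  q_ne_two : q ≠ 2
  q_eq : q = p + 2 ^ m
  squarefree : Squarefree D
  odd_D : ¬ 2 ∣ D
  p_not_dvd : ¬ p ∣ D
  q_not_dvd : ¬ q ∣ D

/-- `c` is even if `t = 1` and odd if `t = -1`. -/
def ParityOK (t : ℤ) (c : ℕ) : Prop := (t = 1 → Even c) ∧ (t = -1 → Odd c)

theorem parityOK_iff {t : ℤ} {c : ℕ} (ht : t = 1 ∨ t = -1) : ParityOK t c ↔ t * (-1) ^ c = 1 := by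
  unfold ParityOK
  rcases ht with rfl | rfl <;> rcases Nat.even_or_odd c with h | h <;>
    simp [h, h.neg_one_pow]

variable {m p q D : ℕ}

theorem mem_plusPrimes {l : ℕ} :
    l ∈ plusPrimes p q D ↔ l ∈ D.primeFactors ∧ jacobiSym (p * q) l = 1 := Finset.mem_filter

theorem mem_minusPrimes {l : ℕ} :
    l ∈ minusPrimes p q D ↔ l ∈ D.primeFactors ∧ jacobiSym (p * q) l = -1 := Finset.mem_filter

theorem mem_vertices {x : ℤ} : x ∈ vertices p q D ↔
    x = -1 ∨ x = p ∨ x = q ∨ ∃ l ∈ D.primeFactors, x = (l : ℤ) := by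
  simp only [vertices, Finset.mem_union, Finset.mem_insert, Finset.mem_singleton, Finset.mem_image,
    or_assoc, eq_comm]

theorem natCast_ne_neg_one (l : ℕ) : (l : ℤ) ≠ -1 := by omega

/-- The arcs that do not start in `-1`. -/
def BaseArc (p q D : ℕ) (u v : ℤ) : Prop :=
  CommonArc p q D u v ∨ DToNegOne D u v ∨ PQToNegOne p q u v

namespace Admissible

theorem mod_two_p (h : Admissible m p q D) : p % 2 = 1 :=
  Nat.odd_iff.1 (h.prime_p.odd_of_ne_two h.p_ne_two)

theorem mod_two_D (h : Admissible m p q D) : D % 2 = 1 := by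
  have := h.odd_D
  omega

theorem p_ne_q (h : Admissible m p q D) : p ≠ q := by
  have := h.q_eq
  have : 0 < 2 ^ m := by positivity
  omega

theorem odd_of_mem (h : Admissible m p q D) {l : ℕ} (hl : l ∈ D.primeFactors) : l % 2 = 1 := by
  refine Nat.odd_iff.1 ((Nat.prime_of_mem_primeFactors hl).odd_of_ne_two ?_)
  rintro rfl
  exact h.odd_D (Nat.dvd_of_mem_primeFactors hl)

theorem ne_p_of_mem (h : Admissible m p q D) {l : ℕ} (hl : l ∈ D.primeFactors) : l ≠ p := by
  rintro rfl
  exact h.p_not_dvd (Nat.dvd_of_mem_primeFactors hl)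

theorem ne_q_of_mem (h : Admissible m p q D) {l : ℕ} (hl : l ∈ D.primeFactors) : l ≠ q := by
  rintro rfl
  exact h.q_not_dvd (Nat.dvd_of_mem_primeFactors hl)

/-- The five cases differ only in the arcs that leave -1. -/
theorem arc_iff_baseArc (h : Admissible m p q D) {u v : ℤ} (hu : u ≠ -1) :
    Arc m p q D u v ↔ BaseArc p q D u v := by
  have h1 : ¬ DToNegOne D v u := fun ⟨_, _, _, _, h⟩ => hu h
  have h2 : ¬ PQToNegOne p q v u := fun h => h.elim (fun h => hu h.2.2) fun h => hu h.2.2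
  have e1 : Arc1 p q D u v ↔ BaseArc p q D u v := by simp [Arc1, BaseArc, h1, h2]
  have e2 : Arc2 p q D u v ↔ BaseArc p q D u v := by simp [Arc2, BaseArc, h1]
  have e3 : Arc3 p q D u v ↔ BaseArc p q D u v := Iff.rfl
  have e4 : Arc4 p q D u v ↔ BaseArc p q D u v := by simp [Arc4, BaseArc, h1, hu]
  have e5 : Arc5 p q D u v ↔ BaseArc p q D u v := by simp [Arc5, BaseArc, h1, hu]
  unfold Arc
  rw [e1, e2, e3, e4, e5]
  have hD := h.mod_two_D
  have hpD := Nat.mul_mod p D 2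
  rw [h.mod_two_p, hD] at hpD
  have := h.one_le
  unfold Nat.ModEq
  by_cases hB : BaseArc p q D u v
  · simp only [hB, and_true, iff_true]
    omega
  · simp [hB]

theorem baseArc_iff_of_minus (h : Admissible m p q D) {l : ℕ} {v : ℤ}
    (hl : l = p ∨ l = q ∨ l ∈ minusPrimes p q D) : BaseArc p q D l v ↔
      jacobiSym v l = -1 ∧ (v = -1 ∨ ∃ i ∈ plusPrimes p q D, v = (i : ℤ)) := by
  have hnp : l ∉ plusPrimes p q D := by
    rcases hl with rfl | rfl | hl
    · exact fun h' => h.ne_p_of_mem (mem_plusPrimes.1 h').1 rfl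
    · exact fun h' => h.ne_q_of_mem (mem_plusPrimes.1 h').1 rfl
    · intro h'
      have h1 := (mem_plusPrimes.1 h').2
      have h2 := (mem_minusPrimes.1 hl).2
      omega
  constructor
  · rintro ((⟨i, hi, _, _, _, h2, _⟩ | ⟨i, hi, j, hj, h1, h2, h3⟩ | ⟨i, hi, h1 | h1⟩ |
      ⟨i, hi, _, h2, _⟩) | ⟨k, hk, h1, h2, h3⟩ | (⟨h1, h2, h3⟩ | ⟨h1, h2, h3⟩))
    · exact absurd (Nat.cast_injective h2 ▸ hi) hnp
    · rw [Nat.cast_injective h2, h3]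
      exact ⟨h1, Or.inr ⟨i, hi, rfl⟩⟩
    · rw [Nat.cast_injective h1.2.1, h1.2.2]
      exact ⟨h1.1, Or.inr ⟨i, hi, rfl⟩⟩
    · rw [Nat.cast_injective h1.2.1, h1.2.2]
      exact ⟨h1.1, Or.inr ⟨i, hi, rfl⟩⟩
    · exact absurd (Nat.cast_injective h2 ▸ hi) hnp
    · rw [Nat.cast_injective h2, h3]
      exact ⟨h1, Or.inl rfl⟩
    · rw [Nat.cast_injective h2, h3]
      exact ⟨h1, Or.inl rfl⟩
    · rw [Nat.cast_injective h2, h3]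
      exact ⟨h1, Or.inl rfl⟩
  · rintro ⟨h1, rfl | ⟨i, hi, rfl⟩⟩
    · rcases hl with rfl | rfl | hl
      · exact Or.inr (Or.inr (Or.inl ⟨h1, rfl, rfl⟩))
      · exact Or.inr (Or.inr (Or.inr ⟨h1, rfl, rfl⟩))
      · exact Or.inr (Or.inl ⟨l, (mem_minusPrimes.1 hl).1, h1, rfl, rfl⟩)
    · rcases hl with rfl | rfl | hl
      · exact Or.inl (Or.inr (Or.inr (Or.inl ⟨i, hi, Or.inl ⟨h1, rfl, rfl⟩⟩)))
      · exact Or.inl (Or.inr (Or.inr (Or.inl ⟨i, hi, Or.inr ⟨h1, rfl, rfl⟩⟩)))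
      · exact Or.inl (Or.inr (Or.inl ⟨i, hi, l, hl, h1, rfl, rfl⟩))

theorem baseArc_iff_of_plus (h : Admissible m p q D) {l : ℕ} {v : ℤ}
    (hl : l ∈ plusPrimes p q D) : BaseArc p q D l v ↔
      jacobiSym v l = -1 ∧ (v = -1 ∨ v = p ∨ ∃ i ∈ D.primeFactors, v = (i : ℤ)) := by
  have hlD := (mem_plusPrimes.1 hl).1
  constructor
  · rintro ((⟨i, hi, j, hj, h1, h2, h3⟩ | ⟨i, hi, j, hj, h1, h2, h3⟩ | ⟨i, hi, h1 | h1⟩ |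
      ⟨i, hi, h1, h2, h3⟩) | ⟨k, hk, h1, h2, h3⟩ | (⟨h1, h2, h3⟩ | ⟨h1, h2, h3⟩))
    · rw [Nat.cast_injective h2, h3]
      exact ⟨h1, Or.inr (Or.inr ⟨j, hj, rfl⟩)⟩
    · rw [Nat.cast_injective h2, h3]
      exact ⟨h1, Or.inr (Or.inr ⟨i, (mem_plusPrimes.1 hi).1, rfl⟩)⟩
    · exact absurd (Nat.cast_injective h1.2.1) (h.ne_p_of_mem hlD)
    · exact absurd (Nat.cast_injective h1.2.1) (h.ne_q_of_mem hlD)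
    · rw [Nat.cast_injective h2, h3]
      exact ⟨h1, Or.inr (Or.inl rfl)⟩
    · rw [Nat.cast_injective h2, h3]
      exact ⟨h1, Or.inl rfl⟩
    · exact absurd (Nat.cast_injective h2) (h.ne_p_of_mem hlD)
    · exact absurd (Nat.cast_injective h2) (h.ne_q_of_mem hlD)
  · rintro ⟨h1, rfl | rfl | ⟨i, hi, rfl⟩⟩
    · exact Or.inr (Or.inl ⟨l, hlD, h1, rfl, rfl⟩)
    · exact Or.inl (Or.inr (Or.inr (Or.inr ⟨l, hl, h1, rfl, rfl⟩)))
    · exact Or.inl (Or.inl ⟨l, hl, i, hi, h1, rfl, rfl⟩)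

end Admissible

/-! ### Counting arcs -/

theorem jacobiSym_prod {ι : Type*} (B : Finset ι) (f : ι → ℤ) (l : ℕ) :
    jacobiSym (∏ x ∈ B, f x) l = ∏ x ∈ B, jacobiSym (f x) l := by
  classical
  induction B using Finset.induction_on with
  | empty => simp [jacobiSym.one_left]
  | insert a B ha ih => rw [Finset.prod_insert ha, Finset.prod_insert ha, jacobiSym.mul_left, ih]

theorem neg_one_pow_card_filter {ι : Type*} (B : Finset ι) (f : ι → ℤ)
    (hf : ∀ x ∈ B, f x = 1 ∨ f x = -1) :
    (-1 : ℤ) ^ (B.filter fun x => f x = -1).card = ∏ x ∈ B, f x := by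
  rw [← Finset.prod_const, Finset.prod_filter]
  refine Finset.prod_congr rfl fun x hx => ?_
  rcases hf x hx with h | h <;> simp [h]

theorem arcsTo_eq_card {P : vertices p q D} {A : Set (vertices p q D)} {B : Finset ℤ}
    (hB : ∀ x ∈ B, x ∈ vertices p q D)
    (h : ∀ Q : vertices p q D, (Q ∈ A ∧ Arc m p q D P Q) ↔ (Q : ℤ) ∈ B) :
    (graph m p q D).arcsTo P A = B.card := by
  rw [Digraph.arcsTo, ← Set.ncard_image_of_injective _ Subtype.val_injective,
    ← Set.ncard_coe_finset]
  congr 1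
  ext x
  constructor
  · rintro ⟨Q, hQ, rfl⟩
    exact (h Q).1 hQ
  · intro hx
    exact ⟨⟨x, hB x hx⟩, (h ⟨x, hB x hx⟩).2 hx, rfl⟩

/-- The sign encoded by `σ`. -/
def sign (σ : Bool) : ℤ := if σ then -1 else 1

/-- The integer `± ∏ S`. -/
def signedProd (σ : Bool) (S : Finset ℕ) : ℤ := sign σ * (∏ l ∈ S, l : ℕ)

/-- The set of vertices in `S`, together with `-1` if `σ` is true. -/
def part (σ : Bool) (S : Finset ℕ) : Set (vertices p q D) :=
  {P | ((P : ℤ) = -1 ∧ σ = true) ∨ ∃ l ∈ S, (P : ℤ) = l}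

theorem natCast_mem_part {σ : Bool} {S : Finset ℕ} {l : ℕ} (hl : (l : ℤ) ∈ vertices p q D) :
    (⟨l, hl⟩ : vertices p q D) ∈ part σ S ↔ l ∈ S := by
  constructor
  · rintro (⟨h, -⟩ | ⟨k, hk, h⟩)
    · exact absurd h (natCast_ne_neg_one l)
    · rwa [Nat.cast_injective h]
  · exact fun h => Or.inr ⟨l, h, rfl⟩

theorem neg_one_mem_part {σ : Bool} {S : Finset ℕ} (hl : (-1 : ℤ) ∈ vertices p q D) :
    (⟨-1, hl⟩ : vertices p q D) ∈ part σ S ↔ σ = true := by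
  constructor
  · rintro (⟨_, h⟩ | ⟨k, hk, h⟩)
    · exact h
    · exact absurd h.symm (natCast_ne_neg_one k)
  · exact fun h => Or.inl ⟨rfl, h⟩

/-- The signed set of integers with product `± ∏ S`. -/
def signedSet (σ : Bool) (S : Finset ℕ) : Finset ℤ :=
  (if σ then {-1} else ∅) ∪ S.image (fun l : ℕ => (l : ℤ))

theorem mem_signedSet {σ : Bool} {S : Finset ℕ} {x : ℤ} :
    x ∈ signedSet σ S ↔ (x = -1 ∧ σ = true) ∨ ∃ l ∈ S, x = (l : ℤ) := by
  cases σ <;> simp [signedSet, eq_comm]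

theorem prod_signedSet (σ : Bool) (S : Finset ℕ) : ∏ x ∈ signedSet σ S, x = signedProd σ S := by
  have h : ∏ x ∈ S.image (fun l : ℕ => (l : ℤ)), x = ((∏ l ∈ S, l : ℕ) : ℤ) := by
    rw [Finset.prod_image (fun _ _ _ _ h => Nat.cast_injective h), Nat.cast_prod]
  rw [signedSet, Finset.prod_union, h, signedProd, sign]
  · cases σ <;> simp
  · cases σ
    · simp
    · simp only [if_true, Finset.disjoint_singleton_left, Finset.mem_image, not_exists, not_and]
      exact fun x _ => natCast_ne_neg_one x

theorem jacobiSym_of_prime_ne {l r : ℕ} (hl : l.Prime) (hr : r.Prime) (h : r ≠ l) :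
    jacobiSym r l = 1 ∨ jacobiSym r l = -1 := by
  refine jacobiSym.eq_one_or_neg_one ?_
  rw [Int.gcd_natCast_natCast]
  exact (Nat.coprime_primes hr hl).2 h

theorem jacobiSym_neg_one (l : ℕ) : jacobiSym (-1) l = 1 ∨ jacobiSym (-1) l = -1 := by
  refine jacobiSym.eq_one_or_neg_one ?_
  simp

namespace Admissible

variable {σ : Bool} {S : Finset ℕ}

theorem subset_primeFactors (hS : S ⊆ plusPrimes p q D) : S ⊆ D.primeFactors :=
  fun _ hl => (mem_plusPrimes.1 (hS hl)).1

/-- The parity of the number of arcs from a prime of `V₂` to `V₁`. -/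
theorem neg_one_pow_arcsTo_part (h : Admissible m p q D) (hS : S ⊆ plusPrimes p q D) {l : ℕ}
    (hl : (l : ℤ) ∈ vertices p q D) (hl' : l ∉ S) :
    (-1 : ℤ) ^ ((graph m p q D).arcsTo ⟨l, hl⟩ (part σ S)) = jacobiSym (signedProd σ S) l := by
  have hprime : l.Prime := by
    rcases mem_vertices.1 hl with h1 | h1 | h1 | ⟨k, hk, h1⟩
    · exact absurd h1 (natCast_ne_neg_one l)
    · exact Nat.cast_injective h1 ▸ h.prime_p
    · exact Nat.cast_injective h1 ▸ h.prime_q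
    · exact Nat.cast_injective h1 ▸ Nat.prime_of_mem_primeFactors hk
  have hSD := subset_primeFactors hS
  -- V₁ contains only -1 and primes D_i with i ≤ s, and every prime vertex has its arcs towards
  -- these governed by (v/l) alone.
  have hbase : ∀ v : ℤ, v ∈ signedSet σ S → (Arc m p q D l v ↔ jacobiSym v l = -1) := by
    intro v hv
    rw [h.arc_iff_baseArc (natCast_ne_neg_one l)]
    rw [mem_signedSet] at hv
    by_cases hlp : l ∈ plusPrimes p q D
    · rw [h.baseArc_iff_of_plus hlp]
      refine and_iff_left ?_
      rcases hv with hv | ⟨k, hk, hv⟩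
      · exact Or.inl hv.1
      · exact Or.inr (Or.inr ⟨k, hSD hk, hv⟩)
    · rw [h.baseArc_iff_of_minus]
      · refine and_iff_left ?_
        rcases hv with hv | ⟨k, hk, hv⟩
        · exact Or.inl hv.1
        · exact Or.inr ⟨k, hS hk, hv⟩
      · rcases mem_vertices.1 hl with h1 | h1 | h1 | ⟨k, hk, h1⟩
        · exact absurd h1 (natCast_ne_neg_one l)
        · exact Or.inl (Nat.cast_injective h1)
        · exact Or.inr (Or.inl (Nat.cast_injective h1))
        · obtain rfl := Nat.cast_injective h1
          refine Or.inr (Or.inr (mem_minusPrimes.2 ⟨hk, ?_⟩))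
          have h2 : jacobiSym (p * q) l = 1 ∨ jacobiSym (p * q) l = -1 := by
            rw [jacobiSym.mul_left]
            rcases jacobiSym_of_prime_ne hprime h.prime_p (h.ne_p_of_mem hk).symm with e | e <;>
            rcases jacobiSym_of_prime_ne hprime h.prime_q (h.ne_q_of_mem hk).symm with e' | e' <;>
            simp [e, e']
          exact h2.resolve_left fun h3 => hlp (mem_plusPrimes.2 ⟨hk, h3⟩)
  rw [arcsTo_eq_card (B := (signedSet σ S).filter fun x => jacobiSym x l = -1),
    neg_one_pow_card_filter, ← jacobiSym_prod, prod_signedSet]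
  · intro x hx
    rcases mem_signedSet.1 hx with ⟨rfl, -⟩ | ⟨k, hk, rfl⟩
    · exact jacobiSym_neg_one l
    · exact jacobiSym_of_prime_ne hprime (Nat.prime_of_mem_primeFactors (hSD hk))
        (fun h => hl' (h ▸ hk))
  · intro x hx
    rw [mem_vertices]
    rcases mem_signedSet.1 (Finset.mem_filter.1 hx).1 with ⟨rfl, -⟩ | ⟨k, hk, rfl⟩
    · exact Or.inl rfl
    · exact Or.inr (Or.inr (Or.inr ⟨k, hSD hk, rfl⟩))
  · intro Q
    rw [Finset.mem_filter]
    have : Q ∈ part σ S ↔ (Q : ℤ) ∈ signedSet σ S := mem_signedSet.symm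
    rw [this]
    exact and_congr_right fun hQ => hbase _ hQ

/-- The product of the vertices of `V₂` other than `q`. -/
def coProd (p D : ℕ) (σ : Bool) (S : Finset ℕ) : ℤ := p * signedProd (!σ) (D.primeFactors \ S)

/-- The parity of the number of arcs from a prime of `V₁` to `V₂`. -/
theorem neg_one_pow_arcsTo_compl (h : Admissible m p q D) (hS : S ⊆ plusPrimes p q D) {l : ℕ}
    (hl : (l : ℤ) ∈ vertices p q D) (hl' : l ∈ S) :
    (-1 : ℤ) ^ ((graph m p q D).arcsTo ⟨l, hl⟩ (part σ S)ᶜ) = jacobiSym (coProd p D σ S) l := by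
  have hSD := subset_primeFactors hS
  have hprime := Nat.prime_of_mem_primeFactors (hSD hl')
  have hlp := hS hl'
  have hpB : (p : ℤ) ∉ signedSet (!σ) (D.primeFactors \ S) := by
    rw [mem_signedSet]
    rintro (⟨h1, -⟩ | ⟨k, hk, h1⟩)
    · exact natCast_ne_neg_one p h1
    · exact h.ne_p_of_mem (Finset.mem_sdiff.1 hk).1 (Nat.cast_injective h1).symm
  rw [arcsTo_eq_card (B := (insert (p : ℤ) (signedSet (!σ) (D.primeFactors \ S))).filter
      fun x => jacobiSym x l = -1),
    neg_one_pow_card_filter, ← jacobiSym_prod, Finset.prod_insert hpB, prod_signedSet, coProd]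
  · intro x hx
    rcases Finset.mem_insert.1 hx with rfl | hx
    · exact jacobiSym_of_prime_ne hprime h.prime_p (h.ne_p_of_mem (hSD hl')).symm
    rcases mem_signedSet.1 hx with ⟨rfl, -⟩ | ⟨k, hk, rfl⟩
    · exact jacobiSym_neg_one l
    · rw [Finset.mem_sdiff] at hk
      exact jacobiSym_of_prime_ne hprime (Nat.prime_of_mem_primeFactors hk.1)
        (fun h => hk.2 (h ▸ hl'))
  · intro x hx
    rw [mem_vertices]
    rcases Finset.mem_insert.1 (Finset.mem_filter.1 hx).1 with rfl | hx
    · exact Or.inr (Or.inl rfl)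
    rcases mem_signedSet.1 hx with ⟨rfl, -⟩ | ⟨k, hk, rfl⟩
    · exact Or.inl rfl
    · exact Or.inr (Or.inr (Or.inr ⟨k, (Finset.mem_sdiff.1 hk).1, rfl⟩))
  · rintro ⟨x, hx⟩
    rw [Finset.mem_filter, h.arc_iff_baseArc (natCast_ne_neg_one l), h.baseArc_iff_of_plus hlp,
      Finset.mem_insert, mem_signedSet, Set.mem_compl_iff]
    rcases mem_vertices.1 hx with rfl | rfl | rfl | ⟨k, hk, rfl⟩
    · have hne : (-1 : ℤ) ≠ p := (natCast_ne_neg_one p).symm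
      have hne' : ∀ k : ℕ, (-1 : ℤ) ≠ k := fun k => (natCast_ne_neg_one k).symm
      rw [neg_one_mem_part]
      simp [hne, hne', and_comm]
    · rw [natCast_mem_part]
      have : p ∉ S := fun h' => h.ne_p_of_mem (hSD h') rfl
      simp [this]
    -- The vertex q lies in V₂ but no D_i has an arc to it, hence its absence from `coProd`.
    · rw [natCast_mem_part]
      have h1 : ¬ ((q : ℤ) = -1 ∨ (q : ℤ) = p ∨ ∃ i ∈ D.primeFactors, (q : ℤ) = i) := by
        rintro (h1 | h1 | ⟨k, hk, h1⟩)
        · exact natCast_ne_neg_one q h1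
        · exact h.p_ne_q (Nat.cast_injective h1).symm
        · exact h.ne_q_of_mem hk (Nat.cast_injective h1).symm
      have h2 : ¬ ((q : ℤ) = p ∨ ((q : ℤ) = -1 ∧ (!σ) = true) ∨
          ∃ i ∈ D.primeFactors \ S, (q : ℤ) = i) := by
        rintro (h2 | h2 | ⟨k, hk, h2⟩)
        · exact h1 (Or.inr (Or.inl h2))
        · exact h1 (Or.inl h2.1)
        · exact h1 (Or.inr (Or.inr ⟨k, (Finset.mem_sdiff.1 hk).1, h2⟩))
      simp only [h1, h2, and_false, false_and]
    · rw [natCast_mem_part]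
      have h1 : ((k : ℤ) = -1 ∨ (k : ℤ) = p ∨ ∃ i ∈ D.primeFactors, (k : ℤ) = i) :=
        Or.inr (Or.inr ⟨k, hk, rfl⟩)
      have h2 : ((k : ℤ) = p ∨ ((k : ℤ) = -1 ∧ (!σ) = true) ∨
          ∃ i ∈ D.primeFactors \ S, (k : ℤ) = i) ↔ k ∉ S := by
        constructor
        · rintro (h2 | h2 | ⟨i, hi, h2⟩)
          · exact absurd (Nat.cast_injective h2) (h.ne_p_of_mem hk)
          · exact absurd h2.1 (natCast_ne_neg_one k)
          · rw [Nat.cast_injective h2]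
            exact (Finset.mem_sdiff.1 hi).2
        · exact fun h2 => Or.inr (Or.inr ⟨k, Finset.mem_sdiff.2 ⟨hk, h2⟩, rfl⟩)
      rw [h2, and_iff_left h1]

/-! ### The vertex `-1` -/

/-- Outside Case 3, -1 points to all D_k ≡ 3 mod 4 and to a set E of primes among p, q, of odd size
exactly when D ≡ 1 mod 4. In Case 1 this is because p and q = p + 2 differ mod 4, in Case 5 because
pD ≡ 3 mod 4. -/
theorem arc_neg_one_iff (h : Admissible m p q D)
    (h3 : ¬ ((m = 2 ∧ (p + 2) * D % 8 = 3) ∨ (3 ≤ m ∧ p * D % 4 = 1))) :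
    ∃ E : Finset ℕ, E ⊆ {p, q} ∧ (-1 : ℤ) ^ E.card = -ZMod.χ₄ D ∧
      ∀ v : ℤ, Arc m p q D (-1) v ↔
        (∃ k ∈ D.primeFactors, jacobiSym (-1) k = -1 ∧ v = k) ∨ ∃ k ∈ E, v = (k : ℤ) := by
  have hne : ∀ k : ℕ, (-1 : ℤ) ≠ k := fun k => (natCast_ne_neg_one k).symm
  have c0 : ∀ v, ¬ CommonArc p q D (-1) v := fun v => by
    simp [CommonArc, ResArc, hne]
  have d0 : ∀ v, ¬ DToNegOne D (-1) v := fun v => by simp [DToNegOne, ResArc, hne]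
  have d1 : ∀ v, DToNegOne D v (-1) ↔ ∃ k ∈ D.primeFactors, jacobiSym (-1) k = -1 ∧ v = k :=
    fun v => by simp [DToNegOne, ResArc]
  have p0 : ∀ v, ¬ PQToNegOne p q (-1) v := fun v => by simp [PQToNegOne, ResArc, hne]
  have p1 : ∀ v, PQToNegOne p q v (-1) ↔
      (jacobiSym (-1) p = -1 ∧ v = p) ∨ (jacobiSym (-1) q = -1 ∧ v = q) :=
    fun v => by simp [PQToNegOne, ResArc]
  have a1 : ∀ v, Arc1 p q D (-1) v ↔
      (∃ k ∈ D.primeFactors, jacobiSym (-1) k = -1 ∧ v = k) ∨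
      ((jacobiSym (-1) p = -1 ∧ v = p) ∨ (jacobiSym (-1) q = -1 ∧ v = q)) := fun v => by
    simp only [Arc1, c0, d0, p0, d1, p1, false_or]
  have a2 : ∀ v, Arc2 p q D (-1) v ↔
      (∃ k ∈ D.primeFactors, jacobiSym (-1) k = -1 ∧ v = k) := fun v => by
    simp only [Arc2, c0, d0, p0, d1, false_or, or_false]
  have a4 : ∀ v, Arc4 p q D (-1) v ↔
      (∃ k ∈ D.primeFactors, jacobiSym (-1) k = -1 ∧ v = k) ∨ v = p := fun v => by
    simp only [Arc4, c0, d0, p0, d1, false_or, true_and]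
  have a5 : ∀ v, Arc5 p q D (-1) v ↔
      (∃ k ∈ D.primeFactors, jacobiSym (-1) k = -1 ∧ v = k) ∨
        (jacobiSym (-1) p = -1 ∧ v = p) := fun v => by
    simp only [Arc5, c0, d0, p0, d1, false_or, true_and]
  have hp := h.mod_two_p
  have hq : q % 2 = 1 := Nat.odd_iff.1 (h.prime_q.odd_of_ne_two h.q_ne_two)
  have hD := h.mod_two_D
  have hm := h.one_le
  have jac : ∀ {l : ℕ}, l % 2 = 1 → jacobiSym (-1) l = if l % 4 = 1 then 1 else -1 := fun hl => by
    rw [jacobiSym.at_neg_one (Nat.odd_iff.2 hl), ZMod.χ₄_nat_eq_if_mod_four, if_neg (by omega)]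
  have chiD : ZMod.χ₄ D = if D % 4 = 1 then 1 else -1 := by
    rw [ZMod.χ₄_nat_eq_if_mod_four, if_neg (by omega)]
  have hpD := Nat.mul_mod p D 4
  unfold Arc Nat.ModEq
  rw [chiD]
  rcases (show (m = 1 ∧ D % 4 = 1) ∨
      ((m = 1 ∧ D % 4 = 3) ∨ (m = 2 ∧ D % 4 = 3)) ∨ (m = 2 ∧ D % 4 = 1) ∨ 3 ≤ m by omega)
    with ⟨rfl, hD4⟩ | hD4 | ⟨rfl, hD4⟩ | hm3
  · have hq4 : q % 4 = (p + 2) % 4 := by rw [h.q_eq, pow_one]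
    rcases (show p % 4 = 1 ∨ p % 4 = 3 by omega) with hp4 | hp4
    · refine ⟨{q}, by simp, by simp [hD4], fun v => ?_⟩
      simp [a1, hD4, jac hp, jac hq, hp4, show q % 4 = 3 by omega]
    · refine ⟨{p}, by simp, by simp [hD4], fun v => ?_⟩
      simp [a1, hD4, jac hp, jac hq, hp4, show q % 4 = 1 by omega]
  · have hD3 : D % 4 = 3 := by omega
    refine ⟨∅, by simp, by simp [hD3], fun v => ?_⟩
    rcases hD4 with ⟨rfl, -⟩ | ⟨rfl, -⟩
    · simp [a2, hD3]
    · have : ¬ (p + 2) * D % 8 = 3 := fun h => h3 (Or.inl ⟨rfl, h⟩)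
      simp [a2, hD3, this]
  · refine ⟨{p}, by simp, by simp [hD4], fun v => ?_⟩
    have : ¬ (p + 2) * D % 8 = 3 := fun h => h3 (Or.inl ⟨rfl, h⟩)
    simp [a4, hD4, this]
  · have hpD3 : p * D % 4 = 3 := by
      have h4 : ¬ p * D % 4 = 1 := fun h => h3 (Or.inr ⟨hm3, h⟩)
      have h5 := Nat.mul_mod p D 2
      rw [hp, hD] at h5
      omega
    have e1 : ¬ m = 1 := by omega
    have e2 : ¬ m = 2 := by omega
    rcases (show p % 4 = 1 ∨ p % 4 = 3 by omega) with hp4 | hp4 <;>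
      rcases (show D % 4 = 1 ∨ D % 4 = 3 by omega) with hD4 | hD4 <;>
      rw [hp4, hD4] at hpD
    · omega
    · refine ⟨∅, by simp, by simp [hD4], fun v => ?_⟩
      simp [a5, hD4, jac hp, hp4, hpD3, e1, e2, hm3]
    · refine ⟨{p}, by simp, by simp [hD4], fun v => ?_⟩
      simp [a5, hD4, jac hp, hp4, hpD3, e1, e2, hm3]
    · omega

theorem neg_one_mem_vertices : (-1 : ℤ) ∈ vertices p q D := mem_vertices.2 (Or.inl rfl)

theorem neg_one_pow_card_neg_one (h : Admissible m p q D) {U : Finset ℕ}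
    (hU : U ⊆ D.primeFactors) :
    (-1 : ℤ) ^ (U.filter fun k => jacobiSym (-1) (k : ℕ) = -1).card =
      ZMod.χ₄ ((∏ k ∈ U, k : ℕ) : ZMod 4) := by
  rw [neg_one_pow_card_filter U (fun k => jacobiSym (-1) k) fun k _ => jacobiSym_neg_one k,
    Nat.cast_prod, map_prod]
  exact Finset.prod_congr rfl fun k hk =>
    jacobiSym.at_neg_one (Nat.odd_iff.2 (h.odd_of_mem (hU hk)))

theorem odd_prod (h : Admissible m p q D) {U : Finset ℕ}
    (hU : U ⊆ D.primeFactors) : (∏ k ∈ U, k) % 2 = 1 := by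
  rw [← Nat.odd_iff]
  exact Finset.prod_induction _ Odd (fun _ _ => Odd.mul) odd_one
    fun k hk => Nat.odd_iff.2 (h.odd_of_mem (hU hk))

theorem prod_mul_prod_sdiff (h : Admissible m p q D) {U : Finset ℕ}
    (hU : U ⊆ D.primeFactors) : (∏ k ∈ U, k) * ∏ k ∈ D.primeFactors \ U, k = D := by
  rw [mul_comm, Finset.prod_sdiff hU, Nat.prod_primeFactors_of_squarefree h.squarefree]

/-- The number of arcs from `-1` to the other part. -/
noncomputable def negOneCount (m p q D : ℕ) (σ : Bool) (S : Finset ℕ) : ℕ :=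
  (graph m p q D).arcsTo ⟨-1, neg_one_mem_vertices⟩ (if σ then (part σ S)ᶜ else part σ S)

theorem negOneCount_eq_zero (h : Admissible m p q D)
    (h3 : (m = 2 ∧ (p + 2) * D % 8 = 3) ∨ (3 ≤ m ∧ p * D % 4 = 1)) :
    negOneCount m p q D σ S = 0 := by
  have hne : ∀ k : ℕ, (-1 : ℤ) ≠ k := fun k => (natCast_ne_neg_one k).symm
  have c0 : ∀ v, ¬ CommonArc p q D (-1) v := fun v => by
    simp [CommonArc, ResArc, hne]
  have d0 : ∀ v, ¬ DToNegOne D (-1) v := fun v => by simp [DToNegOne, ResArc, hne]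
  have p0 : ∀ v, ¬ PQToNegOne p q (-1) v := fun v => by simp [PQToNegOne, ResArc, hne]
  have key : ∀ v, ¬ Arc m p q D (-1) v := by
    intro v
    have h5 : ¬ Arc3 p q D (-1) v := by simp [Arc3, c0, d0, p0]
    unfold Arc Nat.ModEq
    rcases h3 with ⟨rfl, h3⟩ | ⟨hm, h3⟩
    · simp [h5, h3]
    · have e1 : ¬ m = 1 := by omega
      have e2 : ¬ m = 2 := by omega
      simp [h5, e1, e2, h3]
  rw [negOneCount, arcsTo_eq_card (B := ∅) (by simp), Finset.card_empty]
  intro Q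
  simp [key]

/-- If -1 is in V₂, the sign of the count is χ₄(∏S). If -1 is in V₁, it is χ₄(D/∏S) times the
contribution -χ₄(D) of E, that is χ₄(-∏S). Both are χ₄ of the signed product. -/
theorem even_negOneCount_iff (h : Admissible m p q D) (hS : S ⊆ plusPrimes p q D)
    (h3 : ¬ ((m = 2 ∧ (p + 2) * D % 8 = 3) ∨ (3 ≤ m ∧ p * D % 4 = 1))) :
    Even (negOneCount m p q D σ S) ↔ signedProd σ S % 4 = 1 := by
  obtain ⟨E, hE, hEc, harc⟩ := h.arc_neg_one_iff h3
  have hSD := subset_primeFactors hS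
  have hodd := h.odd_prod hSD
  have hEv : ∀ k ∈ E, (k : ℤ) ∈ vertices p q D ∧ k ∉ D.primeFactors := fun k hk => by
    have := hE hk
    simp only [Finset.mem_insert, Finset.mem_singleton] at this
    rcases this with rfl | rfl
    · exact ⟨mem_vertices.2 (Or.inr (Or.inl rfl)), fun h' => h.ne_p_of_mem h' rfl⟩
    · exact ⟨mem_vertices.2 (Or.inr (Or.inr (Or.inl rfl))), fun h' => h.ne_q_of_mem h' rfl⟩
  have hDv : ∀ k ∈ D.primeFactors, (k : ℤ) ∈ vertices p q D := fun k hk =>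
    mem_vertices.2 (Or.inr (Or.inr (Or.inr ⟨k, hk, rfl⟩)))
  have hχ : ∀ {n : ℕ}, n % 2 = 1 → ZMod.χ₄ n = if n % 4 = 1 then 1 else -1 := fun hn => by
    rw [ZMod.χ₄_nat_eq_if_mod_four, if_neg (by omega)]
  rw [← neg_one_pow_eq_one_iff_even (R := ℤ) (by norm_num), negOneCount, signedProd, sign]
  cases σ
  · rw [if_neg (by simp), if_neg (by simp),
      arcsTo_eq_card (B := (S.filter fun k => jacobiSym (-1) (k : ℕ) = -1).image
        (fun l : ℕ => (l : ℤ))),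
      Finset.card_image_of_injective _ Nat.cast_injective, h.neg_one_pow_card_neg_one hSD,
      hχ hodd]
    · simp only [one_mul]
      generalize ∏ k ∈ S, k = s at hodd ⊢
      split_ifs with h4
      · simp only [true_iff]
        omega
      · simp only [false_iff]
        omega
    · intro x hx
      obtain ⟨k, hk, rfl⟩ := Finset.mem_image.1 hx
      exact hDv k (hSD (Finset.mem_filter.1 hk).1)
    · rintro ⟨x, hx⟩
      simp only [harc, Finset.mem_image, Finset.mem_filter]
      constructor
      · rintro ⟨⟨-, h1⟩ | ⟨k, hk, rfl : x = k⟩, h2⟩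
        · cases h1
        · refine ⟨k, ⟨hk, ?_⟩, rfl⟩
          rcases h2 with ⟨j, hj, h4, h5⟩ | ⟨j, hj, h5⟩
          · rwa [Nat.cast_injective h5]
          · exact absurd (Nat.cast_injective h5 ▸ hSD hk) (hEv j hj).2
      · rintro ⟨k, ⟨hk, h4⟩, rfl⟩
        exact ⟨Or.inr ⟨k, hk, rfl⟩, Or.inl ⟨k, hSD hk, h4, rfl⟩⟩
  · have hdisj : Disjoint ((D.primeFactors \ S).filter fun k => jacobiSym (-1) (k : ℕ) = -1) E := by
      rw [Finset.disjoint_left]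
      intro k hk hk'
      exact (hEv k hk').2 (Finset.mem_sdiff.1 (Finset.mem_filter.1 hk).1).1
    have hmul := h.prod_mul_prod_sdiff hSD
    have hD2 := h.mod_two_D
    have hodd' := h.odd_prod (U := D.primeFactors \ S) Finset.sdiff_subset
    rw [if_pos rfl, if_pos rfl,
      arcsTo_eq_card (B := (((D.primeFactors \ S).filter fun k => jacobiSym (-1) (k : ℕ) = -1) ∪
        E).image (fun l : ℕ => (l : ℤ))),
      Finset.card_image_of_injective _ Nat.cast_injective, Finset.card_union_of_disjoint hdisj,
      pow_add, hEc, h.neg_one_pow_card_neg_one Finset.sdiff_subset, hχ hodd', hχ hD2]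
    · have h4 := Nat.mul_mod (∏ k ∈ S, k) (∏ k ∈ D.primeFactors \ S, k) 4
      rw [hmul] at h4
      rcases (show (∏ k ∈ S, k) % 4 = 1 ∨ (∏ k ∈ S, k) % 4 = 3 by omega) with h5 | h5 <;>
        rcases (show (∏ k ∈ D.primeFactors \ S, k) % 4 = 1 ∨
          (∏ k ∈ D.primeFactors \ S, k) % 4 = 3 by omega) with h6 | h6 <;>
        rw [h5, h6] at h4 <;> norm_num at h4 <;> simp only [h4, h6, if_true] <;>
        generalize ∏ k ∈ S, k = s at h5 ⊢ <;> norm_num <;> omega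
    · intro x hx
      obtain ⟨k, hk, rfl⟩ := Finset.mem_image.1 hx
      rcases Finset.mem_union.1 hk with hk | hk
      · exact hDv k (Finset.mem_sdiff.1 (Finset.mem_filter.1 hk).1).1
      · exact (hEv k hk).1
    · rintro ⟨x, hx⟩
      simp only [harc, Finset.mem_image, Finset.mem_union, Finset.mem_filter, Finset.mem_sdiff]
      constructor
      · rintro ⟨h1, ⟨k, hk, h4, rfl⟩ | ⟨k, hk, rfl⟩⟩
        · rw [Set.mem_compl_iff, natCast_mem_part] at h1
          exact ⟨k, Or.inl ⟨⟨hk, h1⟩, h4⟩, rfl⟩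
        · exact ⟨k, Or.inr hk, rfl⟩
      · rintro ⟨k, ⟨⟨hk, hk'⟩, h4⟩ | hk, rfl⟩
        · exact ⟨by rwa [Set.mem_compl_iff, natCast_mem_part], Or.inl ⟨k, hk, h4, rfl⟩⟩
        · refine ⟨?_, Or.inr ⟨k, hk, rfl⟩⟩
          rw [Set.mem_compl_iff, natCast_mem_part]
          exact fun h' => (hEv k hk).2 (hSD h')

end Admissible

variable {σ : Bool} {S : Finset ℕ}

/-- `S` consists of primes `D_i` with `i ≤ s`, and the part `± S`, together with its complement,
is a quasi-even partition with respect to `τ`. -/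
def Good (m p q D : ℕ) (τ : vertices p q D → ℤ) (x : Bool × Finset ℕ) : Prop :=
  x.2 ⊆ plusPrimes p q D ∧
    (graph m p q D).IsQuasiEvenPartition τ (part x.1 x.2) (part x.1 x.2)ᶜ

theorem finite_good (τ : vertices p q D → ℤ) : {x | Good m p q D τ x}.Finite :=
  ((Set.finite_univ (α := Bool)).prod (plusPrimes p q D).powerset.finite_toSet).subset
    fun _ hx => ⟨Set.mem_univ _, Finset.mem_coe.2 (Finset.mem_powerset.2 hx.1)⟩

theorem isEvenPartition_iff {V : Type*} (G : Digraph V) (V₁ V₂ : Set V) :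
    G.IsEvenPartition V₁ V₂ ↔ G.IsQuasiEvenPartition (fun _ => 1) V₁ V₂ := by
  simp [Digraph.IsEvenPartition, Digraph.IsQuasiEvenPartition]

theorem jacobiSym_eq_one_iff {l : ℕ} [Fact l.Prime] (hl : l ≠ 2) {n : ℤ} (hn : ¬ (l : ℤ) ∣ n) :
    jacobiSym n l = 1 ↔ IsSquare (n : ℚ_[l]) := by
  rw [Padic.isSquare_intCast_iff hl hn, ← jacobiSym.legendreSym.to_jacobiSym,
    legendreSym.eq_one_iff]
  rwa [Ne, ZMod.intCast_zmod_eq_zero_iff_dvd]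

namespace Admissible

theorem prime_of_mem_vertices (h : Admissible m p q D) {l : ℕ} (hl : (l : ℤ) ∈ vertices p q D) :
    l.Prime ∧ l ≠ 2 := by
  rcases mem_vertices.1 hl with h1 | h1 | h1 | ⟨k, hk, h1⟩
  · exact absurd h1 (natCast_ne_neg_one l)
  · rw [Nat.cast_injective h1]
    exact ⟨h.prime_p, h.p_ne_two⟩
  · rw [Nat.cast_injective h1]
    exact ⟨h.prime_q, h.q_ne_two⟩
  · rw [Nat.cast_injective h1]
    refine ⟨Nat.prime_of_mem_primeFactors hk, ?_⟩
    rintro rfl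
    have := h.odd_of_mem hk
    omega

theorem mem_plus_or_minus (h : Admissible m p q D) {l : ℕ} (hl : l ∈ D.primeFactors) :
    l ∈ plusPrimes p q D ∨ l ∈ minusPrimes p q D := by
  have hprime := Nat.prime_of_mem_primeFactors hl
  rw [mem_plusPrimes, mem_minusPrimes, ← and_or_left, jacobiSym.mul_left]
  refine ⟨hl, ?_⟩
  rcases jacobiSym_of_prime_ne hprime h.prime_p (h.ne_p_of_mem hl).symm with e | e <;>
  rcases jacobiSym_of_prime_ne hprime h.prime_q (h.ne_q_of_mem hl).symm with e' | e' <;>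
  simp [e, e']

theorem notMem_minus_of_mem_plus {l : ℕ} (hl : l ∈ plusPrimes p q D) :
    l ∉ minusPrimes p q D := by
  rw [mem_minusPrimes, (mem_plusPrimes.1 hl).2]
  norm_num

/-! ### Partitions -/

theorem part_injOn (hS : S ⊆ plusPrimes p q D) {σ' : Bool} {S' : Finset ℕ}
    (hS' : S' ⊆ plusPrimes p q D)
    (he : (part σ S : Set (vertices p q D)) = part σ' S') : σ = σ' ∧ S = S' := by
  constructor
  · have := Set.ext_iff.1 he ⟨-1, neg_one_mem_vertices⟩
    rw [neg_one_mem_part, neg_one_mem_part] at this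
    exact Bool.eq_iff_iff.2 this
  · have key : ∀ l ∈ plusPrimes p q D, l ∈ S ↔ l ∈ S' := fun l hl => by
      have hlv : (l : ℤ) ∈ vertices p q D :=
        mem_vertices.2 (Or.inr (Or.inr (Or.inr ⟨l, (mem_plusPrimes.1 hl).1, rfl⟩)))
      have := Set.ext_iff.1 he ⟨l, hlv⟩
      rwa [natCast_mem_part, natCast_mem_part] at this
    ext l
    exact ⟨fun hl => (key l (hS hl)).1 hl, fun hl => (key l (hS' hl)).2 hl⟩

theorem constraint_compl_part (h : Admissible m p q D) (hS : S ⊆ plusPrimes p q D) :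
    Constraint p q D (part σ S)ᶜ := by
  rintro ⟨P, hP⟩ hPc
  rcases hPc with rfl | rfl | ⟨k, hk, rfl⟩ <;> rw [Set.mem_compl_iff, natCast_mem_part]
  · exact fun h' => h.ne_p_of_mem (mem_plusPrimes.1 (hS h')).1 rfl
  · exact fun h' => h.ne_q_of_mem (mem_plusPrimes.1 (hS h')).1 rfl
  · exact fun h' => notMem_minus_of_mem_plus (hS h') hk

/-- The constraint leaves only -1 and the D_i with i ≤ s free to lie in V₁. -/
theorem exists_eq_part (h : Admissible m p q D) {V₁ V₂ : Set (vertices p q D)}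
    (hc : IsCompl V₁ V₂) (hV : Constraint p q D V₂) :
    ∃ σ, ∃ S ⊆ plusPrimes p q D, V₁ = part σ S ∧ V₂ = (part σ S)ᶜ := by
  classical
  suffices ∃ σ, ∃ S ⊆ plusPrimes p q D, V₁ = part σ S by
    obtain ⟨σ, S, hS, rfl⟩ := this
    exact ⟨σ, S, hS, rfl, hc.compl_eq.symm⟩
  refine ⟨decide (⟨-1, neg_one_mem_vertices⟩ ∈ V₁),
    (plusPrimes p q D).filter fun l => ∃ hl : (l : ℤ) ∈ vertices p q D, ⟨l, hl⟩ ∈ V₁,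
    Finset.filter_subset _ _, ?_⟩
  have hdisj : ∀ P ∈ V₁, P ∉ V₂ := fun P h1 h2 => Set.disjoint_left.1 hc.disjoint h1 h2
  ext ⟨P, hP⟩
  rcases mem_vertices.1 hP with rfl | rfl | rfl | ⟨k, hk, rfl⟩
  · rw [neg_one_mem_part, decide_eq_true_iff]
  · rw [natCast_mem_part]
    refine iff_of_false (fun h' => hdisj _ h' (hV _ (Or.inl rfl))) fun h' => ?_
    exact h.ne_p_of_mem (mem_plusPrimes.1 (Finset.mem_filter.1 h').1).1 rfl
  · rw [natCast_mem_part]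
    refine iff_of_false (fun h' => hdisj _ h' (hV _ (Or.inr (Or.inl rfl)))) fun h' => ?_
    exact h.ne_q_of_mem (mem_plusPrimes.1 (Finset.mem_filter.1 h').1).1 rfl
  · rw [natCast_mem_part, Finset.mem_filter]
    constructor
    · refine fun h' => ⟨(h.mem_plus_or_minus hk).resolve_right fun h2 => ?_, hP, h'⟩
      exact hdisj _ h' (hV _ (Or.inr (Or.inr ⟨k, h2, rfl⟩)))
    · rintro ⟨-, _, h'⟩
      exact h'

theorem ncard_partitions (h : Admissible m p q D) (τ : vertices p q D → ℤ) :
    {V : Set (vertices p q D) × Set (vertices p q D) |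
      (graph m p q D).IsQuasiEvenPartition τ V.1 V.2 ∧ Constraint p q D V.2}.ncard =
      {x | Good m p q D τ x}.ncard := by
  have himg : {V : Set (vertices p q D) × Set (vertices p q D) |
      (graph m p q D).IsQuasiEvenPartition τ V.1 V.2 ∧ Constraint p q D V.2} =
      (fun x : Bool × Finset ℕ => (part x.1 x.2, (part x.1 x.2)ᶜ)) '' {x | Good m p q D τ x} := by
    ext ⟨V₁, V₂⟩
    constructor
    · rintro ⟨h1, h2⟩
      obtain ⟨σ, S, hS, rfl, rfl⟩ := h.exists_eq_part h1.1 h2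
      exact ⟨(σ, S), ⟨hS, h1⟩, rfl⟩
    · rintro ⟨⟨σ, S⟩, ⟨hS, h1⟩, he⟩
      obtain ⟨rfl, rfl⟩ := Prod.mk.inj he
      exact ⟨h1, h.constraint_compl_part hS⟩
  rw [himg, Set.InjOn.ncard_image]
  rintro ⟨σ, S⟩ hx ⟨σ', S'⟩ hx' he
  obtain ⟨h1, h2⟩ := part_injOn hx.1 hx'.1 (Prod.mk.inj he).1
  exact Prod.ext h1 h2

theorem evenCount_eq (h : Admissible m p q D) :
    evenCount m p q D = {x | Good m p q D (fun _ => 1) x}.ncard := by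
  rw [evenCount, ← h.ncard_partitions]
  simp only [isEvenPartition_iff]

theorem quasiEvenCount_eq (h : Admissible m p q D) :
    quasiEvenCount m p q D = {x | Good m p q D (twoSymbol m p q D) x}.ncard := by
  rw [quasiEvenCount, ← h.ncard_partitions]

theorem not_dvd_prod {l : ℕ} (hl : l.Prime) (hS : ∀ k ∈ S, k.Prime) (hlS : l ∉ S) :
    ¬ l ∣ ∏ k ∈ S, k := by
  rw [hl.prime.dvd_finsetProd_iff]
  rintro ⟨k, hk, hd⟩
  exact hlS ((Nat.prime_dvd_prime_iff_eq hl (hS k hk)).1 hd ▸ hk)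

theorem dvd_sign_mul {l : ℕ} (σ : Bool) (n : ℤ) : (l : ℤ) ∣ sign σ * n ↔ (l : ℤ) ∣ n := by
  cases σ <;> simp [sign]

theorem prime_of_mem (hS : S ⊆ plusPrimes p q D) : ∀ k ∈ S, k.Prime := fun _ hk =>
  Nat.prime_of_mem_primeFactors (subset_primeFactors hS hk)

theorem not_dvd_of_prime_ne_two {l : ℕ} (hl : l.Prime) (hl2 : l ≠ 2) {ε : ℤ}
    (hε : ε = 1 ∨ ε = 2) : ¬ (l : ℤ) ∣ ε := by
  rcases hε with rfl | rfl
  · exact_mod_cast hl.one_lt.ne' ∘ Nat.dvd_one.1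
  · intro hd
    exact hl2 ((Nat.prime_dvd_prime_iff_eq hl Nat.prime_two).1 (by exact_mod_cast hd))

theorem not_dvd_mul_signedProd {l : ℕ} (hl : l.Prime) (hl2 : l ≠ 2) {ε : ℤ}
    (hε : ε = 1 ∨ ε = 2) (hS : ∀ k ∈ S, k.Prime) (hlS : l ∉ S) :
    ¬ (l : ℤ) ∣ ε * signedProd σ S := by
  rw [(Nat.prime_iff_prime_int.1 hl).dvd_mul, signedProd, dvd_sign_mul]
  exact fun hd => hd.elim (not_dvd_of_prime_ne_two hl hl2 hε)
    fun hd => not_dvd_prod hl hS hlS (Int.natCast_dvd_natCast.1 hd)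

theorem not_dvd_mul_coProd (h : Admissible m p q D) {l : ℕ} (hl : l.Prime) (hl2 : l ≠ 2) {ε : ℤ}
    (hε : ε = 1 ∨ ε = 2) (hlp : l ≠ p) (hlS : l ∈ S) :
    ¬ (l : ℤ) ∣ ε * coProd p D σ S := by
  rw [coProd, mul_left_comm, (Nat.prime_iff_prime_int.1 hl).dvd_mul]
  refine fun hd => hd.elim (fun hd => ?_) (not_dvd_mul_signedProd hl hl2 hε
    (fun k hk => Nat.prime_of_mem_primeFactors (Finset.mem_sdiff.1 hk).1)
    fun h' => (Finset.mem_sdiff.1 h').2 hlS)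
  exact hlp ((Nat.prime_dvd_prime_iff_eq hl h.prime_p).1 (Int.natCast_dvd_natCast.1 hd))

/-- The conditions on a partition at the prime vertices. -/
def PrimeConditions (p q D : ℕ) (ε : ℤ) (σ : Bool) (S : Finset ℕ) : Prop :=
  ∀ l : ℕ, (l : ℤ) ∈ vertices p q D →
    (l ∉ S → jacobiSym (ε * signedProd σ S) l = 1) ∧
    (l ∈ S → jacobiSym (ε * coProd p D σ S) l = 1)

/-- At a prime vertex the prescribed sign (ε/l) and the sign of the count merge into a single Jacobi
symbol; only -1 keeps a condition on the number of its arcs. -/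
theorem good_iff (h : Admissible m p q D) (hS : S ⊆ plusPrimes p q D) {τ : vertices p q D → ℤ}
    {ε : ℤ} (hε : ε = 1 ∨ ε = 2)
    (hτ : ∀ (l : ℕ) (hl : (l : ℤ) ∈ vertices p q D), τ ⟨l, hl⟩ = jacobiSym ε l) :
    Good m p q D τ (σ, S) ↔
      ParityOK (τ ⟨-1, neg_one_mem_vertices⟩) (negOneCount m p q D σ S) ∧
        PrimeConditions p q D ε σ S := by
  have hsym : ∀ (l : ℕ), (l : ℤ) ∈ vertices p q D → jacobiSym ε l = 1 ∨ jacobiSym ε l = -1 := by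
    intro l hl
    obtain ⟨h1, h2⟩ := h.prime_of_mem_vertices hl
    refine jacobiSym.eq_one_or_neg_one ?_
    rcases hε with rfl | rfl
    · simp
    · exact (Nat.coprime_primes Nat.prime_two h1).2 h2.symm
  have h1 : ∀ (l : ℕ) (hl : (l : ℤ) ∈ vertices p q D), l ∉ S →
      (ParityOK (τ ⟨l, hl⟩) ((graph m p q D).arcsTo ⟨l, hl⟩ (part σ S)) ↔
        jacobiSym (ε * signedProd σ S) l = 1) := fun l hl hlS => by
    rw [hτ, parityOK_iff (hsym l hl), h.neg_one_pow_arcsTo_part hS hl hlS, jacobiSym.mul_left]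
  have h2 : ∀ (l : ℕ) (hl : (l : ℤ) ∈ vertices p q D), l ∈ S →
      (ParityOK (τ ⟨l, hl⟩) ((graph m p q D).arcsTo ⟨l, hl⟩ (part σ S)ᶜ) ↔
        jacobiSym (ε * coProd p D σ S) l = 1) := fun l hl hlS => by
    rw [hτ, parityOK_iff (hsym l hl), h.neg_one_pow_arcsTo_compl hS hl hlS, jacobiSym.mul_left]
  constructor
  · rintro ⟨-, -, h3, h4⟩
    refine ⟨?_, fun l hl => ⟨fun hlS => (h1 l hl hlS).1 (h4 _ ?_),
      fun hlS => (h2 l hl hlS).1 (h3 _ ?_)⟩⟩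
    · unfold negOneCount
      cases σ
      · exact h4 _ (by rw [Set.mem_compl_iff, neg_one_mem_part]; simp)
      · exact h3 _ (by rw [neg_one_mem_part])
    · rwa [Set.mem_compl_iff, natCast_mem_part]
    · rwa [natCast_mem_part]
  · rintro ⟨h3, h4⟩
    have hv : ∀ x ∈ vertices p q D, x ≠ -1 → ∃ l : ℕ, x = l := fun x hx hx1 => by
      rcases mem_vertices.1 hx with h5 | h5 | h5 | ⟨l, -, h5⟩
      exacts [absurd h5 hx1, ⟨_, h5⟩, ⟨_, h5⟩, ⟨_, h5⟩]
    refine ⟨hS, isCompl_compl, ?_, ?_⟩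
    · rintro ⟨x, hx⟩ hxp
      by_cases hx1 : x = -1
      · subst hx1
        rw [neg_one_mem_part] at hxp
        subst hxp
        exact h3
      · obtain ⟨l, rfl⟩ := hv x hx hx1
        rw [natCast_mem_part] at hxp
        exact (h2 l hx hxp).2 ((h4 l hx).2 hxp)
    · rintro ⟨x, hx⟩ hxp
      by_cases hx1 : x = -1
      · subst hx1
        rw [Set.mem_compl_iff, neg_one_mem_part, Bool.not_eq_true] at hxp
        subst hxp
        exact h3
      · obtain ⟨l, rfl⟩ := hv x hx hx1
        rw [Set.mem_compl_iff, natCast_mem_part] at hxp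
        exact (h1 l hx hxp).2 ((h4 l hx).1 hxp)

/-! ### Local conditions at the odd primes -/

theorem q_sub_p (h : Admissible m p q D) : (q : ℤ) - p = 2 ^ m := by
  rw [h.q_eq]
  push_cast
  ring

theorem not_dvd_q_sub_p (h : Admissible m p q D) {l : ℕ} (hl : l.Prime) (hl2 : l ≠ 2) :
    ¬ (l : ℤ) ∣ (q : ℤ) - p := by
  rw [h.q_sub_p]
  intro hd
  have := Nat.Prime.dvd_of_dvd_pow hl (m := 2) (n := m) (by exact_mod_cast hd)
  exact hl2 ((Nat.prime_dvd_prime_iff_eq hl Nat.prime_two).1 this)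

theorem exists_eq_mul (h : Admissible m p q D) {l : ℕ} (hl : l ∈ D.primeFactors) :
    ∃ c : ℤ, (D : ℤ) = l * c ∧ ¬ (l : ℤ) ∣ c := by
  obtain ⟨c, hc⟩ := Nat.dvd_of_mem_primeFactors hl
  refine ⟨c, by exact_mod_cast hc, fun hd => ?_⟩
  obtain ⟨e, rfl⟩ := Int.natCast_dvd_natCast.1 hd
  have := h.squarefree l ⟨e, by rw [hc, mul_assoc]⟩
  exact (Nat.prime_of_mem_primeFactors hl).one_lt.ne' (Nat.isUnit_iff.1 this)

theorem not_dvd_of_ne {l r : ℕ} (hl : l.Prime) (hr : r.Prime) (hne : l ≠ r) :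
    ¬ (l : ℤ) ∣ r := fun hd =>
  hne ((Nat.prime_dvd_prime_iff_eq hl hr).1 (Int.natCast_dvd_natCast.1 hd))

theorem not_dvd_mul_pq (h : Admissible m p q D) {l : ℕ} (hl : l ∈ D.primeFactors) :
    ¬ (l : ℤ) ∣ p * q := by
  have hprime := Nat.prime_of_mem_primeFactors hl
  rw [(Nat.prime_iff_prime_int.1 hprime).dvd_mul]
  exact fun hd => hd.elim (not_dvd_of_ne hprime h.prime_p (h.ne_p_of_mem hl))
    (not_dvd_of_ne hprime h.prime_q (h.ne_q_of_mem hl))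

/-- At `p`, `q` and the `D_k` with `k > s` only squares are solvable. -/
theorem isSquare_of_localPoint (h : Admissible m p q D) {l : ℕ} [hl : Fact l.Prime]
    (hl' : l = p ∨ l = q ∨ l ∈ minusPrimes p q D) {n : ℤ}
    (hn : LocalPoint ℚ_[l] p q D n) : IsSquare (n : ℚ_[l]) := by
  rcases hl' with rfl | rfl | hl'
  · exact LocalPoint.isSquare_of_eq_left h.p_ne_two (not_dvd_of_ne hl.1 h.prime_q h.p_ne_q)
      (fun hd => h.p_not_dvd (Int.natCast_dvd_natCast.1 hd)) hn
  · exact LocalPoint.isSquare_of_eq_left h.q_ne_two (not_dvd_of_ne hl.1 h.prime_p h.p_ne_q.symm)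
      (fun hd => h.q_not_dvd (Int.natCast_dvd_natCast.1 hd)) hn.swap
  · obtain ⟨hlD, hs⟩ := mem_minusPrimes.1 hl'
    have hl2 : l ≠ 2 := by
      rintro rfl
      have := h.odd_of_mem hlD
      omega
    obtain ⟨c, hc, hlc⟩ := h.exists_eq_mul hlD
    rw [hc] at hn
    refine LocalPoint.isSquare_of_not_isSquare_mul hl2 (h.not_dvd_q_sub_p hl.1 hl2)
      (not_dvd_of_ne hl.1 h.prime_p (h.ne_p_of_mem hlD))
      (not_dvd_of_ne hl.1 h.prime_q (h.ne_q_of_mem hlD)) hlc (fun hsq => ?_) hn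
    rw [← Int.cast_mul, ← jacobiSym_eq_one_iff hl2 (h.not_dvd_mul_pq hlD), hs] at hsq
    norm_num at hsq

theorem not_dvd_of_isSquare {l : ℕ} [hl : Fact l.Prime] {n : ℤ} (hn : Squarefree n)
    (hs : IsSquare (n : ℚ_[l])) : ¬ (l : ℤ) ∣ n := by
  rintro ⟨c, rfl⟩
  have hc : ¬ (l : ℤ) ∣ c := by
    rintro ⟨e, rfl⟩
    exact (Nat.prime_iff_prime_int.1 hl.1).not_isUnit (hn l ⟨e, by ring⟩)
  rw [Int.cast_mul, Int.cast_natCast] at hs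
  exact Padic.not_isSquare_prime_mul (Padic.norm_intCast_eq_one_of_not_dvd hc) hs

theorem localPoint_iff_of_plus (h : Admissible m p q D) {l : ℕ} [hl : Fact l.Prime]
    (hlp : l ∈ plusPrimes p q D) {n : ℤ} : LocalPoint ℚ_[l] p q D n ↔
      IsSquare (n : ℚ_[l]) ∨ IsSquare (-(p * D * n) : ℚ_[l]) := by
  obtain ⟨hlD, hs⟩ := mem_plusPrimes.1 hlp
  have hl2 : l ≠ 2 := by
    rintro rfl
    have := h.odd_of_mem hlD
    omega
  obtain ⟨c, hc, hlc⟩ := h.exists_eq_mul hlD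
  have hpq : IsSquare (((p : ℤ) : ℚ_[l]) * ((q : ℤ) : ℚ_[l])) := by
    rw [← Int.cast_mul, ← jacobiSym_eq_one_iff hl2 (h.not_dvd_mul_pq hlD), hs]
  have hD0 : (D : ℤ) ≠ 0 := by exact_mod_cast h.squarefree.ne_zero
  constructor
  · intro hn
    have := LocalPoint.isSquare_or_of_isSquare_mul hl2 (h.not_dvd_q_sub_p hl.1 hl2)
      (not_dvd_of_ne hl.1 h.prime_p (h.ne_p_of_mem hlD)) hlc hpq (hc ▸ hn)
    rw [← hc] at this
    simpa only [Int.cast_natCast] using this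
  · rintro (hn | hn)
    · exact Or.inl hn
    · refine LocalPoint.of_torsion (by exact_mod_cast h.prime_p.ne_zero)
        (by exact_mod_cast h.p_ne_q) hD0 hpq ?_
      simpa only [Int.cast_natCast] using hn

/-- Only at the D_i with i ≤ s is there an alternative to n being a square, and there -pDn has
valuation 1 when n is a unit. -/
theorem localPoint_iff_of_not_dvd (h : Admissible m p q D) {l : ℕ} [hl : Fact l.Prime]
    (hlv : (l : ℤ) ∈ vertices p q D) {n : ℤ} (hn : ¬ (l : ℤ) ∣ n) :
    LocalPoint ℚ_[l] p q D n ↔ jacobiSym n l = 1 := by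
  have hl2 := (h.prime_of_mem_vertices hlv).2
  rw [jacobiSym_eq_one_iff hl2 hn]
  refine ⟨fun hL => ?_, Or.inl⟩
  by_cases hlp : l ∈ plusPrimes p q D
  · have hlD := (mem_plusPrimes.1 hlp).1
    refine ((h.localPoint_iff_of_plus hlp).1 hL).resolve_right fun hs => ?_
    obtain ⟨c, hc, hlc⟩ := h.exists_eq_mul hlD
    have hpn : ¬ (l : ℤ) ∣ -(p * n) := by
      rw [dvd_neg, (Nat.prime_iff_prime_int.1 hl.1).dvd_mul]
      exact fun hd => hd.elim (not_dvd_of_ne hl.1 h.prime_p (h.ne_p_of_mem hlD)) hn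
    refine LocalPoint.not_isSquare_of_exact hlc (Padic.norm_intCast_eq_one_of_not_dvd hpn) ?_
    rw [← hc]
    have e : (((D : ℤ) : ℚ_[l]) * ((-(p * n) : ℤ) : ℚ_[l])) = -(p * D * n) := by
      push_cast
      ring
    rwa [e]
  · refine h.isSquare_of_localPoint ?_ hL
    rcases mem_vertices.1 hlv with h1 | h1 | h1 | ⟨k, hk, h1⟩
    · exact absurd h1 (natCast_ne_neg_one l)
    · exact Or.inl (Nat.cast_injective h1)
    · exact Or.inr (Or.inl (Nat.cast_injective h1))
    · rw [← Nat.cast_injective h1] at hk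
      exact Or.inr (Or.inr ((h.mem_plus_or_minus hk).resolve_left hlp))

/-- The torsion class -pD is the product of all vertices but q. Multiplying by it exchanges V₁ for
V₂ without q, up to squares, which is why a prime in V₁ looks at V₂. -/
theorem neg_mul_signedProd (h : Admissible m p q D) (hS : S ⊆ plusPrimes p q D) (ε : ℤ) :
    -(p * D * (ε * signedProd σ S)) = ((∏ k ∈ S, k : ℕ) : ℤ) ^ 2 * (ε * coProd p D σ S) := by
  have hD : (D : ℤ) = ((∏ k ∈ S, k : ℕ) : ℤ) * ((∏ k ∈ D.primeFactors \ S, k : ℕ) : ℤ) := by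
    exact_mod_cast (h.prod_mul_prod_sdiff (subset_primeFactors hS)).symm
  have hsign : sign (!σ) = -sign σ := by cases σ <;> rfl
  rw [coProd, signedProd, signedProd, hsign, hD]
  ring

theorem squarefree_mul_signedProd (h : Admissible m p q D) (hS : S ⊆ plusPrimes p q D) {ε : ℤ}
    (hε : ε = 1 ∨ ε = 2) : Squarefree (ε * signedProd σ S) := by
  have hSD := subset_primeFactors hS
  have hsf : Squarefree (∏ k ∈ S, k) := h.squarefree.squarefree_of_dvd
    ⟨_, (h.prod_mul_prod_sdiff hSD).symm⟩
  have hodd := h.odd_prod hSD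
  have habs : (sign σ).natAbs = 1 := by cases σ <;> rfl
  rw [← Int.squarefree_natAbs, Int.natAbs_mul, signedProd, Int.natAbs_mul, habs, one_mul,
    Int.natAbs_natCast]
  rcases hε with rfl | rfl
  · simpa using hsf
  · refine (Nat.squarefree_mul ?_).2 ⟨Nat.squarefree_two, hsf⟩
    exact Nat.coprime_two_left.2 (Nat.odd_iff.2 hodd)

/-- The class is divisible by l exactly once, so it is not a square and -pD times it must be. -/
theorem localPoint_iff_of_mem (h : Admissible m p q D) (hS : S ⊆ plusPrimes p q D) {ε : ℤ}
    (hε : ε = 1 ∨ ε = 2) {l : ℕ} [hl : Fact l.Prime] (hlS : l ∈ S) :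
    LocalPoint ℚ_[l] p q D (ε * signedProd σ S) ↔ jacobiSym (ε * coProd p D σ S) l = 1 := by
  have hlD := subset_primeFactors hS hlS
  have hl2 : l ≠ 2 := by
    rintro rfl
    have := h.odd_of_mem hlD
    omega
  have hP : ((∏ k ∈ S, k : ℕ) : ℚ_[l]) ≠ 0 := by
    exact_mod_cast Finset.prod_ne_zero_iff.2 fun k hk => (prime_of_mem hS k hk).ne_zero
  rw [jacobiSym_eq_one_iff hl2 (h.not_dvd_mul_coProd hl.1 hl2 hε (h.ne_p_of_mem hlD) hlS),
    h.localPoint_iff_of_plus (hS hlS), or_iff_right]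
  · have e : (-(p * D * ((ε * signedProd σ S : ℤ) : ℚ_[l])) : ℚ_[l]) =
        ((∏ k ∈ S, k : ℕ) : ℚ_[l]) ^ 2 * ((ε * coProd p D σ S : ℤ) : ℚ_[l]) := by
      exact_mod_cast congrArg (Int.cast : ℤ → ℚ_[l]) (h.neg_mul_signedProd (σ := σ) hS ε)
    rw [e]
    exact ⟨fun hs => IsSquare.of_mul_left hs (IsSquare.sq _) (pow_ne_zero 2 hP),
      fun hs => (IsSquare.sq _).mul hs⟩
  · refine fun hs => not_dvd_of_isSquare (h.squarefree_mul_signedProd hS hε) hs ?_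
    refine Dvd.dvd.mul_left ((dvd_sign_mul σ _).2 ?_) ε
    exact Int.natCast_dvd_natCast.2 (Finset.dvd_prod_of_mem _ hlS)

open TwoIsogeny in
theorem everywhereSolvable_iff_localPoint {n : ℤ} :
    EverywhereSolvable (-(p + q) * D) (p * q * D ^ 2) n ↔
      (∀ (l : ℕ) [Fact l.Prime], LocalPoint ℚ_[l] p q D n) ∧ LocalPoint ℝ p q D n := by
  have key : ∀ (k : Type) [Field k] [CharZero k],
      TorsorSolvable k (-(p + q) * D) (p * q * D ^ 2) n ↔ LocalPoint k p q D n := fun k _ _ => by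
    rw [← LocalPoint.iff_torsorSolvable]
    simp only [Int.cast_natCast]
  simp only [EverywhereSolvable, key]

/-- Solvability of the torsor of `± ∏ S` or `± 2 ∏ S` at all places in terms of the partition. -/
theorem everywhereSolvable_iff (h : Admissible m p q D) (hS : S ⊆ plusPrimes p q D) {ε : ℤ}
    (hε : ε = 1 ∨ ε = 2) :
    TwoIsogeny.EverywhereSolvable (-(p + q) * D) (p * q * D ^ 2) (ε * signedProd σ S : ℤ) ↔
      LocalPoint ℚ_[2] p q D (ε * signedProd σ S) ∧ PrimeConditions p q D ε σ S := by
  rw [everywhereSolvable_iff_localPoint]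
  constructor
  · rintro ⟨hL, -⟩
    refine ⟨hL 2, fun l hl => ?_⟩
    obtain ⟨hl1, hl2⟩ := h.prime_of_mem_vertices hl
    have : Fact l.Prime := ⟨hl1⟩
    exact ⟨fun hlS => (h.localPoint_iff_of_not_dvd hl
      (not_dvd_mul_signedProd hl1 hl2 hε (prime_of_mem hS) hlS)).1 (hL l),
      fun hlS => (h.localPoint_iff_of_mem hS hε hlS).1 (hL l)⟩
  · rintro ⟨h2, hP⟩
    refine ⟨fun l hl => ?_, LocalPoint.real (by exact_mod_cast h.prime_p.pos)
      (by exact_mod_cast h.prime_q.pos) (by exact_mod_cast Nat.pos_of_ne_zero h.squarefree.ne_zero)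
      (h.squarefree_mul_signedProd hS hε).ne_zero⟩
    by_cases hl2 : l = 2
    · subst hl2
      exact h2
    by_cases hlS : l ∈ S
    · refine (h.localPoint_iff_of_mem hS hε hlS).2 ((hP l ?_).2 hlS)
      exact mem_vertices.2 (Or.inr (Or.inr (Or.inr ⟨l, subset_primeFactors hS hlS, rfl⟩)))
    have hn := not_dvd_mul_signedProd (σ := σ) hl.1 hl2 hε (prime_of_mem hS) hlS
    by_cases hlv : (l : ℤ) ∈ vertices p q D
    · exact (h.localPoint_iff_of_not_dvd hlv hn).2 ((hP l hlv).1 hlS)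
    · have hlv' := mt mem_vertices.2 hlv
      push Not at hlv'
      refine LocalPoint.of_good_reduction hl2 (h.not_dvd_q_sub_p hl.1 hl2)
        (not_dvd_of_ne hl.1 h.prime_p fun e => hlv'.2.1 (congrArg _ e))
        (not_dvd_of_ne hl.1 h.prime_q fun e => hlv'.2.2.1 (congrArg _ e)) (fun hd => ?_) hn
      exact hlv'.2.2.2 l (Nat.mem_primeFactors.2
        ⟨hl.1, Int.natCast_dvd_natCast.1 hd, h.squarefree.ne_zero⟩) rfl

/-! ### The local condition at `2` -/

theorem signedProd_mod_two (h : Admissible m p q D) (hS : S ⊆ plusPrimes p q D) :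
    signedProd σ S % 2 = 1 := by
  have := h.odd_prod (subset_primeFactors hS)
  rw [signedProd]
  generalize ∏ k ∈ S, k = s at this ⊢
  cases σ <;> simp only [sign, if_true, if_false, Bool.false_eq_true] <;> omega

theorem allOddClasses_iff : LocalPoint.AllOddClasses m p D ↔
    ((m = 2 ∧ (p + 2) * D % 8 = 3) ∨ (3 ≤ m ∧ p * D % 4 = 1)) := by
  unfold LocalPoint.AllOddClasses
  norm_cast

theorem parityOK_one_iff (h : Admissible m p q D) (hS : S ⊆ plusPrimes p q D) :
    ParityOK 1 (negOneCount m p q D σ S) ↔ LocalPoint ℚ_[2] p q D (signedProd σ S) := by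
  have hq : (q : ℤ) = p + 2 ^ m := by exact_mod_cast h.q_eq
  rw [hq, LocalPoint.odd_iff (by exact_mod_cast h.mod_two_p) (by exact_mod_cast h.mod_two_D)
    h.one_le (h.signedProd_mod_two hS), allOddClasses_iff]
  have hE : ParityOK 1 (negOneCount m p q D σ S) ↔ Even (negOneCount m p q D σ S) := by
    simp [ParityOK]
  rw [hE]
  by_cases h3 : (m = 2 ∧ (p + 2) * D % 8 = 3) ∨ (3 ≤ m ∧ p * D % 4 = 1)
  · simp [h.negOneCount_eq_zero h3, h3]
  · simp [h.even_negOneCount_iff hS h3, h3]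

theorem parityOK_ite {A B : Prop} [Decidable A] [Decidable B] {c : ℕ} :
    ParityOK (if A then 1 else if B then -1 else 0) c ↔ (A → Even c) ∧ (¬ A → B → ¬ Even c) := by
  unfold ParityOK
  split_ifs <;> simp [*]

/-- The count at -1 enters only through d mod 4, or is zero in Case 3, which leaves a finite check
over residues and ranges of m. The default value 0 of `twoOverNegOne` occurs only under `OnlyEven`,
so it never leaves the parity at -1 unconstrained where quasi-even partitions count. -/
theorem evenClass_iff (h : Admissible m p q D) (hS : S ⊆ plusPrimes p q D) :
    LocalPoint.EvenClass m p D (signedProd σ S) ↔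
      ¬ OnlyEven m p D ∧ ParityOK (twoOverNegOne m p D) (negOneCount m p q D σ S) := by
  have hd := h.signedProd_mod_two (σ := σ) hS
  have hD := h.mod_two_D
  have hpD := Nat.mul_mod p D 2
  rw [h.mod_two_p, hD] at hpD
  have hm := h.one_le
  rw [twoOverNegOne, parityOK_ite]
  by_cases hm2 : m = 2
  · simp [LocalPoint.EvenClass, OnlyEven, hm2]
  have hE : Even (negOneCount m p q D σ S) ↔
      (3 ≤ m ∧ p * D % 4 = 1) ∨ signedProd σ S % 4 = 1 := by
    by_cases h3 : 3 ≤ m ∧ p * D % 4 = 1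
    · simp [h.negOneCount_eq_zero (Or.inr h3), h3]
    · rw [h.even_negOneCount_iff hS (by simp [hm2, h3]), or_iff_right h3]
  have e : (p : ℤ) * D = (p * D : ℕ) := by push_cast; rfl
  rw [hE]
  unfold LocalPoint.EvenClass OnlyEven Nat.ModEq
  rw [e]
  generalize p * D = N at *
  generalize signedProd σ S = d at *
  clear hE hS e
  have e4 : N % 4 = N % 8 % 4 := by omega
  have e8 : ((N : ℕ) : ℤ) % 8 = (N % 8 : ℕ) := by push_cast; rfl
  have eD : ((D : ℕ) : ℤ) % 4 = (D % 4 : ℕ) := by push_cast; rfl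
  rw [e4, e8, eD]
  rcases (show N % 8 = 1 ∨ N % 8 = 3 ∨ N % 8 = 5 ∨ N % 8 = 7 by omega) with hN | hN | hN | hN <;>
  rcases (show D % 4 = 1 ∨ D % 4 = 3 by omega) with hD4 | hD4 <;>
  rcases (show d % 4 = 1 ∨ d % 4 = 3 by omega) with hd4 | hd4 <;>
  rw [hN, hD4, hd4] <;> norm_num <;> omega

theorem localPoint_two_mul_iff (h : Admissible m p q D) (hS : S ⊆ plusPrimes p q D) :
    LocalPoint ℚ_[2] p q D (2 * signedProd σ S) ↔
      ¬ OnlyEven m p D ∧ ParityOK (twoOverNegOne m p D) (negOneCount m p q D σ S) := by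
  have hq : (q : ℤ) = p + 2 ^ m := by exact_mod_cast h.q_eq
  have hd := h.signedProd_mod_two (σ := σ) hS
  have hD : (D : ℤ) % 2 = 1 := by exact_mod_cast h.mod_two_D
  rw [← h.evenClass_iff hS, hq]
  exact ⟨LocalPoint.evenClass_of (by exact_mod_cast h.mod_two_p) hD h.one_le hd,
    LocalPoint.of_evenClass hD hd⟩

/-! ### Counting -/

theorem good_one_iff (h : Admissible m p q D) (hS : S ⊆ plusPrimes p q D) :
    Good m p q D (fun _ => 1) (σ, S) ↔
      TwoIsogeny.EverywhereSolvable (-(p + q) * D) (p * q * D ^ 2) (1 * signedProd σ S : ℤ) := by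
  rw [h.everywhereSolvable_iff hS (Or.inl rfl), one_mul, ← h.parityOK_one_iff hS,
    h.good_iff hS (Or.inl rfl) fun l _ => (jacobiSym.one_left l).symm]

theorem good_twoSymbol_iff (h : Admissible m p q D) (hS : S ⊆ plusPrimes p q D) :
    (¬ OnlyEven m p D ∧ Good m p q D (twoSymbol m p q D) (σ, S)) ↔
      TwoIsogeny.EverywhereSolvable (-(p + q) * D) (p * q * D ^ 2) (2 * signedProd σ S : ℤ) := by
  rw [h.everywhereSolvable_iff hS (Or.inr rfl), h.localPoint_two_mul_iff hS,
    h.good_iff hS (Or.inr rfl), and_assoc]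
  · rfl
  · intro l hl
    rw [twoSymbol, if_neg (natCast_ne_neg_one l), Int.natAbs_natCast]

theorem signedProd_inj {σ' : Bool} {S' : Finset ℕ} (hS : ∀ k ∈ S, k.Prime)
    (hS' : ∀ k ∈ S', k.Prime) (he : signedProd σ S = signedProd σ' S') : σ = σ' ∧ S = S' := by
  have hpos : ∀ {T : Finset ℕ}, (∀ k ∈ T, k.Prime) → 0 < ∏ k ∈ T, k := fun hT =>
    Finset.prod_pos fun k hk => (hT k hk).pos
  have h1 := hpos hS
  have h2 := hpos hS'
  rw [signedProd, signedProd] at he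
  have h3 : σ = σ' ∧ ∏ k ∈ S, k = ∏ k ∈ S', k := by
    generalize ∏ k ∈ S, k = s at *
    generalize ∏ k ∈ S', k = s' at *
    cases σ <;> cases σ' <;>
      simp only [sign, if_true, if_false, Bool.false_eq_true, true_and, false_and] at he ⊢ <;> omega
  refine ⟨h3.1, ?_⟩
  rw [← Nat.primeFactors_prod hS, h3.2, Nat.primeFactors_prod hS']

theorem exists_eq_mul_signedProd {n : ℤ} (hn : Squarefree n) :
    ∃ ε : ℤ, (ε = 1 ∨ ε = 2) ∧ ∃ σ, n = ε * signedProd σ (n.natAbs.primeFactors.erase 2) := by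
  have hsf : Squarefree n.natAbs := Int.squarefree_natAbs.2 hn
  have hsign : ∃ σ, n = sign σ * n.natAbs := by
    rcases Int.natAbs_eq n with e | e
    · exact ⟨false, by simpa [sign] using e⟩
    · exact ⟨true, by simpa [sign] using e⟩
  obtain ⟨σ, hσ⟩ := hsign
  have hprod := Nat.prod_primeFactors_of_squarefree hsf
  by_cases h2 : 2 ∈ n.natAbs.primeFactors
  · refine ⟨2, Or.inr rfl, σ, ?_⟩
    rw [← Finset.mul_prod_erase _ _ h2] at hprod
    rw [signedProd, mul_left_comm]
    have e : (2 : ℤ) * (∏ k ∈ n.natAbs.primeFactors.erase 2, k : ℕ) = n.natAbs := by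
      exact_mod_cast hprod
    rw [e, ← hσ]
  · refine ⟨1, Or.inl rfl, σ, ?_⟩
    rw [Finset.erase_eq_of_notMem h2, signedProd, hprod, one_mul, ← hσ]

/-- At odd primes not dividing D a soluble n has even valuation, and at the D_k with k > s it is a
square; neither is possible for a prime dividing n exactly once. -/
theorem mem_plusPrimes_of_dvd (h : Admissible m p q D) {n : ℤ} (hn : Squarefree n) {l : ℕ}
    [hl : Fact l.Prime] (hl2 : l ≠ 2) (hln : (l : ℤ) ∣ n) (hL : LocalPoint ℚ_[l] p q D n) :
    l ∈ plusPrimes p q D := by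
  have hlD : (l : ℤ) ∣ D := by
    by_contra hlD
    exact LocalPoint.not_dvd_of_not_dvd hl2 (h.not_dvd_q_sub_p hl.1 hl2) hlD hn hL hln
  have hlD' : l ∈ D.primeFactors := Nat.mem_primeFactors.2
    ⟨hl.1, Int.natCast_dvd_natCast.1 hlD, h.squarefree.ne_zero⟩
  refine (h.mem_plus_or_minus hlD').resolve_right fun hlm => ?_
  exact not_dvd_of_isSquare hn (h.isSquare_of_localPoint (Or.inr (Or.inr hlm)) hL) hln

/-- Odd soluble integers come from even partitions; even ones come from quasi-even partitions,
provided the condition at 2 permits any. -/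
theorem setOf_everywhereSolvable_eq (h : Admissible m p q D) :
    {n : ℤ | Squarefree n ∧ TwoIsogeny.EverywhereSolvable (-(p + q) * D) (p * q * D ^ 2) n} =
      (fun x : Bool × Finset ℕ => 1 * signedProd x.1 x.2) '' {x | Good m p q D (fun _ => 1) x} ∪
      (fun x : Bool × Finset ℕ => 2 * signedProd x.1 x.2) ''
        {x | ¬ OnlyEven m p D ∧ Good m p q D (twoSymbol m p q D) x} := by
  ext n
  constructor
  · rintro ⟨hn, hE⟩
    obtain ⟨ε, hε, σ, he⟩ := exists_eq_mul_signedProd hn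
    have hS : n.natAbs.primeFactors.erase 2 ⊆ plusPrimes p q D := fun l hl => by
      rw [Finset.mem_erase, Nat.mem_primeFactors] at hl
      have : Fact l.Prime := ⟨hl.2.1⟩
      exact h.mem_plusPrimes_of_dvd hn hl.1 (Int.natCast_dvd.2 hl.2.2.1)
        ((everywhereSolvable_iff_localPoint.1 hE).1 l)
    generalize n.natAbs.primeFactors.erase 2 = S at he hS
    subst he
    rcases hε with rfl | rfl
    · exact Or.inl ⟨(σ, S), (h.good_one_iff hS).2 hE, rfl⟩
    · exact Or.inr ⟨(σ, S), (h.good_twoSymbol_iff hS).2 hE, rfl⟩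
  · rintro (⟨⟨σ, S⟩, hx, rfl⟩ | ⟨⟨σ, S⟩, hx, rfl⟩)
    · exact ⟨h.squarefree_mul_signedProd hx.1 (Or.inl rfl), (h.good_one_iff hx.1).1 hx⟩
    · exact ⟨h.squarefree_mul_signedProd hx.2.1 (Or.inr rfl), (h.good_twoSymbol_iff hx.2.1).1 hx⟩

theorem card_selmerE (h : Admissible m p q D) :
    Nat.card (selmerE (-1) p q D) = evenCount m p q D +
      {x | ¬ OnlyEven m p D ∧ Good m p q D (twoSymbol m p q D) x}.ncard := by
  have ha : (((-1 : ℤ) : ℚ) * p * D + ((-1 : ℤ) : ℚ) * q * D) = -(p + q) * D := by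
    push_cast
    ring
  have hb : (((-1 : ℤ) : ℚ) * p * D) * (((-1 : ℤ) : ℚ) * q * D) = p * q * D ^ 2 := by
    push_cast
    ring
  have hc : (-(p + q) * D : ℚ) ^ 2 - 4 * (p * q * D ^ 2) = ((q - p) * D) ^ 2 := by ring
  have hp : (p : ℚ) ≠ 0 := by exact_mod_cast h.prime_p.ne_zero
  have hq : (q : ℚ) ≠ 0 := by exact_mod_cast h.prime_q.ne_zero
  have hD : (D : ℚ) ≠ 0 := by exact_mod_cast h.squarefree.ne_zero
  have hpq : (q : ℚ) - p ≠ 0 := sub_ne_zero.2 (by exact_mod_cast h.p_ne_q.symm)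
  rw [selmerE, ha, hb, TwoIsogeny.card_selmerPhi (by rw [hc]; positivity) hc,
    h.setOf_everywhereSolvable_eq, h.evenCount_eq, Set.ncard_union_eq ?_
      ((finite_good _).image _) (((finite_good _).subset fun _ hx => hx.2).image _),
    Set.InjOn.ncard_image, Set.InjOn.ncard_image]
  · rintro ⟨σ, S⟩ hx ⟨σ', S'⟩ hx' he
    have h1 := signedProd_inj (prime_of_mem hx.2.1) (prime_of_mem hx'.2.1)
      (mul_left_cancel₀ two_ne_zero he)
    exact Prod.ext h1.1 h1.2
  · rintro ⟨σ, S⟩ hx ⟨σ', S'⟩ hx' he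
    have h1 := signedProd_inj (prime_of_mem hx.1) (prime_of_mem hx'.1)
      (mul_left_cancel₀ one_ne_zero he)
    exact Prod.ext h1.1 h1.2
  -- Signed products are odd, so the two families are told apart by parity.
  · rw [Set.disjoint_left]
    rintro _ ⟨⟨σ, S⟩, hx, rfl⟩ ⟨⟨σ', S'⟩, hx', he⟩
    have h1 := h.signedProd_mod_two (σ := σ) (S := S) hx.1
    have he' : 2 * signedProd σ' S' = 1 * signedProd σ S := he
    omega

end Admissible

end GraphMinus

theorem theorem1p3 (m p q D : ℕ) (hm : 1 ≤ m)
    (hp : p.Prime) (hp2 : p ≠ 2) (hq : q.Prime) (hq2 : q ≠ 2) (hpq : q = p + 2 ^ m)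
    (hD : Squarefree D) (h2D : ¬ 2 ∣ D) (hpD : ¬ p ∣ D) (hqD : ¬ q ∣ D) :
    (GraphMinus.OnlyEven m p D →
      Nat.card (selmerE (-1) p q D) = GraphMinus.evenCount m p q D) ∧
    (¬ GraphMinus.OnlyEven m p D →
      Nat.card (selmerE (-1) p q D) =
        GraphMinus.evenCount m p q D + GraphMinus.quasiEvenCount m p q D) := by
  have h : GraphMinus.Admissible m p q D := ⟨hm, hp, hp2, hq, hq2, hpq, hD, h2D, hpD, hqD⟩
  rw [h.card_selmerE, h.quasiEvenCount_eq]
  constructor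
  · intro hO
    simp [hO]
  · intro hO
    simp [hO]
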